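/- **Setting.** Let $f=(f^1,\dots,f^d)$ with $f^l\in C^1(\mathbb R^N,\mathbb R^N)$, and let $D=\mathbb R^d\times[0,\infty)$. A *Young measure* on a Borel set $X$ is a map $\nu:z\mapsto\nu_z$ into the probability measures on $\mathbb R^N$ with $z\mapsto\langle\nu_z,g\rangle=\int g\,d\nu_z$ measurable for all $g\in C_0(\mathbb R^N)$; $\nu^n\rightharpoonup\nu$ weak* on $X$ means $\int_X\psi\langle\nu^n,g\rangle\,dz\to\int_X\psi\langle\nu,g\rangle\,dz$ for all $\psi\in L^1(X)$, $g\in C_0(\mathbb R^N)$. An *entropy pair* $(\eta,q)$ consists of a convex $\eta:\mathbb R^N\to\mathbb R$ and a locally Lipschitz $q=(q^1,\dots,q^d)$ with $q'=\eta'f'$ almost everywhere. Let $\mathcal E$ be a set of entropy pairs (for instance all of them) and $\sigma$ a Young measure on $\mathbb R^d$ such that $x\mapsto\langle\sigma_x,|\xi|\rangle$ and $x\mapsto\langle\sigma_x,|\eta|\rangle$, $(\eta,q)\in\mathcal E$, are integrable on compact sets. An *EMV solution* of $\partial_tu+\nabla_x\cdot f(u)=0$ with initial data $\sigma$ (with respect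 to $\mathcal E$) is a Young measure $\nu$ on $D$ such that $$\int_D\partial_t\varphi\,\langle\nu,\mathrm{id}\rangle+\nabla_x\varphi\cdot\langle\nu,f\rangle\,dx\,dt+\int_{\mathbb R^d}\varphi(x,0)\langle\sigma_x,\mathrm{id}\rangle\,dx=0\qquad\forall\varphi\in C^1_c(D),$$ $$\int_D\partial_t\varphi\,\langle\nu,\eta\rangle+\nabla_x\varphi\cdot\langle\nu,q\rangle\,dx\,dt+\int_{\mathbb R^d}\varphi(x,0)\langle\sigma_x,\eta\rangle\,dx\ge0\qquad\forall\,0\le\varphi\in C^1_c(D),\ (\eta,q)\in\mathcal E.$$ *Scheme.* For $\Delta x>0$ take the Cartesian mesh with widths $\Delta x_l=c_l\Delta x$ ($c_l>0$ fixed) and cells $\prod_l[(i_l-\frac12)\Delta x_l,(i_l+\frac12)\Delta x_l)$, $i\in\mathbb Z^d$; grid functions are identified with functions that are constant on cells. The scheme is $$\frac{d}{dt}u_i+\sum_{l=1}^d\frac1{\Delta x_l}\bigl(F^{l}_{i+e_l/2}-F^{l}_{i-e_l/2}\bigr)=0,\qquad u_i(0)=u_{0,i},$$ integrated exactly in time.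 Here $F^l_{i+e_l/2}$ is a function (which may depend on $\Delta x$) of the values $u_{i+m}$, $m\in\{-p+1,\dots,p\}^d$, for a fixed $p\ge1$, and is consistent with $f$ and locally Lipschitz: for every compact $K\subset\mathbb R^N$ there is a constant $C_K$, independent of $\Delta x$, with $|F^l_{i+e_l/2}-f^l(u_i)|\le C_K\sum_m|u_{i+m}-u_i|$ whenever all these values lie in $K$. Let $\mathcal S^{\Delta x}$ be a (jointly measurable in data and time) evolution operator of the scheme, mapping grid data to a solution for all data that occur below. Let $u_0^{\Delta x}$ be random grid data on a probability space $(\Omega,P)$, $u^{\Delta x}(\omega)=\mathcal S^{\Delta x}u_0^{\Delta x}(\omega)$, and let $\sigma^{\Delta x}$ be the law of $u_0^{\Delta x}$, i.e. $\sigma^{\Delta x}_x(B)=P(u_0^{\Delta x}(x)\in B)$. Assume: * (boundedness) $\|u^{\Delta x}(\omega)\|_{L^\infty(D)}\le C$ for all $\omega$ and $\Delta x>0$; * (weak BV) for some $1\le r<\infty$, all $T>0$ and all $\omega$, $\int_0^T\sum_i\sum_l|u^{\Delta x}_{i+e_l}-u^{\Delta x}_i|^r\,\prod_k\Delta x_k\,dt\to0$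 as $\Delta x\to0$; * (entropy consistency) for each $(\eta,q)\in\mathcal E$ there are numerical entropy fluxes $Q^l$, consistent with $q^l$ and locally Lipschitz in the above sense, with $\frac d{dt}\eta(u_i^{\Delta x})+\sum_l\frac1{\Delta x_l}(Q^l_{i+e_l/2}-Q^l_{i-e_l/2})\le0$ for a.e. $t>0$ and all $i$, $\omega$, $\Delta x$; * (initial data) $\int\psi\langle\sigma^{\Delta x},\mathrm{id}\rangle\,dx\to\int\psi\langle\sigma,\mathrm{id}\rangle\,dx$ for all $\psi\in C^1_c(\mathbb R^d)$, and $\limsup_{\Delta x\to0}\int\psi\langle\sigma^{\Delta x},\eta\rangle\,dx\le\int\psi\langle\sigma,\eta\rangle\,dx$ for all $0\le\psi\in C_c^1(\mathbb R^d)$ and $(\eta,q)\in\mathcal E$. *Monte Carlo approximation.* For each $\Delta x>0$ let $u_0^{\Delta x,k}$, $k=1,2,\dots$, be independent copies of $u_0^{\Delta x}$ on a probability space $(\Omega',P')$ (nothing is assumed about samples for different $\Delta x$), let $u^{\Delta x,k}=\mathcal S^{\Delta x}u_0^{\Delta x,k}$, and $\nu^{\Delta x,M}=\frac1M\sum_{k=1}^M\delta_{u^{\Delta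 x,k}}$. **Claim.** Every sequence of mesh sizes tending to $0$ has a subsequence $\Delta x_n\to0$ for which there is a uniformly bounded EMV solution $\nu$ with initial data $\sigma$ (with respect to $\mathcal E$) such that: 1. there are (non-random) positive integers $M_n\to\infty$, strictly increasing, such that $P'$-almost surely $\nu^{\Delta x_n,M_n}\rightharpoonup\nu$ weak* on $D$; 2. $P'$-almost surely, for all $\psi\in L^1(D)$ and $g\in C(\mathbb R^N)$, $$\lim_{n\to\infty}\lim_{M\to\infty}\frac1M\sum_{k=1}^M\int_D\psi\,g(u^{\Delta x_n,k})\,dx\,dt=\int_D\psi\,\langle\nu,g\rangle\,dx\,dt ,$$ all these limits existing; 3. the two limits are interchangeable: for all $\psi\in L^1(D)$, $g\in C(\mathbb R^N)$, with $A_{n,M}=\frac1M\sum_{k=1}^M\int_D\psi\,g(u^{\Delta x_n,k})\,dx\,dt$ and $I=\int_D\psi\langle\nu,g\rangle\,dx\,dt$, (a) $A_{n,M}\to I$ in $L^2(P')$ as $n,M\to\infty$ jointly; (b) $\lim_{M\to\infty}\lim_{n\to\infty}\mathbb E\,b(A_{n,M})=b(I)$ for every bounded continuous $b:\mathbb R\to\mathbb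 R$, all these limits existing; (c) if for every $M$ the limit $B_M=\lim_{n\to\infty}A_{n,M}$ exists in probability, then $\lim_{M\to\infty}B_M=I$ $P'$-almost surely. -/

import Mathlib

open MeasureTheory ProbabilityTheory Filter Topology Set
open scoped ENNReal ZeroAtInfty BoundedContinuousFunction

noncomputable section

namespace EMV

/-- Euclidean space `ℝᵏ`. -/
abbrev E (k : ℕ) : Type := EuclideanSpace ℝ (Fin k)

/-- Indices of the cells of a Cartesian mesh of `ℝᵈ`. -/
abbrev Grid (d : ℕ) : Type := Fin d → ℤ

/-! ### Young measures -/

section Young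

variable {X : Type*} [MeasurableSpace X] {N : ℕ}

/-- A Young measure from `X` to `ℝᴺ`: a weak* measurable map into the probability measures. -/
def IsYoungMeasure (ν : X → Measure (E N)) : Prop :=
  (∀ z, IsProbabilityMeasure (ν z)) ∧ ∀ g : C₀(E N, ℝ), Measurable fun z => ∫ ξ, g ξ ∂(ν z)

/-- All the measures `ν z` are carried by one compact set. -/
def IsUniformlyBounded (ν : X → Measure (E N)) : Prop :=
  ∃ K : Set (E N), IsCompact K ∧ ∀ z, ν z Kᶜ = 0

/-- Weak* convergence of Young measures on the measure space `(X, μ)`. -/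
def WeakStarTendsto (μ : Measure X) (νs : ℕ → X → Measure (E N)) (ν : X → Measure (E N)) : Prop :=
  ∀ g : C₀(E N, ℝ), ∀ ψ : X → ℝ, Integrable ψ μ →
    Tendsto (fun n => ∫ z, ψ z * (∫ ξ, g ξ ∂(νs n z)) ∂μ) atTop
      (𝓝 (∫ z, ψ z * (∫ ξ, g ξ ∂(ν z)) ∂μ))

/-- The law of the random field `U`, i.e. the map `z ↦ (F ↦ P (U z ∈ F))`. -/
def law {Ω : Type*} [MeasurableSpace Ω] (P : Measure Ω) (U : Ω → X → E N) (z : X) :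
    Measure (E N) :=
  P.map fun ω => U ω z

/-- The empirical measure `(1 / M) ∑_{k < M} δ_{U k z}` of the fields `U 0, …, U (M - 1)`. -/
def empirical (U : ℕ → X → E N) (M : ℕ) (z : X) : Measure (E N) :=
  (M : ℝ≥0∞)⁻¹ • ∑ k ∈ Finset.range M, Measure.dirac (U k z)

end Young

/-- Lebesgue measure on the space-time domain `ℝᵈ × [0, ∞)`. Functions on the domain are
represented by functions on `ℝᵈ × ℝ`, whose values at negative times play no role. -/
def spaceTime (d : ℕ) : Measure (E d × ℝ) := volume.restrict (univ ×ˢ Ici 0)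

/-! ### Entropy measure-valued solutions of `∂ₜ u + ∇ₓ · f(u) = 0` -/

section Solutions

variable {d N : ℕ}

/-- An entropy pair for the flux `f = (f¹, …, fᵈ)`: `η` is convex and `q' = η' f'`.
Nonsmooth convex functions are allowed (they are differentiable almost everywhere); when `η` is
differentiable everywhere, and `f` is `C¹`, this is the identity `q' = η' f'` at every point. -/
structure EntropyPair (f : Fin d → E N → E N) where
  η : E N → ℝ
  q : Fin d → E N → ℝ
  convex : ConvexOn ℝ univ η
  lipschitz : ∀ l, LocallyLipschitz (q l)
  compat : ∀ᵐ ξ ∂(volume : Measure (E N)), ∀ l,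
    HasFDerivAt (q l) ((fderiv ℝ η ξ).comp (fderiv ℝ (f l) ξ)) ξ

/-- The time derivative of `φ` at `z`. -/
def dt (φ : E d × ℝ → ℝ) (z : E d × ℝ) : ℝ := fderiv ℝ φ z (0, 1)

/-- The partial derivative of `φ` at `z` in the `l`-th space direction. -/
def dx (l : Fin d) (φ : E d × ℝ → ℝ) (z : E d × ℝ) : ℝ :=
  fderiv ℝ φ z (EuclideanSpace.single l 1, 0)

/-- `ν` is a measure-valued solution with initial data `σ`. Test functions in
`C¹_c(ℝᵈ × [0, ∞))` are the restrictions of functions in `C¹_c(ℝᵈ × ℝ)`. -/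
def IsMVSolution (f : Fin d → E N → E N) (σ : E d → Measure (E N))
    (ν : E d × ℝ → Measure (E N)) : Prop :=
  ∀ φ : E d × ℝ → ℝ, ContDiff ℝ 1 φ → HasCompactSupport φ →
    ∫ z, (dt φ z • (∫ ξ, ξ ∂(ν z)) + ∑ l, dx l φ z • (∫ ξ, f l ξ ∂(ν z))) ∂(spaceTime d)
      + ∫ x, φ (x, 0) • (∫ ξ, ξ ∂(σ x)) = 0

/-- The entropy inequality for the pair `e`. -/
def EntropyInequality {f : Fin d → E N → E N} (e : EntropyPair f) (σ : E d → Measure (E N))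
    (ν : E d × ℝ → Measure (E N)) : Prop :=
  ∀ φ : E d × ℝ → ℝ, ContDiff ℝ 1 φ → HasCompactSupport φ → (∀ x t, 0 ≤ t → 0 ≤ φ (x, t)) →
    0 ≤ ∫ z, (dt φ z * (∫ ξ, e.η ξ ∂(ν z)) + ∑ l, dx l φ z * (∫ ξ, e.q l ξ ∂(ν z))) ∂(spaceTime d)
      + ∫ x, φ (x, 0) * (∫ ξ, e.η ξ ∂(σ x))

/-- `ν` is an entropy measure-valued solution with initial data `σ`, the entropy inequality being
required for the entropy pairs in `𝓔`; the unrestricted notion is the case `𝓔 = univ`. -/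
def IsEMVSolution (f : Fin d → E N → E N) (𝓔 : Set (EntropyPair f)) (σ : E d → Measure (E N))
    (ν : E d × ℝ → Measure (E N)) : Prop :=
  IsYoungMeasure ν ∧ IsMVSolution f σ ν ∧ ∀ e ∈ 𝓔, EntropyInequality e σ ν

/-- `x ↦ ⟨σ_x, |h|⟩` is integrable on compact sets. -/
def LocallyIntegrablePairing {V : Type*} [NormedAddCommGroup V] (σ : E d → Measure (E N))
    (h : E N → V) : Prop :=
  ∀ B : Set (E d), IsCompact B → ∫⁻ x in B, (∫⁻ ξ, ‖h ξ‖ₑ ∂(σ x)) < ⊤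

end Solutions

/-! ### Finite volume schemes -/

section Scheme

variable {d N p : ℕ}

/-- The offsets `{-p + 1, …, p}ᵈ` of the stencil of a numerical flux. -/
abbrev Stencil (d p : ℕ) : Type := Fin d → Finset.Icc (1 - (p : ℤ)) (p : ℤ)

/-- A stencil offset as a grid vector. -/
def Stencil.toGrid (m : Stencil d p) : Grid d := fun l => (m l : ℤ)

/-- The mesh widths `Δx_l = c_l Δx`, with fixed ratios `c_l`. -/
def width (c : Fin d → ℝ) (Δx : ℝ) (l : Fin d) : ℝ := c l * Δx

/-- The index `i` of the cell `∏_l [(i_l - 1/2) w_l, (i_l + 1/2) w_l)` that contains `x`. -/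
def cellIndex (w : Fin d → ℝ) (x : E d) : Grid d := fun l => ⌊x l / w l + 1 / 2⌋

/-- The function on `ℝᵈ` that is constant on cells, with the given values. -/
def cellwise (w : Fin d → ℝ) (v : Grid d → E N) (x : E d) : E N := v (cellIndex w x)

/-- The function on space-time that is constant on cells at every time. -/
def cellwiseST (w : Fin d → ℝ) (u : Grid d → ℝ → E N) (z : E d × ℝ) : E N :=
  u (cellIndex w z.1) z.2

/-- The numerical flux in direction `l` through the face between the cells `i` and `i + e_l`. -/
def faceFlux {V : Type*} (F : Fin d → (Stencil d p → E N) → V) (u : Grid d → ℝ → E N)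
    (l : Fin d) (i : Grid d) (t : ℝ) : V :=
  F l fun m => u (i + m.toGrid) t

/-- The numerical fluxes `F Δx` are consistent with `f` and locally Lipschitz:
`|F_{i+1/2} - f(u_i)| ≤ C ∑_j |u_j - u_i|` (sum over the stencil) for values in a compact set,
uniformly in the mesh size. -/
def IsConsistentFlux {V : Type*} [NormedAddCommGroup V]
    (F : ℝ → Fin d → (Stencil d p → E N) → V) (f : Fin d → E N → V) : Prop :=
  1 ≤ p ∧ ∀ K : Set (E N), IsCompact K → ∃ C : ℝ, ∀ Δx > 0, ∀ (l : Fin d) (v : Grid d → E N),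
    (∀ m : Stencil d p, v m.toGrid ∈ K) →
      ‖F Δx l (fun m => v m.toGrid) - f l (v 0)‖ ≤ C * ∑ m : Stencil d p, ‖v m.toGrid - v 0‖

/-- `u` solves the semi-discrete scheme with mesh widths `w`, numerical fluxes `F` and initial
values `v`, integrated exactly in time. -/
def IsSchemeSolution (w : Fin d → ℝ) (F : Fin d → (Stencil d p → E N) → E N)
    (v : Grid d → E N) (u : Grid d → ℝ → E N) : Prop :=
  ∀ (i : Grid d) (t : ℝ), 0 ≤ t →
    (∀ l, IntervalIntegrable (faceFlux F u l i) volume 0 t) ∧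
    u i t = v i - ∑ l, (w l)⁻¹ •
      ∫ τ in (0 : ℝ)..t, (faceFlux F u l i τ - faceFlux F u l (i - Pi.single l 1) τ)

variable {Ω : Type*}

/-- The weak BV condition with exponent `r`. -/
def WeakBV (c : Fin d → ℝ) (r : ℝ) (U : ℝ → Ω → Grid d → ℝ → E N) : Prop :=
  ∀ T > 0, ∀ ω, Tendsto (fun Δx : ℝ => ∫⁻ t in Icc 0 T, ∑' i : Grid d,
      (∑ l, ‖U Δx ω (i + Pi.single l 1) t - U Δx ω i t‖ₑ ^ r)
        * ENNReal.ofReal (∏ l, width c Δx l)) (𝓝[>] 0) (𝓝 0)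

/-- Entropy stability with respect to `e`: a discrete entropy inequality holds with a numerical
entropy flux that is consistent with `e.q` and locally Lipschitz. (The approximations are Lipschitz
in time, hence differentiable at almost every time.) -/
def IsEntropyStable {f : Fin d → E N → E N} (c : Fin d → ℝ) (U : ℝ → Ω → Grid d → ℝ → E N)
    (e : EntropyPair f) : Prop :=
  ∃ (s : ℕ) (Q : ℝ → Fin d → (Stencil d s → E N) → ℝ), IsConsistentFlux Q e.q ∧
    ∀ Δx > 0, ∀ (ω : Ω) (i : Grid d), ∀ᵐ t ∂(volume.restrict (Ioi (0 : ℝ))),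
      deriv (fun τ => e.η (U Δx ω i τ)) t + ∑ l, (width c Δx l)⁻¹ *
        (faceFlux (Q Δx) (U Δx ω) l i t - faceFlux (Q Δx) (U Δx ω) l (i - Pi.single l 1) t) ≤ 0

/-- Consistency of the approximate initial laws `σs Δx` with `σ`: convergence of the means. -/
def InitialMeanConsistent (σs : ℝ → E d → Measure (E N)) (σ : E d → Measure (E N)) : Prop :=
  ∀ ψ : E d → ℝ, ContDiff ℝ 1 ψ → HasCompactSupport ψ →
    Tendsto (fun Δx => ∫ x, ψ x • (∫ ξ, ξ ∂(σs Δx x))) (𝓝[>] 0)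
      (𝓝 (∫ x, ψ x • (∫ ξ, ξ ∂(σ x))))

/-- Consistency of the approximate initial laws `σs Δx` with `σ` for the entropy `η`. -/
def InitialEntropyConsistent (σs : ℝ → E d → Measure (E N)) (σ : E d → Measure (E N))
    (η : E N → ℝ) : Prop :=
  ∀ ψ : E d → ℝ, ContDiff ℝ 1 ψ → HasCompactSupport ψ → (∀ x, 0 ≤ ψ x) →
    limsup (fun Δx => ((∫ x, ψ x * (∫ ξ, η ξ ∂(σs Δx x)) : ℝ) : EReal)) (𝓝[>] 0)
      ≤ ((∫ x, ψ x * (∫ ξ, η ξ ∂(σ x)) : ℝ) : EReal)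

/-- The sample average `(1 / M) ∑_{k < M} ∫ ψ g(U k)` over space-time. -/
def sampleAverage (ψ : E d × ℝ → ℝ) (g : E N → ℝ) (U : ℕ → E d × ℝ → E N) (M : ℕ) : ℝ :=
  (M : ℝ)⁻¹ * ∑ k ∈ Finset.range M, ∫ z, ψ z * g (U k z) ∂(spaceTime d)

end Scheme

end EMV

end

open EMV

/-! Two independent mechanisms are at work: the laws of the approximations converge to an EMV
solution, and averages of bounded i.i.d. samples are close to their expectations at a rate that does
not depend on the mesh.

Compactness. All values lie in one ball `K`. The joint laws of (space-time point, value of the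
field), taken under a probability measure equivalent to `spaceTime`, are tight and have a fixed
first marginal. Prokhorov's theorem and disintegration give a Markov kernel `κ` with E ∫ ψ g(u) → ∫
ψ ⟨κ, g⟩ along a subsequence (`exists_subseq_youngMeasure`).

Consistency. For fixed ω the discrete entropy inequality is tested with φ, and the differences are
moved onto φ by summation by parts in space and integration by parts in time. Replacing the
numerical fluxes by the exact ones costs a sum of differences over the stencil. Weak BV makes these
vanish in L¹ on bounded sets (`tendsto_lintegral_sub`), hence the weak form is bounded below by a
null sequence (`weakForm_lower_bound`). The conservation law is the same statement for the
coordinate functions, where the inequality is an equality and both φ and -φ are admissible. The null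
sequence depends on ω, so expectations are taken by dominated convergence for the negative part
(`eventually_neg_le_integral`). The weak form is linear in the law, so its expected value passes to
the limit `κ`, and the initial term only sees the laws `σ^Δx`.

Monte Carlo. Each number ∫ ψ g(u^k) is bounded by some `R` depending on ψ and g only, so an average
of `M` of them has variance at most R² / M for every mesh size. This gives the joint limit in mean
square, and almost sure convergence for M = (n + 1)², since the variances are then summable; nothing
is needed about samples on different meshes. For fixed mesh the strong law applies. A countable
dense family of pairs (ψ, g) leaves a single exceptional null set for all of them.

Reversed order. Convergence of means does not determine the limit law of an average with fixed `M`.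
A further subsequence is chosen along which all moments of all pairings converge
(`exists_subseq_moments`). By independence the moments of finite sums converge as well, and
Weierstrass approximation yields convergence of E b(A) for continuous `b`. If the inner limits `B M`
exist in probability, they inherit the variance bound and the increment bound of averages. The
former gives almost sure convergence along the squares, the latter fills the gaps
(`tendsto_of_tendsto_squares`). -/

namespace EMV

/-! ### Averages of triangular arrays of bounded random variables -/

section Arrays

variable {Ω : Type*}

/-- The average of the first `M` terms of a sequence of random variables. -/
noncomputable def avg (Y : ℕ → Ω → ℝ) (M : ℕ) (ω : Ω) : ℝ :=
  (M : ℝ)⁻¹ * ∑ k ∈ Finset.range M, Y k ω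

theorem measurable_avg [MeasurableSpace Ω] {Y : ℕ → Ω → ℝ} (hY : ∀ k, Measurable (Y k)) (M : ℕ) :
    Measurable (avg Y M) := by
  unfold avg
  fun_prop

theorem mul_avg (Y : ℕ → Ω → ℝ) (M : ℕ) (ω : Ω) :
    M * avg Y M ω = ∑ k ∈ Finset.range M, Y k ω := by
  rcases eq_or_ne M 0 with rfl | h
  · simp
  · have : (M : ℝ) ≠ 0 := by exact_mod_cast h
    unfold avg
    field_simp

theorem abs_avg_le {Y : ℕ → Ω → ℝ} {R : ℝ} (hR : 0 ≤ R) (hbd : ∀ k ω, |Y k ω| ≤ R) (M : ℕ)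
    (ω : Ω) : |avg Y M ω| ≤ R := by
  rcases eq_or_ne M 0 with rfl | h
  · simpa [avg] using hR
  · have hM : (0 : ℝ) < M := by exact_mod_cast Nat.pos_of_ne_zero h
    have h1 : |∑ k ∈ Finset.range M, Y k ω| ≤ M * R := by
      refine (Finset.abs_sum_le_sum_abs _ _).trans
        ((Finset.sum_le_sum fun k _ => hbd k ω).trans (by simp))
    unfold avg
    rw [abs_mul, abs_of_pos (inv_pos.2 hM), inv_mul_le_iff₀ hM]
    exact h1

/-- After multiplication by the sample number only the terms between `M` and `M'` remain. The bound
is pathwise and survives limits, which is how it reaches the limits `B M` later on. -/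
theorem abs_mul_avg_sub_le {Y : ℕ → Ω → ℝ} {R : ℝ} (hbd : ∀ k ω, |Y k ω| ≤ R) {M M' : ℕ}
    (h : M ≤ M') (ω : Ω) : |M' * avg Y M' ω - M * avg Y M ω| ≤ (M' - M) * R := by
  rw [mul_avg, mul_avg, ← Finset.sum_sdiff_eq_sub (Finset.range_mono h)]
  refine (Finset.abs_sum_le_sum_abs _ _).trans
    ((Finset.sum_le_sum fun k _ => hbd k ω).trans ?_)
  rw [Finset.sum_const, Finset.card_sdiff_of_subset (Finset.range_mono h)]
  simp [Nat.cast_sub h]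

variable [MeasurableSpace Ω] {P : Measure Ω}

theorem integrable_of_abs_le [IsFiniteMeasure P] {f : Ω → ℝ} {R : ℝ} (hf : Measurable f)
    (h : ∀ ω, |f ω| ≤ R) : Integrable f P :=
  Integrable.of_bound hf.aestronglyMeasurable R (ae_of_all _ h)

/-- The variance bound for averages. -/
theorem integral_avg_sub_sq_le [IsProbabilityMeasure P] {Y : ℕ → Ω → ℝ} {R : ℝ}
    (hY : ∀ k, Measurable (Y k)) (hbd : ∀ k ω, |Y k ω| ≤ R) (hind : iIndepFun Y P)
    (hid : ∀ k, IdentDistrib (Y k) (Y 0) P P) {M : ℕ} (hM : 0 < M) :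
    ∫ ω, (avg Y M ω - ∫ ω, Y 0 ω ∂P) ^ 2 ∂P ≤ R ^ 2 / M := by
  have hM' : (0 : ℝ) < M := by exact_mod_cast hM
  have hmem : ∀ k, MemLp (Y k) 2 P := fun k =>
    MemLp.of_bound (hY k).aestronglyMeasurable R (ae_of_all _ (hbd k))
  have hmean : ∫ ω, avg Y M ω ∂P = ∫ ω, Y 0 ω ∂P := by
    unfold avg
    rw [integral_const_mul, integral_finsetSum _
      fun k _ => integrable_of_abs_le (hY k) (hbd k)]
    rw [Finset.sum_congr rfl fun k _ => (hid k).integral_eq]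
    simp only [Finset.sum_const, Finset.card_range, nsmul_eq_mul]
    field_simp
  have hvar : Var[avg Y M; P] ≤ R ^ 2 / M := by
    have h1 : avg Y M = fun ω => (M : ℝ)⁻¹ * (∑ k ∈ Finset.range M, Y k) ω := by
      ext ω; simp [avg]
    rw [h1, variance_const_mul, IndepFun.variance_sum (fun k _ => hmem k)
      fun i _ j _ hij => hind.indepFun hij]
    have h2 : ∀ k, Var[Y k; P] ≤ R ^ 2 := fun k => by
      -- Popoviciu's inequality on `[-R, R]`, an interval of half-length `R`.
      have := variance_le_sq_of_bounded (μ := P) (a := -R) (b := R) (X := Y k)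
        (ae_of_all _ fun ω => abs_le.1 (hbd k ω)) (hY k).aemeasurable
      linarith [show ((R - -R) / 2) ^ 2 = R ^ 2 by ring]
    have h3 := Finset.sum_le_sum fun k (_ : k ∈ Finset.range M) => h2 k
    rw [Finset.sum_const, Finset.card_range, nsmul_eq_mul] at h3
    calc (M : ℝ)⁻¹ ^ 2 * ∑ k ∈ Finset.range M, Var[Y k; P] ≤ (M : ℝ)⁻¹ ^ 2 * (M * R ^ 2) := by
          gcongr
      _ = R ^ 2 / M := by field_simp
  rwa [variance_eq_integral (measurable_avg hY M).aemeasurable, hmean] at hvar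

/-- Nonnegative random variables with summable expectations tend to zero almost surely. -/
theorem ae_tendsto_zero_of_summable_integral {f : ℕ → Ω → ℝ} (hf : ∀ n, Integrable (f n) P)
    (h0 : ∀ n ω, 0 ≤ f n ω) (hs : Summable fun n => ∫ ω, f n ω ∂P) :
    ∀ᵐ ω ∂P, Tendsto (fun n => f n ω) atTop (𝓝 0) := by
  -- By Tonelli the series has finite expectation, so it converges almost surely and its terms tend
  -- to zero.
  have h1 : ∫⁻ ω, ∑' n, ENNReal.ofReal (f n ω) ∂P ≠ ⊤ := by
    rw [lintegral_tsum fun n => (hf n).1.aemeasurable.ennreal_ofReal]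
    simp_rw [← ofReal_integral_eq_lintegral_ofReal (hf _) (ae_of_all _ (h0 _))]
    rw [← ENNReal.ofReal_tsum_of_nonneg (fun n => integral_nonneg (h0 n)) hs]
    exact ENNReal.ofReal_ne_top
  filter_upwards [ae_lt_top' (AEMeasurable.tsum
    fun n => (hf n).1.aemeasurable.ennreal_ofReal) h1] with ω hω
  have h2 := ENNReal.tendsto_atTop_zero_of_tsum_ne_top hω.ne
  have h3 := (ENNReal.tendsto_toReal ENNReal.zero_ne_top).comp h2
  simpa [Function.comp_def, ENNReal.toReal_ofReal (h0 _ _)] using h3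

theorem tendsto_of_tendsto_sq {f : ℕ → ℝ} (h : Tendsto (fun n => f n ^ 2) atTop (𝓝 0)) :
    Tendsto f atTop (𝓝 0) := by
  have := (Real.continuous_sqrt.tendsto 0).comp h
  simp only [Function.comp_def, Real.sqrt_sq_eq_abs, Real.sqrt_zero] at this
  exact (tendsto_zero_iff_abs_tendsto_zero _).2 this

/-- A sequence of averages of bounded terms converges if it converges along the squares. -/
theorem tendsto_of_tendsto_squares {b : ℕ → ℝ} {R I : ℝ}
    (h : ∀ M M' : ℕ, M ≤ M' → |M' * b M' - M * b M| ≤ (M' - M) * R)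
    (hI : Tendsto (fun m : ℕ => b (m ^ 2)) atTop (𝓝 I)) : Tendsto b atTop (𝓝 I) := by
  have hR : ∀ M : ℕ, 0 < M → |b M| ≤ R := fun M hM => by
    -- Comparison with the empty sum turns the increment bound into a bound on `b M` itself.
    have h1 := h 0 M (Nat.zero_le _)
    have hM' : (0 : ℝ) < M := by exact_mod_cast hM
    simp only [CharP.cast_eq_zero, zero_mul, sub_zero, abs_mul, abs_of_pos hM'] at h1
    exact le_of_mul_le_mul_left h1 hM'
  have hsq : Tendsto Nat.sqrt atTop atTop :=
    tendsto_atTop.2 fun m => eventually_atTop.2 ⟨m * m, fun M hM => Nat.le_sqrt.2 hM⟩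
  have h2 : Tendsto (fun M : ℕ => b (Nat.sqrt M ^ 2)) atTop (𝓝 I) := hI.comp hsq
  have h3 : Tendsto (fun M : ℕ => 4 * R / (Nat.sqrt M : ℝ)) atTop (𝓝 0) :=
    tendsto_const_nhds.div_atTop (tendsto_natCast_atTop_atTop.comp hsq)
  have h4 : Tendsto (fun M : ℕ => b M - b (Nat.sqrt M ^ 2)) atTop (𝓝 0) := by
    refine squeeze_zero_norm' ?_ h3
    filter_upwards [eventually_ge_atTop 1] with M hM
    -- With m² ≤ M ≤ m² + 2m, at most 2m terms are new. They enter once through the sum and once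
    -- through the changed normalisation, so the change is at most 4mR / m² = 4R / m.
    set m := Nat.sqrt M with hm
    have hm1 : 1 ≤ m := Nat.le_sqrt.2 (by simpa using hM)
    have hmM : m ^ 2 ≤ M := by rw [pow_two]; exact Nat.sqrt_le M
    have hMm : M ≤ m ^ 2 + 2 * m := by
      have := Nat.sqrt_le_add M
      rw [← hm] at this
      nlinarith
    have e1 := h _ _ hmM
    have e2 := hR _ (pow_pos hm1 2)
    have r1 : (1 : ℝ) ≤ m := by exact_mod_cast hm1
    have r2 : (m : ℝ) ^ 2 ≤ M := by exact_mod_cast hmM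
    have r3 : (M : ℝ) ≤ (m : ℝ) ^ 2 + 2 * m := by exact_mod_cast hMm
    have hR0 : 0 ≤ R := (abs_nonneg _).trans e2
    push_cast at e1
    rw [Real.norm_eq_abs, le_div_iff₀ (by linarith)]
    have hMpos : (0 : ℝ) < M := by nlinarith
    have e3 : M * |b M - b (m ^ 2)| ≤ 4 * m * R := by
      rw [← abs_of_pos hMpos, ← abs_mul]
      calc |M * (b M - b (m ^ 2))|
          = |(M * b M - m ^ 2 * b (m ^ 2)) + (m ^ 2 - M) * b (m ^ 2)| := by ring_nf
        _ ≤ |M * b M - m ^ 2 * b (m ^ 2)| + |((m : ℝ) ^ 2 - M) * b (m ^ 2)| := abs_add_le _ _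
        _ ≤ (M - m ^ 2) * R + (M - m ^ 2) * R := by
            refine add_le_add e1 ?_
            rw [abs_mul, abs_sub_comm, abs_of_nonneg (by linarith)]
            exact mul_le_mul_of_nonneg_left e2 (by linarith)
        _ ≤ 4 * m * R := by nlinarith
    have e4 : (m : ℝ) * (m * |b M - b (m ^ 2)|) ≤ m * (4 * R) := by
      have := mul_le_mul_of_nonneg_right r2 (abs_nonneg (b M - b (m ^ 2)))
      nlinarith
    have := le_of_mul_le_mul_left e4 (by linarith)
    linarith
  simpa using h4.add h2

/-- A sequence that is uniformly close to convergent sequences is Cauchy. The limit need not be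
known, as is the case for moments and for expectations of continuous functions. -/
theorem exists_tendsto_of_forall_approx {x : ℕ → ℝ}
    (h : ∀ ε > 0, ∃ y : ℕ → ℝ, (∀ n, |x n - y n| ≤ ε) ∧ ∃ ℓ, Tendsto y atTop (𝓝 ℓ)) :
    ∃ ℓ, Tendsto x atTop (𝓝 ℓ) := by
  refine cauchySeq_tendsto_of_complete (Metric.cauchySeq_iff.2 fun ε hε => ?_)
  obtain ⟨y, hxy, ℓ, hy⟩ := h (ε / 4) (by linarith)
  obtain ⟨n₀, hn₀⟩ := Metric.cauchySeq_iff.1 hy.cauchySeq (ε / 4) (by linarith)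
  refine ⟨n₀, fun m hm n hn => ?_⟩
  have h1 := hn₀ m hm n hn
  rw [Real.dist_eq] at h1 ⊢
  have h2 := abs_le.1 (hxy m)
  have h3 := abs_le.1 (hxy n)
  have h4 := abs_lt.1 h1
  exact abs_lt.2 ⟨by linarith, by linarith⟩

/-- A triangular array of bounded random variables that are independent and identically
distributed in every row, and whose means converge. -/
structure IsBoundedArray (P : Measure Ω) (Y : ℕ → ℕ → Ω → ℝ) (R I : ℝ) : Prop where
  meas : ∀ n k, Measurable (Y n k)
  nonneg : 0 ≤ R
  bdd : ∀ n k ω, |Y n k ω| ≤ R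
  indep : ∀ n, iIndepFun (Y n) P
  ident : ∀ n k, IdentDistrib (Y n k) (Y n 0) P P
  mean : Tendsto (fun n => ∫ ω, Y n 0 ω ∂P) atTop (𝓝 I)

namespace IsBoundedArray

variable {Y : ℕ → ℕ → Ω → ℝ} {R I : ℝ}

theorem abs_avg_sub_le (h : IsBoundedArray P Y R I) (n M : ℕ) (ω : Ω) {x : ℝ} (hx : |x| ≤ R) :
    |(avg (Y n) M ω - x) ^ 2| ≤ (2 * R) ^ 2 := by
  have h1 := abs_avg_le h.nonneg (h.bdd n) M ω
  rw [abs_pow]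
  exact pow_le_pow_left₀ (abs_nonneg _) ((abs_sub _ _).trans (by linarith)) 2

variable [IsProbabilityMeasure P]

theorem integral_sq_le (h : IsBoundedArray P Y R I) (n : ℕ) {M : ℕ} (hM : 0 < M) :
    ∫ ω, (avg (Y n) M ω - ∫ ω, Y n 0 ω ∂P) ^ 2 ∂P ≤ R ^ 2 / M :=
  integral_avg_sub_sq_le (h.meas n) (h.bdd n) (h.indep n) (h.ident n) hM

theorem abs_mean_le (h : IsBoundedArray P Y R I) (n : ℕ) : |∫ ω, Y n 0 ω ∂P| ≤ R := by
  simpa using norm_integral_le_of_norm_le_const (μ := P) (f := Y n 0) (C := R)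
    (ae_of_all _ (h.bdd n 0))

theorem abs_limit_le (h : IsBoundedArray P Y R I) : |I| ≤ R :=
  le_of_tendsto' h.mean.abs h.abs_mean_le

theorem integrable_sq (h : IsBoundedArray P Y R I) (n M : ℕ) {x : ℝ} (hx : |x| ≤ R) :
    Integrable (fun ω => (avg (Y n) M ω - x) ^ 2) P :=
  integrable_of_abs_le (((measurable_avg (h.meas n) M).sub_const x).pow_const 2)
    fun ω => h.abs_avg_sub_le n M ω hx

/-- The averages converge to the limit mean in mean square, jointly in both parameters. -/
theorem tendsto_integral_sq (h : IsBoundedArray P Y R I) :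
    Tendsto (fun nM : ℕ × ℕ => ∫ ω, (avg (Y nM.1) nM.2 ω - I) ^ 2 ∂P) (atTop ×ˢ atTop) (𝓝 0) := by
  -- Variance plus squared bias, with a factor 2 each from (a + b)² ≤ 2a² + 2b². The first depends
  -- on `M` alone and the second on `n` alone, whence the joint limit.
  have h1 : Tendsto (fun nM : ℕ × ℕ => 2 * (R ^ 2 / (nM.2 : ℝ)) +
      2 * ((∫ ω, Y nM.1 0 ω ∂P) - I) ^ 2) (atTop ×ˢ atTop) (𝓝 0) := by
    have e1 : Tendsto (fun M : ℕ => R ^ 2 / (M : ℝ)) atTop (𝓝 0) :=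
      tendsto_const_nhds.div_atTop tendsto_natCast_atTop_atTop
    have e2 := ((h.mean.sub_const I).pow 2).comp (tendsto_fst (f := atTop) (g := (atTop : Filter ℕ)))
    have e3 := e1.comp (tendsto_snd (f := (atTop : Filter ℕ)) (g := atTop))
    simpa [Function.comp_def] using (e3.const_mul 2).add (e2.const_mul 2)
  refine tendsto_of_tendsto_of_tendsto_of_le_of_le' tendsto_const_nhds h1
    (Eventually.of_forall fun _ => integral_nonneg fun ω => sq_nonneg _) ?_
  filter_upwards [tendsto_snd.eventually (eventually_gt_atTop 0)] with nM hM
  set L := ∫ ω, Y nM.1 0 ω ∂P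
  have i1 := h.integrable_sq nM.1 nM.2 (h.abs_mean_le nM.1)
  calc ∫ ω, (avg (Y nM.1) nM.2 ω - I) ^ 2 ∂P
      ≤ ∫ ω, (2 * (avg (Y nM.1) nM.2 ω - L) ^ 2 + 2 * (L - I) ^ 2) ∂P := by
        refine integral_mono (h.integrable_sq _ _ h.abs_limit_le)
          ((i1.const_mul 2).add (integrable_const _)) fun ω => ?_
        show (avg (Y nM.1) nM.2 ω - I) ^ 2 ≤ 2 * (avg (Y nM.1) nM.2 ω - L) ^ 2 + 2 * (L - I) ^ 2
        nlinarith [sq_nonneg ((avg (Y nM.1) nM.2 ω - L) - (L - I))]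
    _ = 2 * ∫ ω, (avg (Y nM.1) nM.2 ω - L) ^ 2 ∂P + 2 * (L - I) ^ 2 := by
        rw [integral_add (i1.const_mul 2) (integrable_const _), integral_const_mul]
        simp [L]
    _ ≤ _ := by
        have := h.integral_sq_le nM.1 hM
        gcongr

theorem summable_inv_sq (R : ℝ) : Summable fun n : ℕ => R ^ 2 / (((n + 1) ^ 2 : ℕ) : ℝ) := by
  have := ((summable_nat_add_iff 1).2 (Real.summable_one_div_nat_pow.2 one_lt_two)).mul_left (R ^ 2)
  refine this.congr fun n => ?_
  push_cast
  ring

/-- Almost sure convergence along the diagonal with `(n + 1)²` samples. -/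
theorem ae_tendsto_diagonal (h : IsBoundedArray P Y R I) :
    ∀ᵐ ω ∂P, Tendsto (fun n => avg (Y n) ((n + 1) ^ 2) ω) atTop (𝓝 I) := by
  -- The variances R² / (n + 1)² are summable, so no relation between different rows is required.
  have h1 := ae_tendsto_zero_of_summable_integral
    (fun n => h.integrable_sq n ((n + 1) ^ 2) (h.abs_mean_le n)) (fun n ω => sq_nonneg _)
    ((summable_inv_sq R).of_nonneg_of_le (fun n => integral_nonneg fun ω => sq_nonneg _)
      fun n => h.integral_sq_le n (pow_pos n.succ_pos 2))
  filter_upwards [h1] with ω hω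
  simpa using (tendsto_of_tendsto_sq hω).add h.mean

theorem ae_tendsto_avg (h : IsBoundedArray P Y R I) :
    ∀ᵐ ω ∂P, ∀ n, Tendsto (fun M => avg (Y n) M ω) atTop (𝓝 (∫ ω, Y n 0 ω ∂P)) := by
  refine ae_all_iff.2 fun n => ?_
  filter_upwards [strong_law_ae_real (Y n) (integrable_of_abs_le (h.meas n 0) (h.bdd n 0))
    (fun i j hij => (h.indep n).indepFun hij) (h.ident n)] with ω hω
  refine hω.congr fun M => ?_
  rw [avg, div_eq_inv_mul]

/-- The last sample is independent of the sum of the earlier ones. Binomial expansion therefore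
expresses the moments of the longer sum by products of moments of the shorter sum and of a single
sample, and induction on `M` applies. -/
theorem exists_tendsto_sum_pow (h : IsBoundedArray P Y R I)
    (hmom : ∀ m : ℕ, ∃ ℓ, Tendsto (fun n => ∫ ω, Y n 0 ω ^ m ∂P) atTop (𝓝 ℓ)) (M m : ℕ) :
    ∃ ℓ, Tendsto (fun n => ∫ ω, (∑ k ∈ Finset.range M, Y n k ω) ^ m ∂P) atTop (𝓝 ℓ) := by
  have hsm : ∀ n M, Measurable fun ω => ∑ k ∈ Finset.range M, Y n k ω := fun n M =>
    Finset.measurable_fun_sum _ fun k _ => h.meas n k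
  have hsb : ∀ n M ω, |∑ k ∈ Finset.range M, Y n k ω| ≤ M * R := fun n M ω =>
    (Finset.abs_sum_le_sum_abs _ _).trans
      ((Finset.sum_le_sum fun k _ => h.bdd n k ω).trans (by simp))
  induction M generalizing m with
  | zero => exact ⟨(0 : ℝ) ^ m, by simp⟩
  | succ M ih =>
    choose a ha using ih
    choose b hb using hmom
    refine ⟨∑ j ∈ Finset.range (m + 1), a j * b (m - j) * (m.choose j : ℝ), ?_⟩
    have key : ∀ n, ∫ ω, (∑ k ∈ Finset.range (M + 1), Y n k ω) ^ m ∂P =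
        ∑ j ∈ Finset.range (m + 1), (∫ ω, (∑ k ∈ Finset.range M, Y n k ω) ^ j ∂P) *
          (∫ ω, Y n 0 ω ^ (m - j) ∂P) * (m.choose j : ℝ) := fun n => by
      simp_rw [fun ω => Finset.sum_range_succ (fun k => Y n k ω) M, add_pow]
      rw [integral_finsetSum]
      · refine Finset.sum_congr rfl fun j _ => ?_
        rw [integral_mul_const]
        congr 1
        have hi : IndepFun (fun ω => ∑ k ∈ Finset.range M, Y n k ω) (Y n M) P := by
          have := (h.indep n).indepFun_finsetSum_of_notMem (h.meas n)
            (s := Finset.range M) (i := M) (by simp)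
          convert this using 1
          ext ω; simp
        have hi' := hi.comp (φ := fun x => x ^ j) (ψ := fun x => x ^ (m - j))
          (by fun_prop) (by fun_prop)
        have he : ∫ ω, Y n M ω ^ (m - j) ∂P = ∫ ω, Y n 0 ω ^ (m - j) ∂P :=
          ((h.ident n M).comp (u := fun x => x ^ (m - j)) (by fun_prop)).integral_eq
        rw [← he]
        exact hi'.integral_fun_mul_eq_mul_integral
          ((hsm n M).pow_const j).aestronglyMeasurable
          ((h.meas n M).pow_const _).aestronglyMeasurable
      · intro j _
        refine integrable_of_abs_le (R := (M * R) ^ j * R ^ (m - j) * (m.choose j : ℝ)) ?_ fun ω => ?_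
        · exact (((hsm n M).pow_const j).mul ((h.meas n M).pow_const _)).mul_const _
        · rw [abs_mul, abs_mul, abs_pow, abs_pow, Nat.abs_cast]
          have := h.nonneg
          have := hsb n M ω
          have := h.bdd n M ω
          gcongr
    simp_rw [key]
    exact tendsto_finsetSum _ fun j _ => ((ha j).mul (hb _)).mul_const _

/-- If all moments converge, then so do the laws of the averages. -/
theorem exists_tendsto_integral_comp_avg (h : IsBoundedArray P Y R I)
    (hmom : ∀ m : ℕ, ∃ ℓ, Tendsto (fun n => ∫ ω, Y n 0 ω ^ m ∂P) atTop (𝓝 ℓ)) (b : ℝ →ᵇ ℝ)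
    (M : ℕ) : ∃ ℓ, Tendsto (fun n => ∫ ω, b (avg (Y n) M ω) ∂P) atTop (𝓝 ℓ) := by
  have hA : ∀ n ω, avg (Y n) M ω ∈ Icc (-R) R := fun n ω =>
    abs_le.1 (abs_avg_le h.nonneg (h.bdd n) M ω)
  have hpow : ∀ n m, Integrable (fun ω => avg (Y n) M ω ^ m) P := fun n m =>
    integrable_of_abs_le (R := R ^ m) ((measurable_avg (h.meas n) M).pow_const m) fun ω => by
      rw [abs_pow]
      exact pow_le_pow_left₀ (abs_nonneg _) (abs_avg_le h.nonneg (h.bdd n) M ω) m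
  have hpoly : ∀ (p : Polynomial ℝ) n, Integrable (fun ω => p.eval (avg (Y n) M ω)) P :=
    fun p n => by
      simp_rw [Polynomial.eval_eq_sum_range]
      exact integrable_finsetSum _ fun m _ => (hpow n m).const_mul _
  refine exists_tendsto_of_forall_approx fun ε hε => ?_
  -- All averages stay in `[-R, R]`, so `b` may be replaced by a polynomial with an error uniform in
  -- `n`; expectations of polynomials are combinations of moments.
  obtain ⟨p, hp⟩ := exists_polynomial_near_of_continuousOn (-R) R b b.continuous.continuousOn ε hε
  refine ⟨fun n => ∫ ω, p.eval (avg (Y n) M ω) ∂P, fun n => ?_, ?_⟩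
  · have hb : Integrable (fun ω => b (avg (Y n) M ω)) P :=
      integrable_of_abs_le (b.continuous.measurable.comp (measurable_avg (h.meas n) M))
        fun ω => b.norm_coe_le_norm _
    rw [← integral_sub hb (hpoly p n)]
    have := norm_integral_le_of_norm_le_const (μ := P) (C := ε)
      (f := fun ω => b (avg (Y n) M ω) - p.eval (avg (Y n) M ω)) (ae_of_all _ fun ω => by
        rw [norm_sub_rev]; exact (hp _ (hA n ω)).le)
    simpa using this
  · choose a ha using fun m => h.exists_tendsto_sum_pow hmom M m
    refine ⟨∑ m ∈ Finset.range (p.natDegree + 1), p.coeff m * ((M : ℝ)⁻¹ ^ m * a m), ?_⟩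
    have key : ∀ n, ∫ ω, p.eval (avg (Y n) M ω) ∂P =
        ∑ m ∈ Finset.range (p.natDegree + 1),
          p.coeff m * ((M : ℝ)⁻¹ ^ m * ∫ ω, (∑ k ∈ Finset.range M, Y n k ω) ^ m ∂P) := fun n => by
      simp_rw [Polynomial.eval_eq_sum_range]
      rw [integral_finsetSum _ fun m _ => (hpow n m).const_mul _]
      simp_rw [integral_const_mul, avg, mul_pow, integral_const_mul]
    simp_rw [key]
    exact tendsto_finsetSum _ fun m _ => ((ha m).const_mul _).const_mul _

/-- The iterated limit in distribution. -/
theorem exists_iterated_limit (h : IsBoundedArray P Y R I)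
    (hmom : ∀ m : ℕ, ∃ ℓ, Tendsto (fun n => ∫ ω, Y n 0 ω ^ m ∂P) atTop (𝓝 ℓ)) (b : ℝ →ᵇ ℝ) :
    ∃ L : ℕ → ℝ, (∀ M, Tendsto (fun n => ∫ ω, b (avg (Y n) M ω) ∂P) atTop (𝓝 (L M))) ∧
      Tendsto L atTop (𝓝 (b I)) := by
  choose L hL using h.exists_tendsto_integral_comp_avg hmom b
  refine ⟨L, hL, Metric.tendsto_atTop.2 fun ε hε => ?_⟩
  obtain ⟨δ, hδ, hbδ⟩ := Metric.continuousAt_iff.1 (b.continuous.continuousAt (x := I)) (ε / 4)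
    (by linarith)
  have hlim := h.tendsto_integral_sq.const_mul (2 * ‖b‖ / δ ^ 2)
  rw [mul_zero] at hlim
  have hev := hlim.eventually (gt_mem_nhds (show (0 : ℝ) < ε / 4 by linarith))
  -- Splitting the joint filter gives a threshold for `M` that does not depend on `n`, so that `n`
  -- may go to infinity first.
  rw [eventually_prod_iff] at hev
  obtain ⟨p, hp, q, hq, hpq⟩ := hev
  obtain ⟨M₀, hM₀⟩ := eventually_atTop.1 hq
  refine ⟨M₀, fun M hM => ?_⟩
  -- Chebyshev's argument: within distance δ of `I` continuity gives ε / 4, and farther away the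
  -- trivial bound 2‖b‖ is multiplied by (A - I)² / δ² ≥ 1.
  have hle : ∀ᶠ n in atTop, |(∫ ω, b (avg (Y n) M ω) ∂P) - b I| ≤ ε / 2 := by
    filter_upwards [hp] with n hn
    have hsmall := hpq hn (hM₀ M hM)
    have hb : Integrable (fun ω => b (avg (Y n) M ω)) P :=
      integrable_of_abs_le (b.continuous.measurable.comp (measurable_avg (h.meas n) M))
        fun ω => b.norm_coe_le_norm _
    have hsq := h.integrable_sq n M h.abs_limit_le
    have e1 : (∫ ω, b (avg (Y n) M ω) ∂P) - b I = ∫ ω, (b (avg (Y n) M ω) - b I) ∂P := by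
      rw [integral_sub hb (integrable_const _)]; simp
    rw [e1]
    calc |∫ ω, (b (avg (Y n) M ω) - b I) ∂P|
        ≤ ∫ ω, (ε / 4 + 2 * ‖b‖ / δ ^ 2 * (avg (Y n) M ω - I) ^ 2) ∂P := by
          refine norm_integral_le_of_norm_le (f := fun ω => b (avg (Y n) M ω) - b I)
            ((integrable_const _).add (hsq.const_mul _)) (ae_of_all _ fun ω => ?_)
          show |b (avg (Y n) M ω) - b I| ≤ _
          have hnn : 0 ≤ 2 * ‖b‖ / δ ^ 2 * (avg (Y n) M ω - I) ^ 2 := by positivity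
          rcases lt_or_ge (dist (avg (Y n) M ω) I) δ with hd | hd
          · have := hbδ hd
            rw [Real.dist_eq] at this
            linarith
          · rw [Real.dist_eq] at hd
            have h1 : |b (avg (Y n) M ω) - b I| ≤ 2 * ‖b‖ := by
              have := b.dist_le_two_norm (avg (Y n) M ω) I
              rwa [Real.dist_eq] at this
            have h2 : 2 * ‖b‖ ≤ 2 * ‖b‖ / δ ^ 2 * (avg (Y n) M ω - I) ^ 2 := by
              rw [div_mul_eq_mul_div, le_div_iff₀ (by positivity)]
              have : δ ^ 2 ≤ (avg (Y n) M ω - I) ^ 2 := by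
                rw [← sq_abs (avg (Y n) M ω - I)]
                exact pow_le_pow_left₀ hδ.le hd 2
              have := norm_nonneg b
              gcongr
            linarith
      _ = ε / 4 + 2 * ‖b‖ / δ ^ 2 * ∫ ω, (avg (Y n) M ω - I) ^ 2 ∂P := by
          rw [integral_add (integrable_const _) (hsq.const_mul _), integral_const_mul]
          simp
      _ ≤ ε / 2 := by linarith
  have := le_of_tendsto ((hL M).sub_const (b I)).abs hle
  rw [Real.dist_eq]
  linarith

/-- The iterated limit almost surely, if the inner limits exist in probability. -/
theorem ae_tendsto_of_tendstoInMeasure (h : IsBoundedArray P Y R I) {B : ℕ → Ω → ℝ}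
    (hB : ∀ M, TendstoInMeasure P (fun n => avg (Y n) M) atTop (B M)) :
    ∀ᵐ ω ∂P, Tendsto (fun M => B M ω) atTop (𝓝 I) := by
  -- Almost sure convergence along a subsequence depending on `M` is enough to transfer
  -- measurability, the bound and the variance estimate to `B M`.
  have hae : ∀ M, ∃ ns : ℕ → ℕ, StrictMono ns ∧
      ∀ᵐ ω ∂P, Tendsto (fun i => avg (Y (ns i)) M ω) atTop (𝓝 (B M ω)) := fun M =>
    (hB M).exists_seq_tendsto_ae
  have hBmeas : ∀ M, AEMeasurable (B M) P := fun M => by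
    obtain ⟨ns, -, hns⟩ := hae M
    exact aemeasurable_of_tendsto_metrizable_ae atTop
      (fun i => (measurable_avg (h.meas (ns i)) M).aemeasurable) hns
  have hBbd : ∀ M, ∀ᵐ ω ∂P, |B M ω| ≤ R := fun M => by
    obtain ⟨ns, -, hns⟩ := hae M
    filter_upwards [hns] with ω hω
    exact le_of_tendsto' hω.abs fun i => abs_avg_le h.nonneg (h.bdd _) M ω
  have hBint : ∀ M, Integrable (fun ω => (B M ω - I) ^ 2) P := fun M => by
    refine Integrable.of_bound
      (((hBmeas M).sub_const I).pow_const 2).aestronglyMeasurable ((2 * R) ^ 2) ?_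
    filter_upwards [hBbd M] with ω hω
    rw [Real.norm_eq_abs, abs_pow]
    have := h.abs_limit_le
    exact pow_le_pow_left₀ (abs_nonneg _) ((abs_sub _ _).trans (by linarith)) 2
  have hBsq : ∀ M : ℕ, 0 < M → ∫ ω, (B M ω - I) ^ 2 ∂P ≤ R ^ 2 / M := fun M hM => by
    obtain ⟨ns, hmono, hns⟩ := hae M
    have hlim : Tendsto (fun i => ∫ ω, (avg (Y (ns i)) M ω - ∫ ω, Y (ns i) 0 ω ∂P) ^ 2 ∂P) atTop
        (𝓝 (∫ ω, (B M ω - I) ^ 2 ∂P)) := by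
      refine tendsto_integral_of_dominated_convergence (fun _ => (2 * R) ^ 2)
        (fun i => (h.integrable_sq (ns i) M (h.abs_mean_le _)).1) (integrable_const _)
        (fun i => ae_of_all _ fun ω => h.abs_avg_sub_le _ M ω (h.abs_mean_le _)) ?_
      filter_upwards [hns] with ω hω
      exact (hω.sub (h.mean.comp hmono.tendsto_atTop)).pow 2
    exact le_of_tendsto' hlim fun i => h.integral_sq_le (ns i) hM
  -- The shift by one keeps the number of samples positive, as the variance bound requires.
  have hsquares : ∀ᵐ ω ∂P, Tendsto (fun m : ℕ => B ((m + 1) ^ 2) ω) atTop (𝓝 I) := by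
    have h1 := ae_tendsto_zero_of_summable_integral (fun m : ℕ => hBint ((m + 1) ^ 2))
      (fun m ω => sq_nonneg _)
      ((summable_inv_sq R).of_nonneg_of_le (fun m => integral_nonneg fun ω => sq_nonneg _)
        fun m => hBsq _ (pow_pos m.succ_pos 2))
    filter_upwards [h1] with ω hω
    simpa using (tendsto_of_tendsto_sq hω).add_const I
  have hgap : ∀ᵐ ω ∂P, ∀ M M' : ℕ, M ≤ M' → |M' * B M' ω - M * B M ω| ≤ (M' - M) * R := by
    refine ae_all_iff.2 fun M => ae_all_iff.2 fun M' => ?_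
    obtain ⟨ns, hmono, hns⟩ := hae M
    -- The increment bound compares `M` and `M'` on the same mesh, so a second extraction is made
    -- inside the first to obtain a common subsequence.
    have hM' : TendstoInMeasure P (fun i => avg (Y (ns i)) M') atTop (B M') := fun ε hε =>
      (hB M' ε hε).comp hmono.tendsto_atTop
    obtain ⟨ms, hms, hlim⟩ := hM'.exists_seq_tendsto_ae
    filter_upwards [hns, hlim] with ω h1 h2 hle
    exact le_of_tendsto' ((h2.const_mul _).sub ((h1.comp hms.tendsto_atTop).const_mul _)).abs
      fun i => abs_mul_avg_sub_le (h.bdd _) hle ω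
  filter_upwards [hsquares, hgap] with ω h1 h2
  exact tendsto_of_tendsto_squares h2
    ((tendsto_add_atTop_iff_nat (f := fun m : ℕ => B (m ^ 2) ω) 1).1 h1)

end IsBoundedArray

end Arrays

end EMV

namespace EMV

/-! ### Pairings with Young measures -/

section Pairing

variable {X : Type*} [MeasurableSpace X] {N : ℕ} {K : Set (E N)} {μ : Measure X}

/-- The estimates satisfied by the pairing of `ψ ⊗ g` with a Young measure carried by `K`. -/
def IsPairing (K : Set (E N)) (μ : Measure X) (T : (X → ℝ) → (E N → ℝ) → ℝ) : Prop :=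
  ∀ (ψ ψ' : X → ℝ) (g g' : E N → ℝ) (b ε : ℝ), Integrable ψ μ → Integrable ψ' μ → Continuous g →
    Continuous g' → (∀ ξ ∈ K, |g ξ| ≤ b) → (∀ ξ ∈ K, |g ξ - g' ξ| ≤ ε) →
      |T ψ g - T ψ' g'| ≤ b * ∫ z, |ψ z - ψ' z| ∂μ + ε * ∫ z, |ψ' z| ∂μ

theorem integrable_mul_of_abs_le {ψ G : X → ℝ} {b : ℝ} (hψ : Integrable ψ μ)
    (hG : AEStronglyMeasurable G μ) (hb : ∀ z, |G z| ≤ b) : Integrable (fun z => ψ z * G z) μ :=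
  hψ.mul_bdd hG (ae_of_all _ hb)

theorem exists_abs_le_on (hK : IsCompact K) {g : E N → ℝ} (hg : Continuous g) :
    ∃ b, 0 ≤ b ∧ ∀ ξ ∈ K, |g ξ| ≤ b := by
  obtain ⟨b, hb⟩ := hK.exists_bound_of_continuousOn hg.continuousOn
  exact ⟨max b 0, le_max_right _ _, fun ξ hξ => (hb ξ hξ).trans (le_max_left _ _)⟩

/-- The pairing with a measurable family of positive functionals of mass one. -/
theorem isPairing_of_forall {G : X → (E N → ℝ) → ℝ} (hK : IsCompact K)
    (hmeas : ∀ g, Continuous g → AEStronglyMeasurable (fun z => G z g) μ)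
    (hb : ∀ g b z, Continuous g → (∀ ξ ∈ K, |g ξ| ≤ b) → |G z g| ≤ b)
    (hsub : ∀ g g' z, Continuous g → Continuous g' → G z g - G z g' = G z fun ξ => g ξ - g' ξ) :
    IsPairing K μ fun ψ g => ∫ z, ψ z * G z g ∂μ := by
  intro ψ ψ' g g' b ε hψ hψ' hg hg' hgb hgε
  obtain ⟨b', -, hb'⟩ := exists_abs_le_on hK hg'
  have i1 := integrable_mul_of_abs_le hψ (hmeas g hg) (hb g b · hg hgb)
  have i2 := integrable_mul_of_abs_le hψ' (hmeas g' hg') (hb g' b' · hg' hb')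
  have i3 : Integrable (fun z => |ψ z - ψ' z|) μ := (hψ.sub hψ').abs
  rw [← integral_sub i1 i2, ← integral_const_mul, ← integral_const_mul,
    ← integral_add (i3.const_mul b) (hψ'.abs.const_mul ε)]
  refine norm_integral_le_of_norm_le (f := fun z => ψ z * G z g - ψ' z * G z g')
    ((i3.const_mul b).add (hψ'.abs.const_mul ε))
    (ae_of_all _ fun z => ?_)
  have e1 := hb g b z hg hgb
  have e2 := hb (fun ξ => g ξ - g' ξ) ε z (hg.sub hg') hgε
  rw [← hsub g g' z hg hg'] at e2
  calc |ψ z * G z g - ψ' z * G z g'|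
      = |(ψ z - ψ' z) * G z g + ψ' z * (G z g - G z g')| := by ring_nf
    _ ≤ |ψ z - ψ' z| * |G z g| + |ψ' z| * |G z g - G z g'| := by
        rw [← abs_mul, ← abs_mul]; exact abs_add_le _ _
    _ ≤ b * |ψ z - ψ' z| + ε * |ψ' z| := by
        rw [mul_comm b, mul_comm ε]; gcongr

theorem integrable_of_compl_eq_zero (hK : IsCompact K) {ρ : Measure (E N)}
    [IsProbabilityMeasure ρ] (hρ : ρ Kᶜ = 0) {V : Type*} [NormedAddCommGroup V]
    [SecondCountableTopology V] {g : E N → V} (hg : Continuous g) : Integrable g ρ := by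
  obtain ⟨b, hb⟩ := hK.exists_bound_of_continuousOn hg.continuousOn
  refine Integrable.of_bound hg.stronglyMeasurable.aestronglyMeasurable b ?_
  filter_upwards [compl_mem_ae_iff.2 hρ] with ξ hξ
  exact hb ξ (by simpa using hξ)

theorem abs_integral_le_of_compl_eq_zero {ρ : Measure (E N)} [IsProbabilityMeasure ρ]
    (hρ : ρ Kᶜ = 0) {g : E N → ℝ} {b : ℝ} (hb : ∀ ξ ∈ K, |g ξ| ≤ b) : |∫ ξ, g ξ ∂ρ| ≤ b := by
  have : ∀ᵐ ξ ∂ρ, ‖g ξ‖ ≤ b := by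
    filter_upwards [compl_mem_ae_iff.2 hρ] with ξ hξ
    exact hb ξ (by simpa using hξ)
  simpa using norm_integral_le_of_norm_le_const this

/-- A Young measure carried by `K` that comes from a kernel defines a pairing. -/
theorem isPairing_kernel (hK : IsCompact K) (κ : Kernel X (E N)) [IsMarkovKernel κ]
    (hκ : ∀ z, κ z Kᶜ = 0) : IsPairing K μ fun ψ g => ∫ z, ψ z * ∫ ξ, g ξ ∂(κ z) ∂μ :=
  isPairing_of_forall (G := fun z g => ∫ ξ, g ξ ∂(κ z)) hK
    (fun _ hg => hg.stronglyMeasurable.integral_kernel.aestronglyMeasurable)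
    (fun _ _ z _ hb => abs_integral_le_of_compl_eq_zero (hκ z) hb)
    fun _ _ z hg hg' => (integral_sub (integrable_of_compl_eq_zero hK (hκ z) hg)
      (integrable_of_compl_eq_zero hK (hκ z) hg')).symm

/-- The pairing `∫ ψ g(U)` of a field `U` with `ψ ⊗ g`. -/
noncomputable def fieldPairing (μ : Measure X) (U : X → E N) (ψ : X → ℝ) (g : E N → ℝ) : ℝ :=
  ∫ z, ψ z * g (U z) ∂μ

theorem isPairing_fieldPairing (hK : IsCompact K) {U : X → E N} (hU : Measurable U)
    (hUK : ∀ z, U z ∈ K) : IsPairing K μ (fieldPairing μ U) :=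
  isPairing_of_forall (G := fun z g => g (U z)) hK
    (fun _ hg => (hg.measurable.comp hU).aestronglyMeasurable) (fun _ _ z _ hb => hb _ (hUK z))
    fun _ _ _ _ _ => rfl

theorem IsPairing.zero_left {T : (X → ℝ) → (E N → ℝ) → ℝ} (hT : IsPairing K μ T) {g : E N → ℝ}
    {b : ℝ} (hg : Continuous g) (hb : ∀ ξ ∈ K, |g ξ| ≤ b) {ψ : X → ℝ} (hψ : Integrable ψ μ)
    (h0 : T 0 g = 0) : |T ψ g| ≤ b * ∫ z, |ψ z| ∂μ := by
  have := hT ψ 0 g g b 0 hψ (integrable_zero _ _ _) hg hg hb (by simp)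
  simpa [h0] using this

theorem abs_fieldPairing_le (hK : IsCompact K) {U : X → E N} (hU : Measurable U)
    (hUK : ∀ z, U z ∈ K) {g : E N → ℝ} {b : ℝ} (hg : Continuous g) (hb : ∀ ξ ∈ K, |g ξ| ≤ b)
    {ψ : X → ℝ} (hψ : Integrable ψ μ) : |fieldPairing μ U ψ g| ≤ b * ∫ z, |ψ z| ∂μ :=
  (isPairing_fieldPairing hK hU hUK).zero_left hg hb hψ (by simp [fieldPairing])

/-- Averages of pairings are pairings. -/
theorem IsPairing.average (hne : K.Nonempty) {T : ℕ → (X → ℝ) → (E N → ℝ) → ℝ}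
    (hT : ∀ k, IsPairing K μ (T k)) (M : ℕ) :
    IsPairing K μ fun ψ g => (M : ℝ)⁻¹ * ∑ k ∈ Finset.range M, T k ψ g := by
  intro ψ ψ' g g' b ε hψ hψ' hg hg' hgb hgε
  -- A point of `K` forces `b` and `ε` to be nonnegative, which the degenerate case `M = 0` needs.
  obtain ⟨ξ, hξ⟩ := hne
  have hb : 0 ≤ b := (abs_nonneg _).trans (hgb ξ hξ)
  have hε : 0 ≤ ε := (abs_nonneg _).trans (hgε ξ hξ)
  rcases eq_or_ne M 0 with rfl | hM
  · simp only [CharP.cast_eq_zero, inv_zero, zero_mul, sub_self, abs_zero]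
    positivity
  · have hM' : (0 : ℝ) < M := by exact_mod_cast Nat.pos_of_ne_zero hM
    rw [← mul_sub, ← Finset.sum_sub_distrib, abs_mul, abs_of_pos (inv_pos.2 hM'),
      inv_mul_le_iff₀ hM']
    refine (Finset.abs_sum_le_sum_abs _ _).trans ((Finset.sum_le_sum fun k _ =>
      hT k ψ ψ' g g' b ε hψ hψ' hg hg' hgb hgε).trans ?_)
    simp [mul_add]

/-- Expectations of bounded pairings are pairings. -/
theorem IsPairing.expectation {A : Type*} [MeasurableSpace A] {Q : Measure A}
    [IsProbabilityMeasure Q] {T : A → (X → ℝ) → (E N → ℝ) → ℝ} (hT : ∀ a, IsPairing K μ (T a))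
    (hint : ∀ ψ g, Integrable ψ μ → Continuous g → Integrable (fun a => T a ψ g) Q) :
    IsPairing K μ fun ψ g => ∫ a, T a ψ g ∂Q := by
  intro ψ ψ' g g' b ε hψ hψ' hg hg' hgb hgε
  rw [← integral_sub (hint ψ g hψ hg) (hint ψ' g' hψ' hg')]
  simpa using norm_integral_le_of_norm_le_const (μ := Q)
    (f := fun a => T a ψ g - T a ψ' g')
    (ae_of_all _ fun a => hT a ψ ψ' g g' b ε hψ hψ' hg hg' hgb hgε)

/-- Integrable functions and continuous functions on a compact set can be approximated out of
countable families. -/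
theorem exists_countable_approximation [MeasurableSpace.CountablyGenerated X] [SigmaFinite μ]
    (hK : IsCompact K) : ∃ (ψs : ℕ → X → ℝ) (gs : ℕ → E N → ℝ),
      (∀ i, Integrable (ψs i) μ) ∧ (∀ i, Continuous (gs i)) ∧
      ∀ (ψ : X → ℝ) (g : E N → ℝ) (ε : ℝ), Integrable ψ μ → Continuous g → 0 < ε →
        ∃ i j, ∫ z, |ψ z - ψs i z| ∂μ ≤ ε ∧ ∀ ξ ∈ K, |g ξ - gs j ξ| ≤ ε := by
  have : Fact ((1 : ℝ≥0∞) ≤ 1) := ⟨le_rfl⟩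
  have : Fact ((1 : ℝ≥0∞) ≠ ⊤) := ⟨ENNReal.one_ne_top⟩
  have : CompactSpace K := isCompact_iff_compactSpace.1 hK
  let D := TopologicalSpace.denseSeq (Lp ℝ 1 μ)
  let D' := TopologicalSpace.denseSeq C(K, ℝ)
  -- Tietze extension of a dense sequence of functions on `K` to the whole space.
  choose G hG using fun j => ContinuousMap.exists_restrict_eq hK.isClosed (D' j)
  refine ⟨fun i => D i, fun j => G j, fun i => L1.integrable_coeFn _, fun j => (G j).continuous,
    fun ψ g ε hψ hg hε => ?_⟩
  obtain ⟨i, hi⟩ := (TopologicalSpace.denseRange_denseSeq (Lp ℝ 1 μ)).exists_dist_lt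
    (hψ.toL1 ψ) hε
  obtain ⟨j, hj⟩ := (TopologicalSpace.denseRange_denseSeq C(K, ℝ)).exists_dist_lt
    ((⟨g, hg⟩ : C(E N, ℝ)).restrict K) hε
  refine ⟨i, j, ?_, fun ξ hξ => ?_⟩
  · rw [dist_eq_norm, L1.norm_eq_integral_norm] at hi
    refine le_of_eq_of_le (integral_congr_ae ?_) hi.le
    filter_upwards [Lp.coeFn_sub (hψ.toL1 ψ) (D i), hψ.coeFn_toL1] with z h1 h2
    show _ = ‖(hψ.toL1 ψ - D i : Lp ℝ 1 μ) z‖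
    rw [h1, Pi.sub_apply, h2]
    rfl
  · have h1 := (ContinuousMap.dist_lt_iff hε).1 hj ⟨ξ, hξ⟩
    have h2 : D' j ⟨ξ, hξ⟩ = G j ξ := by rw [← hG j]; rfl
    have h3 : (TopologicalSpace.denseSeq C(K, ℝ) j) ⟨ξ, hξ⟩ = G j ξ := h2
    rw [h3, Real.dist_eq] at h1
    exact h1.le

/-- Together with `exists_approx` this extends convergence from a countable family of pairs (ψ, g)
to all pairs for one and the same ω, so a single null set serves uncountably many test functions. -/
theorem tendsto_of_forall_approx {ι : Type*} {l : Filter ι} {x : ι → ℝ} {x₀ : ℝ}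
    (h : ∀ ε > 0, ∃ (y : ι → ℝ) (y₀ : ℝ), (∀ n, |x n - y n| ≤ ε) ∧ |x₀ - y₀| ≤ ε ∧
      Tendsto y l (𝓝 y₀)) : Tendsto x l (𝓝 x₀) := by
  refine Metric.tendsto_nhds.2 fun ε hε => ?_
  obtain ⟨y, y₀, h1, h2, h3⟩ := h (ε / 4) (by linarith)
  filter_upwards [Metric.tendsto_nhds.1 h3 (ε / 4) (by linarith)] with n hn
  rw [Real.dist_eq] at hn ⊢
  have e1 := abs_le.1 (h1 n)
  have e2 := abs_le.1 h2
  have e3 := abs_lt.1 hn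
  exact abs_lt.2 ⟨by linarith, by linarith⟩

/-- Approximation of the arguments of a pairing. -/
theorem exists_approx (hK : IsCompact K) {ψs : ℕ → X → ℝ}
    {gs : ℕ → E N → ℝ} (hψs : ∀ i, Integrable (ψs i) μ) (hgs : ∀ i, Continuous (gs i))
    (happ : ∀ (ψ : X → ℝ) (g : E N → ℝ) (ε : ℝ), Integrable ψ μ → Continuous g → 0 < ε →
        ∃ i j, ∫ z, |ψ z - ψs i z| ∂μ ≤ ε ∧ ∀ ξ ∈ K, |g ξ - gs j ξ| ≤ ε)
    {ψ : X → ℝ} {g : E N → ℝ} (hψ : Integrable ψ μ) (hg : Continuous g) {ε : ℝ} (hε : 0 < ε) :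
    ∃ i j, ∀ T : (X → ℝ) → (E N → ℝ) → ℝ, IsPairing K μ T →
      |T ψ g - T (ψs i) (gs j)| ≤ ε := by
  obtain ⟨b, hb0, hb⟩ := exists_abs_le_on hK hg
  have hm : 0 ≤ ∫ z, |ψ z| ∂μ := integral_nonneg fun z => abs_nonneg _
  -- The pairing estimate gives the error bδ + δ(∫ |ψ| + 1), where the cap δ ≤ 1 bounds the mass of
  -- the approximant of ψ by ∫ |ψ| + 1. The total is at most δD ≤ ε.
  set D := b + (∫ z, |ψ z| ∂μ) + 2 with hD
  have hDpos : 0 < D := by linarith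
  set δ := min 1 (ε / D) with hδ
  have hδpos : 0 < δ := lt_min one_pos (div_pos hε hDpos)
  have hδ1 : δ ≤ 1 := min_le_left _ _
  have hδD : δ * D ≤ ε := (le_div_iff₀ hDpos).1 (min_le_right _ _)
  obtain ⟨i, j, hi, hj⟩ := happ ψ g δ hψ hg hδpos
  refine ⟨i, j, fun T hT => (hT ψ (ψs i) g (gs j) b δ hψ (hψs i) hg (hgs j) hb hj).trans ?_⟩
  have hi' : ∫ z, |ψs i z| ∂μ ≤ (∫ z, |ψ z| ∂μ) + δ := by
    have h1 : ∫ z, |ψs i z| ∂μ ≤ ∫ z, (|ψ z| + |ψ z - ψs i z|) ∂μ :=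
      integral_mono (hψs i).abs (hψ.abs.add (hψ.sub (hψs i)).abs) fun z => by
        have := abs_sub_abs_le_abs_sub (ψs i z) (ψ z)
        rw [abs_sub_comm] at this
        show |ψs i z| ≤ |ψ z| + |ψ z - ψs i z|
        linarith
    rw [integral_add hψ.abs (show Integrable (fun z => |ψ z - ψs i z|) μ from
      (hψ.sub (hψs i)).abs)] at h1
    linarith
  calc b * ∫ z, |ψ z - ψs i z| ∂μ + δ * ∫ z, |ψs i z| ∂μ
      ≤ b * δ + δ * ((∫ z, |ψ z| ∂μ) + 1) := by gcongr; linarith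
    _ ≤ δ * D := by rw [hD]; nlinarith
    _ ≤ ε := hδD

variable {A : Type*} [MeasurableSpace A]

theorem measurable_fieldPairing [SFinite μ] {V : A → X → E N}
    (hV : Measurable (Function.uncurry V)) {ψ : X → ℝ} (hψ : AEStronglyMeasurable ψ μ)
    {g : E N → ℝ} (hg : Continuous g) : Measurable fun a => fieldPairing μ (V a) ψ g := by
  -- An integrable ψ is only almost everywhere equal to a measurable function; passing to that
  -- version changes none of the integrals.
  have h1 : (fun a => fieldPairing μ (V a) ψ g) =
      fun a => ∫ z, hψ.mk ψ z * g (V a z) ∂μ := by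
    ext a
    exact integral_congr_ae (hψ.ae_eq_mk.mono fun z hz => by simp only [hz])
  rw [h1]
  refine StronglyMeasurable.measurable (StronglyMeasurable.integral_prod_right ?_)
  exact (hψ.stronglyMeasurable_mk.comp_measurable measurable_snd).mul
    (hg.measurable.comp hV).stronglyMeasurable

theorem integrable_fieldPairing [SFinite μ] {Q : Measure A} [IsFiniteMeasure Q]
    (hK : IsCompact K) {V : A → X → E N}
    (hV : Measurable (Function.uncurry V)) (hVK : ∀ a z, V a z ∈ K) {ψ : X → ℝ}
    (hψ : Integrable ψ μ) {g : E N → ℝ} (hg : Continuous g) :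
    Integrable (fun a => fieldPairing μ (V a) ψ g) Q := by
  obtain ⟨b, -, hb⟩ := exists_abs_le_on hK hg
  exact integrable_of_abs_le (measurable_fieldPairing hV hψ.1 hg) fun a =>
    abs_fieldPairing_le hK (hV.comp measurable_prodMk_left) (hVK a) hg hb hψ

/-- Change of the reference measure. -/
theorem integral_mul_eq_integral_toFinite [SigmaFinite μ] (ψ G : X → ℝ) :
    ∫ z, ψ z * G z ∂μ = ∫ z, (μ.rnDeriv μ.toFinite z).toReal * ψ z * G z ∂μ.toFinite := by
  rw [← integral_rnDeriv_smul (absolutelyContinuous_toFinite μ)]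
  simp only [smul_eq_mul, mul_assoc]

end Pairing

/-! ### Compactness -/

section Compactness

variable {X : Type*} [TopologicalSpace X] [PolishSpace X] [MeasurableSpace X] [BorelSpace X]
  {N : ℕ} {K : Set (E N)} {μ : Measure X} {A : Type*} [MeasurableSpace A]

/-- A weak limit point of the joint laws of the space variable and of random fields with values in
a compact set. -/
theorem exists_subseq_joint_law [IsProbabilityMeasure μ] (hK : IsCompact K)
    (Q : ℕ → Measure A) [∀ n, IsProbabilityMeasure (Q n)] {V : ℕ → A → X → E N}
    (hV : ∀ n, Measurable (Function.uncurry (V n))) (hVK : ∀ n a z, V n a z ∈ K) :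
    ∃ (j : ℕ → ℕ) (ρ : ProbabilityMeasure (X × E N)), StrictMono j ∧
      (ρ : Measure (X × E N)).fst = μ ∧ (ρ : Measure (X × E N)) (univ ×ˢ Kᶜ) = 0 ∧
      ∀ h : X × E N →ᵇ ℝ, Tendsto (fun n => ∫ a, ∫ z, h (z, V (j n) a z) ∂μ ∂(Q (j n))) atTop
        (𝓝 (∫ p, h p ∂(ρ : Measure (X × E N)))) := by
  have hm : ∀ n, Measurable fun p : A × X => (p.2, V n p.1 p.2) := fun n =>
    measurable_snd.prodMk (hV n)
  let ρs : ℕ → ProbabilityMeasure (X × E N) := fun n =>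
    ⟨((Q n).prod μ).map fun p => (p.2, V n p.1 p.2),
      Measure.isProbabilityMeasure_map (hm n).aemeasurable⟩
  have hρs : ∀ n, (ρs n : Measure (X × E N)) = ((Q n).prod μ).map fun p => (p.2, V n p.1 p.2) :=
    fun n => rfl
  have hfst : ∀ n, (ρs n : Measure (X × E N)).fst = μ := fun n => by
    rw [hρs, Measure.fst, Measure.map_map measurable_fst (hm n)]
    exact Measure.snd_prod
  have hKc : ∀ n, (ρs n : Measure (X × E N)) (univ ×ˢ Kᶜ) = 0 := fun n => by
    rw [hρs, Measure.map_apply (hm n) (MeasurableSet.univ.prod hK.measurableSet.compl)]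
    convert measure_empty (μ := (Q n).prod μ)
    ext p
    simpa using hVK n p.1 p.2
  -- The first marginal is a single probability measure on a Polish space, and the second marginals
  -- all live on `K`.
  have htight : IsTightMeasureSet
      {x : Measure (X × E N) | ∃ ρ ∈ range ρs, (ρ : Measure (X × E N)) = x} := by
    refine IsTightMeasureSet.prodMk ?_ ?_
    · refine (isTightMeasureSet_singleton (μ := μ)).subset ?_
      rintro _ ⟨_, ⟨_, ⟨n, rfl⟩, rfl⟩, rfl⟩
      exact hfst n
    · refine isTightMeasureSet_iff_exists_isCompact_measure_compl_le.2 fun ε hε => ⟨K, hK, ?_⟩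
      rintro _ ⟨_, ⟨_, ⟨n, rfl⟩, rfl⟩, rfl⟩
      rw [Measure.snd_apply hK.measurableSet.compl]
      have h1 : (Prod.snd ⁻¹' Kᶜ : Set (X × E N)) = univ ×ˢ Kᶜ := by ext p; simp
      rw [h1, hKc n]
      exact hε.le
  obtain ⟨ρ, -, j, hj, hlim⟩ := (isCompact_closure_of_isTightMeasureSet htight).tendsto_subseq
    (x := ρs) fun n => subset_closure ⟨n, rfl⟩
  refine ⟨j, ρ, hj, ?_, ?_, fun h => ?_⟩
  · have h1 := ProbabilityMeasure.tendsto_map_of_tendsto_of_continuous (ρs ∘ j) ρ hlim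
      (continuous_fst (X := X) (Y := E N))
    have h2 : ∀ n, ((ρs ∘ j) n).map (f := (Prod.fst : X × E N → X))
        continuous_fst.measurable.aemeasurable = (⟨μ, ‹_›⟩ : ProbabilityMeasure X) := fun n =>
      Subtype.ext (hfst (j n))
    simp only [h2] at h1
    have h3 := tendsto_nhds_unique tendsto_const_nhds h1
    exact (congrArg Subtype.val h3).symm
  -- The complement of `K` is open, so by the portmanteau theorem it cannot gain mass in the limit.
  · have h1 := ProbabilityMeasure.le_liminf_measure_open_of_tendsto hlim
      (isOpen_univ.prod hK.isClosed.isOpen_compl)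
    refine le_antisymm (h1.trans ?_) bot_le
    simp [hKc]
  · have h1 := (ProbabilityMeasure.tendsto_iff_forall_integral_tendsto.1 hlim) h
    refine h1.congr fun n => ?_
    rw [Function.comp_apply, hρs, integral_map (hm _).aemeasurable
      h.continuous.stronglyMeasurable.aestronglyMeasurable]
    exact integral_prod _ (Integrable.of_bound
      (h.continuous.measurable.comp (hm _)).aestronglyMeasurable ‖h‖
      (ae_of_all _ fun p => h.norm_coe_le_norm _))

/-- The fundamental theorem on Young measures, for random fields with values in a compact set. -/
theorem exists_subseq_youngMeasure [SigmaFinite μ] [NeZero μ] (hK : IsCompact K)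
    (hne : K.Nonempty) (Q : ℕ → Measure A) [∀ n, IsProbabilityMeasure (Q n)]
    {V : ℕ → A → X → E N} (hV : ∀ n, Measurable (Function.uncurry (V n)))
    (hVK : ∀ n a z, V n a z ∈ K) :
    ∃ (j : ℕ → ℕ) (κ : Kernel X (E N)), StrictMono j ∧ IsMarkovKernel κ ∧ (∀ z, κ z Kᶜ = 0) ∧
      ∀ (ψ : X → ℝ) (g : E N → ℝ), Integrable ψ μ → Continuous g →
        Tendsto (fun n => ∫ a, fieldPairing μ (V (j n) a) ψ g ∂(Q (j n))) atTop
          (𝓝 (∫ z, ψ z * ∫ ξ, g ξ ∂(κ z) ∂μ)) := by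
  classical
  obtain ⟨ξ₀, hξ₀⟩ := hne
  -- Prokhorov's theorem needs a probability measure, so the σ-finite `μ` is replaced by the
  -- equivalent `μ.toFinite`; the density returns at the end as a factor of ψ.
  obtain ⟨j, ρ, hj, hfst, hρK, hlim⟩ := exists_subseq_joint_law (μ := μ.toFinite) hK Q hV hVK
  set κ₀ := (ρ : Measure (X × E N)).condKernel with hκ₀
  have hG : MeasurableSet {z | κ₀ z Kᶜ = 0} :=
    (κ₀.measurable_coe hK.measurableSet.compl) (measurableSet_singleton 0)
  -- Disintegration puts the conditional laws on `K` only for almost every point. On the exceptional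
  -- set a Dirac mass in `K` is used, so that the support condition holds everywhere.
  let κ : Kernel X (E N) := Kernel.piecewise hG κ₀ (Kernel.const X (Measure.dirac ξ₀))
  have hκ : IsMarkovKernel κ := inferInstance
  have hκz : ∀ z, κ z = if κ₀ z Kᶜ = 0 then κ₀ z else Measure.dirac ξ₀ := fun z => by
    simp only [κ, Kernel.piecewise_apply, mem_ofPred_eq, Kernel.const_apply]
  have hκK : ∀ z, κ z Kᶜ = 0 := fun z => by
    by_cases hz : κ₀ z Kᶜ = 0
    · rw [hκz z, if_pos hz, hz]
    · rw [hκz z, if_neg hz, Measure.dirac_apply' _ hK.measurableSet.compl]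
      simp [hξ₀]
  have hae : ∀ᵐ z ∂μ.toFinite, κ z = κ₀ z := by
    have h1 : ∀ᵐ p ∂(μ.toFinite ⊗ₘ κ₀), p.2 ∈ K := by
      rw [hκ₀, ← hfst, Measure.disintegrate]
      rw [ae_iff]
      convert hρK using 2
      ext p; simp
    filter_upwards [Measure.ae_ae_of_ae_compProd h1] with z hz
    have : κ₀ z Kᶜ = 0 := hz
    rw [hκz z, if_pos this]
  refine ⟨j, κ, hj, hκ, hκK, ?_⟩
  have hcont : ∀ (ψ : X →ᵇ ℝ) (g : E N → ℝ), Continuous g →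
      Tendsto (fun n => ∫ a, fieldPairing μ.toFinite (V (j n) a) ψ g ∂(Q (j n))) atTop
          (𝓝 (∫ z, ψ z * ∫ ξ, g ξ ∂(κ z) ∂μ.toFinite)) := fun ψ g hg => by
    obtain ⟨b, hb0, hb⟩ := exists_abs_le_on hK hg
    -- Truncation at the bound valid on `K` makes ψ ⊗ g a bounded continuous test function without
    -- changing `g` on `K`.
    let g' : E N → ℝ := fun ξ => max (-b) (min b (g ξ))
    have hg' : Continuous g' := by fun_prop
    have hgg' : ∀ ξ ∈ K, g' ξ = g ξ := fun ξ hξ => by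
      have := abs_le.1 (hb ξ hξ)
      simp [g', min_eq_right this.2, max_eq_right this.1]
    have hgb : ∀ ξ, |g' ξ| ≤ b := fun ξ =>
      abs_le.2 ⟨le_max_left _ _, max_le (by linarith) (min_le_left _ _)⟩
    let h : X × E N →ᵇ ℝ := BoundedContinuousFunction.ofNormedAddCommGroup
      (fun p => ψ p.1 * g' p.2) (by fun_prop) (‖ψ‖ * b) fun p => by
        rw [norm_mul]
        exact mul_le_mul (ψ.norm_coe_le_norm _) (hgb _) (norm_nonneg _) (norm_nonneg _)
    have hh : ∀ z ξ, h (z, ξ) = ψ z * g' ξ := fun _ _ => rfl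
    convert hlim h using 2
    · refine integral_congr_ae (ae_of_all _ fun a => ?_)
      simp only [fieldPairing, hh, hgg' _ (hVK _ _ _)]
    · rw [← Measure.integral_condKernel (Integrable.of_bound
        h.continuous.stronglyMeasurable.aestronglyMeasurable ‖h‖
        (ae_of_all _ fun p => h.norm_coe_le_norm _)), hfst]
      refine integral_congr_ae (hae.mono fun z hz => ?_)
      simp only [hh]
      rw [integral_const_mul, ← hκ₀, ← hz]
      congr 1
      refine integral_congr_ae ?_
      filter_upwards [compl_mem_ae_iff.2 (hκK z)] with ξ hξ
      exact (hgg' ξ (by simpa using hξ)).symm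
  have hfin : ∀ (ψ : X → ℝ) (g : E N → ℝ), Integrable ψ μ.toFinite → Continuous g →
      Tendsto (fun n => ∫ a, fieldPairing μ.toFinite (V (j n) a) ψ g ∂(Q (j n))) atTop
          (𝓝 (∫ z, ψ z * ∫ ξ, g ξ ∂(κ z) ∂μ.toFinite)) := fun ψ g hψ hg => by
    obtain ⟨b, hb0, hb⟩ := exists_abs_le_on hK hg
    refine tendsto_of_forall_approx fun ε hε => ?_
    obtain ⟨ψ', h1, h2⟩ := hψ.exists_boundedContinuous_integral_sub_le
      (ε := ε / (b + 1)) (by positivity)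
    have h3 : b * ∫ z, |ψ z - ψ' z| ∂μ.toFinite ≤ ε := by
      calc b * ∫ z, |ψ z - ψ' z| ∂μ.toFinite ≤ (b + 1) * (ε / (b + 1)) := by
            exact mul_le_mul (by linarith) h1 (integral_nonneg fun z => abs_nonneg _)
              (by linarith)
        _ = ε := by field_simp
    have key : ∀ T, IsPairing K μ.toFinite T → |T ψ g - T ψ' g| ≤ ε := fun T hT => by
      refine (hT ψ ψ' g g b 0 hψ h2 hg hg hb (by simp)).trans ?_
      simpa using h3
    exact ⟨_, _, fun n => key _ (IsPairing.expectation
      (fun a => isPairing_fieldPairing hK ((hV _).comp measurable_prodMk_left) (hVK _ a))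
      fun ψ g hψ hg => integrable_fieldPairing hK (hV _) (hVK _) hψ hg),
      key _ (isPairing_kernel hK κ hκK), hcont ψ' g hg⟩
  intro ψ g hψ hg
  have hψ' : Integrable (fun z => (μ.rnDeriv μ.toFinite z).toReal * ψ z) μ.toFinite :=
    (integrable_rnDeriv_smul_iff (absolutelyContinuous_toFinite μ)).2 hψ
  rw [integral_mul_eq_integral_toFinite]
  refine (hfin _ g hψ' hg).congr fun n => integral_congr_ae (ae_of_all _ fun a => ?_)
  exact (integral_mul_eq_integral_toFinite ψ fun z => g (V (j n) a z)).symm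

end Compactness

end EMV

namespace EMV

/-! ### Monte Carlo approximation of the limit Young measure -/

section MonteCarlo

/-- Diagonal extraction in the form of sequential compactness of a countable product of intervals.
-/
theorem exists_subseq_forall_tendsto {ι : Type*} [Countable ι] (x : ℕ → ι → ℝ) (R : ι → ℝ)
    (h : ∀ n i, |x n i| ≤ R i) :
    ∃ j : ℕ → ℕ, StrictMono j ∧ ∀ i, ∃ ℓ, Tendsto (fun n => x (j n) i) atTop (𝓝 ℓ) := by
  obtain ⟨ℓ, -, j, hj, hlim⟩ := (isCompact_univ_pi fun i => isCompact_Icc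
    (a := -R i) (b := R i)).tendsto_subseq (x := x) fun n i _ => abs_le.1 (h n i)
  exact ⟨j, hj, fun i => ⟨ℓ i, (tendsto_pi_nhds.1 hlim) i⟩⟩

variable {X : Type*} [MeasurableSpace X] {N : ℕ} {K : Set (E N)} {μ : Measure X}
  {A : Type*} [MeasurableSpace A]

theorem exists_abs_fieldPairing_le (hK : IsCompact K) {ψ : X → ℝ}
    (hψ : Integrable ψ μ) {g : E N → ℝ} (hg : Continuous g) :
    ∃ R, 0 ≤ R ∧ ∀ U : X → E N, Measurable U → (∀ z, U z ∈ K) → |fieldPairing μ U ψ g| ≤ R := by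
  obtain ⟨b, hb0, hb⟩ := exists_abs_le_on hK hg
  exact ⟨b * ∫ z, |ψ z| ∂μ, mul_nonneg hb0 (integral_nonneg fun z => abs_nonneg _),
    fun U hU hUK => abs_fieldPairing_le hK hU hUK hg hb hψ⟩

/-- A common subsequence along which all the moments of all pairings converge. -/
theorem exists_subseq_moments [MeasurableSpace.CountablyGenerated X] [SigmaFinite μ]
    (hK : IsCompact K) (Q : ℕ → Measure A)
    [∀ n, IsProbabilityMeasure (Q n)] {V : ℕ → A → X → E N}
    (hV : ∀ n, Measurable (Function.uncurry (V n))) (hVK : ∀ n a z, V n a z ∈ K) :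
    ∃ j : ℕ → ℕ, StrictMono j ∧ ∀ (ψ : X → ℝ) (g : E N → ℝ), Integrable ψ μ → Continuous g →
      ∀ m : ℕ, ∃ ℓ, Tendsto (fun n => ∫ a, fieldPairing μ (V (j n) a) ψ g ^ m ∂(Q (j n))) atTop
        (𝓝 ℓ) := by
  obtain ⟨ψs, gs, hψs, hgs, happ⟩ := exists_countable_approximation (N := N) (μ := μ) hK
  have hVa : ∀ n a, Measurable (V n a) := fun n a => (hV n).comp measurable_prodMk_left
  have hint : ∀ n {ψ g}, Integrable ψ μ → Continuous g → ∀ m : ℕ,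
      Integrable (fun a => fieldPairing μ (V n a) ψ g ^ m) (Q n) := fun n ψ g hψ hg m => by
    obtain ⟨R, -, hR⟩ := exists_abs_fieldPairing_le hK hψ hg
    refine integrable_of_abs_le (R := R ^ m) ((measurable_fieldPairing (hV n) hψ.1 hg).pow_const m)
      fun a => ?_
    rw [abs_pow]
    exact pow_le_pow_left₀ (abs_nonneg _) (hR _ (hVa n a) (hVK n a)) m
  choose R hR0 hR using fun i j => exists_abs_fieldPairing_le hK (hψs i) (hgs j)
  obtain ⟨j, hj, hlim⟩ := exists_subseq_forall_tendsto
    (fun n (i : ℕ × ℕ × ℕ) => ∫ a, fieldPairing μ (V n a) (ψs i.1) (gs i.2.1) ^ i.2.2 ∂(Q n))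
    (fun i => R i.1 i.2.1 ^ i.2.2) fun n i => by
      have h1 : ∀ a, ‖fieldPairing μ (V n a) (ψs i.1) (gs i.2.1) ^ i.2.2‖ ≤
          R i.1 i.2.1 ^ i.2.2 := fun a => by
        rw [norm_pow]
        exact pow_le_pow_left₀ (norm_nonneg _) (hR _ _ _ (hVa n a) (hVK n a)) _
      simpa using norm_integral_le_of_norm_le_const (μ := Q n) (ae_of_all _ h1)
  refine ⟨j, hj, fun ψ g hψ hg m => exists_tendsto_of_forall_approx fun ε hε => ?_⟩
  obtain ⟨R₀, hR₀, hR₀b⟩ := exists_abs_fieldPairing_le hK hψ hg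
  -- Powers of pairings are not pairings, so the approximation of (ψ, g) is transferred by uniform
  -- continuity of x ↦ xᵐ. The interval is enlarged by 1 to contain the approximating values.
  have hu : UniformContinuousOn (fun x : ℝ => x ^ m) (Icc (-(R₀ + 1)) (R₀ + 1)) :=
    isCompact_Icc.uniformContinuousOn_of_continuous (by fun_prop)
  obtain ⟨δ, hδ, hδε⟩ := Metric.uniformContinuousOn_iff.1 hu ε hε
  obtain ⟨i, l, hil⟩ := exists_approx hK hψs hgs happ hψ hg
    (show (0 : ℝ) < min (δ / 2) 1 by positivity)
  refine ⟨_, fun n => ?_, hlim (i, l, m)⟩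
  have h1 : ∀ a, ‖fieldPairing μ (V (j n) a) ψ g ^ m -
      fieldPairing μ (V (j n) a) (ψs i) (gs l) ^ m‖ ≤ ε := fun a => by
    have e1 := hil _ (isPairing_fieldPairing hK (hVa (j n) a) (hVK (j n) a))
    have e2 := abs_le.1 (hR₀b _ (hVa (j n) a) (hVK (j n) a))
    have e3 := abs_le.1 (e1.trans (min_le_right _ _))
    refine (hδε _ ⟨by linarith, by linarith⟩ _ ⟨by linarith, by linarith⟩ ?_).le
    rw [Real.dist_eq]
    linarith [min_le_left (δ / 2) 1]
  rw [← integral_sub (hint _ hψ hg m) (hint _ (hψs i) (hgs l) m)]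
  simpa using norm_integral_le_of_norm_le_const (μ := Q (j n)) (ae_of_all _ h1)

/-- The random variables `∫ ψ g(U k)`, for a sequence of samples `U k` of a random field. -/
noncomputable def samplePairing {Ω : Type*} (μ : Measure X) (V : A → X → E N) (v : ℕ → Ω → A)
    (ψ : X → ℝ) (g : E N → ℝ) (k : ℕ) (ω : Ω) : ℝ :=
  fieldPairing μ (V (v k ω)) ψ g

variable {Ω : Type*}

theorem isPairing_avg_samplePairing (hK : IsCompact K) (hne : K.Nonempty) {V : A → X → E N}
    (hV : Measurable (Function.uncurry V)) (hVK : ∀ a z, V a z ∈ K) (v : ℕ → Ω → A) (M : ℕ)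
    (ω : Ω) : IsPairing K μ fun ψ g => avg (samplePairing μ V v ψ g) M ω :=
  IsPairing.average hne (fun k => isPairing_fieldPairing (U := V (v k ω)) hK
    (hV.comp measurable_prodMk_left) (hVK _)) M

variable [MeasurableSpace Ω] {P : Measure Ω}

/-- A fixed measurable function of i.i.d. data is again i.i.d., and its mean is read off from the
common law `Q n`. The bound comes from `K`, ψ and g and is therefore the same for all meshes. -/
theorem isBoundedArray_samplePairing [SFinite μ] (hK : IsCompact K)
    {Q : ℕ → Measure A} {V : ℕ → A → X → E N}
    (hV : ∀ n, Measurable (Function.uncurry (V n))) (hVK : ∀ n a z, V n a z ∈ K)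
    {v : ℕ → ℕ → Ω → A} (hv : ∀ n k, Measurable (v n k)) (hind : ∀ n, iIndepFun (v n) P)
    (hlaw : ∀ n k, P.map (v n k) = Q n) {ψ : X → ℝ} {g : E N → ℝ} (hψ : Integrable ψ μ)
    (hg : Continuous g) {I : ℝ}
    (hI : Tendsto (fun n => ∫ a, fieldPairing μ (V n a) ψ g ∂(Q n)) atTop (𝓝 I)) :
    ∃ R, IsBoundedArray P (fun n => samplePairing μ (V n) (v n) ψ g) R I := by
  obtain ⟨R, hR0, hR⟩ := exists_abs_fieldPairing_le hK hψ hg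
  have hm := fun n => measurable_fieldPairing (hV n) hψ.1 hg
  refine ⟨R, fun n k => (hm n).comp (hv n k), hR0,
    fun n k ω => hR _ ((hV n).comp measurable_prodMk_left) (hVK n _),
    fun n => (hind n).comp (fun _ a => fieldPairing μ (V n a) ψ g) fun _ => hm n,
    fun n k => ?_, hI.congr fun n => ?_⟩
  · have : IdentDistrib (v n k) (v n 0) P P :=
      ⟨(hv n k).aemeasurable, (hv n 0).aemeasurable, by rw [hlaw, hlaw]⟩
    exact this.comp (hm n)
  · rw [← hlaw n 0, integral_map (hv n 0).aemeasurable (hm n).aestronglyMeasurable]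
    rfl

/-- Convergence of the Monte Carlo approximations of the limit Young measure `κ` of a sequence of
random fields `V n`. -/
structure IsMonteCarloLimit (μ : Measure X) (P : Measure Ω) (Q : ℕ → Measure A)
    (V : ℕ → A → X → E N) (v : ℕ → ℕ → Ω → A) (κ : X → Measure (E N)) : Prop where
  mean : ∀ (ψ : X → ℝ) (g : E N → ℝ), Integrable ψ μ → Continuous g →
    Tendsto (fun n => ∫ a, fieldPairing μ (V n a) ψ g ∂(Q n)) atTop
      (𝓝 (∫ z, ψ z * ∫ ξ, g ξ ∂(κ z) ∂μ))
  diagonal : ∀ᵐ ω ∂P, ∀ (ψ : X → ℝ) (g : E N → ℝ), Integrable ψ μ → Continuous g →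
    Tendsto (fun n => avg (samplePairing μ (V n) (v n) ψ g) ((n + 1) ^ 2) ω) atTop
      (𝓝 (∫ z, ψ z * ∫ ξ, g ξ ∂(κ z) ∂μ))
  iterated : ∀ᵐ ω ∂P, ∀ (ψ : X → ℝ) (g : E N → ℝ), Integrable ψ μ → Continuous g →
    ∀ n, Tendsto (fun M => avg (samplePairing μ (V n) (v n) ψ g) M ω) atTop
      (𝓝 (∫ a, fieldPairing μ (V n a) ψ g ∂(Q n)))
  meanSquare : ∀ (ψ : X → ℝ) (g : E N → ℝ), Integrable ψ μ → Continuous g →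
    Tendsto (fun nM : ℕ × ℕ => ∫ ω, (avg (samplePairing μ (V nM.1) (v nM.1) ψ g) nM.2 ω -
      ∫ z, ψ z * ∫ ξ, g ξ ∂(κ z) ∂μ) ^ 2 ∂P) (atTop ×ˢ atTop) (𝓝 0)
  inDistribution : ∀ (ψ : X → ℝ) (g : E N → ℝ), Integrable ψ μ → Continuous g →
    ∀ b : ℝ →ᵇ ℝ, ∃ L : ℕ → ℝ,
      (∀ M, Tendsto (fun n => ∫ ω, b (avg (samplePairing μ (V n) (v n) ψ g) M ω) ∂P) atTop
        (𝓝 (L M))) ∧ Tendsto L atTop (𝓝 (b (∫ z, ψ z * ∫ ξ, g ξ ∂(κ z) ∂μ)))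
  almostSure : ∀ (ψ : X → ℝ) (g : E N → ℝ), Integrable ψ μ → Continuous g →
    ∀ B : ℕ → Ω → ℝ,
      (∀ M, TendstoInMeasure P (fun n => avg (samplePairing μ (V n) (v n) ψ g) M) atTop (B M)) →
      ∀ᵐ ω ∂P, Tendsto (fun M => B M ω) atTop (𝓝 (∫ z, ψ z * ∫ ξ, g ξ ∂(κ z) ∂μ))

variable [IsProbabilityMeasure P]

/-- The Monte Carlo approximations converge along a sequence for which the means converge to the
limit Young measure and the moments of all pairings converge. -/
theorem isMonteCarloLimit_of_tendsto [MeasurableSpace.CountablyGenerated X] [SigmaFinite μ]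
    (hK : IsCompact K) (hne : K.Nonempty) {Q : ℕ → Measure A}
    [∀ n, IsProbabilityMeasure (Q n)] {V : ℕ → A → X → E N}
    (hV : ∀ n, Measurable (Function.uncurry (V n))) (hVK : ∀ n a z, V n a z ∈ K)
    {v : ℕ → ℕ → Ω → A} (hv : ∀ n k, Measurable (v n k)) (hind : ∀ n, iIndepFun (v n) P)
    (hlaw : ∀ n k, P.map (v n k) = Q n) (κ : Kernel X (E N)) [IsMarkovKernel κ]
    (hκ : ∀ z, κ z Kᶜ = 0)
    (hmean : ∀ (ψ : X → ℝ) (g : E N → ℝ), Integrable ψ μ → Continuous g →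
      Tendsto (fun n => ∫ a, fieldPairing μ (V n a) ψ g ∂(Q n)) atTop
        (𝓝 (∫ z, ψ z * ∫ ξ, g ξ ∂(κ z) ∂μ)))
    (hmom : ∀ (ψ : X → ℝ) (g : E N → ℝ), Integrable ψ μ → Continuous g →
      ∀ m : ℕ, ∃ ℓ, Tendsto (fun n => ∫ a, fieldPairing μ (V n a) ψ g ^ m ∂(Q n)) atTop (𝓝 ℓ)) :
    IsMonteCarloLimit μ P Q V v κ := by
  have harr : ∀ (ψ : X → ℝ) (g : E N → ℝ), Integrable ψ μ → Continuous g →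
      ∃ R, IsBoundedArray P (fun n => samplePairing μ (V n) (v n) ψ g) R
        (∫ z, ψ z * ∫ ξ, g ξ ∂(κ z) ∂μ) := fun ψ g hψ hg =>
    isBoundedArray_samplePairing hK hV hVK hv hind hlaw hψ hg (hmean ψ g hψ hg)
  have hsample : ∀ (ψ : X → ℝ) (g : E N → ℝ), Integrable ψ μ → Continuous g → ∀ (n m : ℕ),
      ∫ ω, samplePairing μ (V n) (v n) ψ g 0 ω ^ m ∂P =
        ∫ a, fieldPairing μ (V n a) ψ g ^ m ∂(Q n) := fun ψ g hψ hg n m => by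
    rw [← hlaw n 0, integral_map (hv n 0).aemeasurable
      ((measurable_fieldPairing (hV n) hψ.1 hg).pow_const m).aestronglyMeasurable]
    rfl
  have hmom' : ∀ (ψ : X → ℝ) (g : E N → ℝ), Integrable ψ μ → Continuous g → ∀ m : ℕ, ∃ ℓ,
      Tendsto (fun n => ∫ ω, samplePairing μ (V n) (v n) ψ g 0 ω ^ m ∂P) atTop (𝓝 ℓ) :=
    fun ψ g hψ hg m => by
      simp_rw [hsample ψ g hψ hg]
      exact hmom ψ g hψ hg m
  -- The almost sure statements quantify over all ψ and g inside the null set. They are proved on a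
  -- countable family and extended pathwise, because averages obey the pairing estimate for every ω.
  obtain ⟨ψs, gs, hψs, hgs, happ⟩ := exists_countable_approximation (N := N) (μ := μ) hK
  have hpair := fun n => isPairing_avg_samplePairing (μ := μ) hK hne (hV n) (hVK n) (v n)
  refine ⟨hmean, ?_, ?_, fun ψ g hψ hg => ?_, fun ψ g hψ hg b => ?_, fun ψ g hψ hg B hB => ?_⟩
  · have h1 : ∀ᵐ ω ∂P, ∀ i j,
        Tendsto (fun n => avg (samplePairing μ (V n) (v n) (ψs i) (gs j)) ((n + 1) ^ 2) ω) atTop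
          (𝓝 (∫ z, ψs i z * ∫ ξ, gs j ξ ∂(κ z) ∂μ)) := by
      refine ae_all_iff.2 fun i => ae_all_iff.2 fun j => ?_
      obtain ⟨R, hR⟩ := harr _ _ (hψs i) (hgs j)
      exact hR.ae_tendsto_diagonal
    filter_upwards [h1] with ω hω ψ g hψ hg
    refine tendsto_of_forall_approx fun ε hε => ?_
    obtain ⟨i, j, hij⟩ := exists_approx hK hψs hgs happ hψ hg hε
    exact ⟨_, _, fun n => hij _ (hpair n _ ω), hij _ (isPairing_kernel hK κ hκ), hω i j⟩
  · have h1 : ∀ᵐ ω ∂P, ∀ i j n,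
        Tendsto (fun M => avg (samplePairing μ (V n) (v n) (ψs i) (gs j)) M ω) atTop
          (𝓝 (∫ a, fieldPairing μ (V n a) (ψs i) (gs j) ∂(Q n))) := by
      refine ae_all_iff.2 fun i => ae_all_iff.2 fun j => ?_
      obtain ⟨R, hR⟩ := harr _ _ (hψs i) (hgs j)
      have h2 := fun n => hsample _ _ (hψs i) (hgs j) n 1
      simp only [pow_one] at h2
      simpa only [h2] using hR.ae_tendsto_avg
    filter_upwards [h1] with ω hω ψ g hψ hg n
    refine tendsto_of_forall_approx fun ε hε => ?_
    obtain ⟨i, j, hij⟩ := exists_approx hK hψs hgs happ hψ hg hε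
    exact ⟨_, _, fun M => hij _ (hpair n M ω), hij _ (IsPairing.expectation (Q := Q n)
      (fun a => isPairing_fieldPairing hK ((hV n).comp measurable_prodMk_left) (hVK n a))
      fun ψ g hψ hg => integrable_fieldPairing hK (hV n) (hVK n) hψ hg), hω i j n⟩
  · obtain ⟨R, hR⟩ := harr ψ g hψ hg
    exact hR.tendsto_integral_sq
  · obtain ⟨R, hR⟩ := harr ψ g hψ hg
    exact hR.exists_iterated_limit (hmom' ψ g hψ hg) b
  · obtain ⟨R, hR⟩ := harr ψ g hψ hg
    exact hR.ae_tendsto_of_tendstoInMeasure hB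

/-- A sequence of bounded random fields has a subsequence whose Monte Carlo approximations converge
to a Young measure. -/
theorem exists_subseq_isMonteCarloLimit [TopologicalSpace X] [PolishSpace X] [BorelSpace X]
    [SigmaFinite μ] [NeZero μ]
    (hK : IsCompact K) (hne : K.Nonempty) {Q : ℕ → Measure A}
    [∀ n, IsProbabilityMeasure (Q n)] {V : ℕ → A → X → E N}
    (hV : ∀ n, Measurable (Function.uncurry (V n))) (hVK : ∀ n a z, V n a z ∈ K)
    {v : ℕ → ℕ → Ω → A} (hv : ∀ n k, Measurable (v n k)) (hind : ∀ n, iIndepFun (v n) P)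
    (hlaw : ∀ n k, P.map (v n k) = Q n) :
    ∃ (j : ℕ → ℕ) (κ : Kernel X (E N)), StrictMono j ∧ IsMarkovKernel κ ∧ (∀ z, κ z Kᶜ = 0) ∧
      IsMonteCarloLimit μ P (fun n => Q (j n)) (fun n => V (j n)) (fun n => v (j n)) κ := by
  obtain ⟨j, κ, hj, hκ, hκK, hmean⟩ := exists_subseq_youngMeasure (μ := μ) hK hne Q hV hVK
  -- The means do not control the laws of averages with fixed `M`; the second extraction fixes all
  -- moments, for the reversed order of limits.
  obtain ⟨l, hl, hmom⟩ := exists_subseq_moments (μ := μ) hK (fun n => Q (j n))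
    (V := fun n => V (j n)) (fun n => hV _) fun n => hVK _
  exact ⟨j ∘ l, κ, hj.comp hl, hκ, hκK, isMonteCarloLimit_of_tendsto
    (Q := fun n => Q ((j ∘ l) n))
    (V := fun n => V ((j ∘ l) n)) (v := fun n => v ((j ∘ l) n)) hK hne (fun n => hV _)
    (fun n => hVK _) (fun n k => hv _ k) (fun n => hind _) (fun n k => hlaw _ k) κ hκK
    (fun ψ g hψ hg => (hmean ψ g hψ hg).comp hl.tendsto_atTop) hmom⟩

end MonteCarlo

end EMV

namespace EMV

/-! ### Cartesian meshes -/

section Mesh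

variable {d : ℕ} {w : Fin d → ℝ}

theorem measurable_cellIndex (w : Fin d → ℝ) : Measurable (cellIndex w) :=
  measurable_pi_iff.2 fun l => by
    unfold cellIndex
    fun_prop

/-- The translation of space by `m` cells. -/
noncomputable def gridShift (w : Fin d → ℝ) (m : Grid d) : E d :=
  WithLp.toLp 2 fun l => w l * m l

theorem cellIndex_add_gridShift (hw : ∀ l, 0 < w l) (x : E d) (m : Grid d) :
    cellIndex w (x + gridShift w m) = cellIndex w x + m := by
  ext l
  have h : (x l + w l * m l) / w l + 1 / 2 = (x l / w l + 1 / 2) + m l := by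
    have := (hw l).ne'
    field_simp
    ring
  simp only [cellIndex, gridShift, PiLp.add_apply, Pi.add_apply]
  rw [h, Int.floor_add_intCast]

theorem gridShift_single (w : Fin d → ℝ) (l : Fin d) :
    gridShift w (Pi.single l 1) = w l • EuclideanSpace.single l (1 : ℝ) := by
  ext k
  by_cases h : k = l
  · subst h; simp [gridShift]
  · simp [gridShift, h]

theorem volume_cell (hw : ∀ l, 0 < w l) (i : Grid d) :
    volume (cellIndex w ⁻¹' {i}) = ENNReal.ofReal (∏ l, w l) := by
  have h1 : cellIndex w ⁻¹' {i} = (WithLp.ofLp : E d → Fin d → ℝ) ⁻¹'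
      (univ.pi fun l => Ico ((i l - 1 / 2) * w l) ((i l + 1 / 2) * w l)) := by
    ext x
    simp only [mem_preimage, mem_singleton_iff, Set.mem_pi, mem_univ, true_implies, funext_iff,
      cellIndex, Int.floor_eq_iff]
    refine forall_congr' fun l => ?_
    rw [mem_Ico, ← sub_le_iff_le_add, le_div_iff₀ (hw l), ← lt_sub_iff_add_lt, div_lt_iff₀ (hw l)]
    rw [show (i l : ℝ) + 1 - 1 / 2 = i l + 1 / 2 by ring]
  rw [h1, (PiLp.volume_preserving_ofLp (Fin d)).measure_preimage
    (MeasurableSet.univ_pi fun l => measurableSet_Ico).nullMeasurableSet, Real.volume_pi_Ico,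
    ENNReal.ofReal_prod_of_nonneg fun l _ => (hw l).le]
  exact Finset.prod_congr rfl fun l _ => by ring_nf

/-- The image of Lebesgue measure under the cell index gives every lattice point the volume of a
cell. This links the sums in the weak BV condition with integrals. -/
theorem lintegral_cellIndex (hw : ∀ l, 0 < w l) (G : Grid d → ℝ≥0∞) :
    ∫⁻ x : E d, G (cellIndex w x) = ∑' i, G i * ENNReal.ofReal (∏ l, w l) := by
  rw [← lintegral_map (measurable_of_countable G) (measurable_cellIndex w), lintegral_countable']
  refine tsum_congr fun i => ?_
  rw [Measure.map_apply (measurable_cellIndex w) (measurableSet_singleton i), volume_cell hw]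

theorem lintegral_cellIndex_add_le (hw : ∀ l, 0 < w l) (D : Grid d → Fin d → ℝ≥0∞) (B : Set (E d))
    (k : Grid d) (l : Fin d) : ∫⁻ x in B, D (cellIndex w x + k) l ≤
      ∑' i, (∑ l, D i l) * ENNReal.ofReal (∏ l, w l) := by
  refine (setLIntegral_le_lintegral _ _).trans ?_
  have h := (Equiv.addRight k).tsum_eq fun i => D i l * ENNReal.ofReal (∏ l, w l)
  simp only [Equiv.coe_addRight] at h
  rw [lintegral_cellIndex hw fun i => D (i + k) l, h]
  exact ENNReal.tsum_le_tsum fun i =>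
    mul_le_mul' (Finset.single_le_sum_of_canonicallyOrdered (Finset.mem_univ l)) le_rfl

theorem measurable_cellwise {V : Type*} [MeasurableSpace V] (w : Fin d → ℝ) {a : Grid d → ℝ → V}
    (ha : ∀ i, Measurable (a i)) : Measurable fun z : E d × ℝ => a (cellIndex w z.1) z.2 :=
  (measurable_from_prod_countable_right (f := fun p : Grid d × ℝ => a p.1 p.2) ha).comp
    (((measurable_cellIndex w).comp measurable_fst).prodMk measurable_snd)

theorem measurable_cellwise_space {V : Type*} [MeasurableSpace V] (w : Fin d → ℝ) (a : Grid d → V) :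
    Measurable fun x : E d => a (cellIndex w x) :=
  (measurable_of_countable a).comp (measurable_cellIndex w)

end Mesh

/-! ### The weak BV estimate -/

section WeakBV

/-- Above δ one has a / δ ≥ 1, and raising it to the power `r` only increases it. The inequality
takes the place of Hölder's: on a set of finite measure the first term is small with δ, and for
fixed δ the second is controlled by weak BV. -/
theorem le_add_mul_rpow {a δ : ℝ≥0∞} (hδ : δ ≠ 0) (hδ' : δ ≠ ⊤) {r : ℝ} (hr : 1 ≤ r) :
    a ≤ δ + δ / δ ^ r * a ^ r := by
  rcases le_total a δ with h | h
  · exact h.trans le_self_add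
  · have h1 : 1 ≤ a / δ := by
      rwa [ENNReal.le_div_iff_mul_le (Or.inl hδ) (Or.inl hδ'), one_mul]
    calc a = δ * (a / δ) := (ENNReal.mul_div_cancel hδ hδ').symm
      _ ≤ δ * (a / δ) ^ r := by gcongr; exact ENNReal.le_rpow_self_of_one_le h1 hr
      _ = δ / δ ^ r * a ^ r := by
          rw [ENNReal.div_rpow_of_nonneg _ _ (by linarith), ENNReal.div_eq_inv_mul,
            ENNReal.div_eq_inv_mul]
          ring
      _ ≤ _ := le_add_self

variable {d : ℕ} {w : ℕ → Fin d → ℝ} {V : Type*} [NormedAddCommGroup V] {u : ℕ → Grid d → ℝ → V}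

theorem tendsto_lintegral_single (hw : ∀ n l, 0 < w n l) {r : ℝ} (hr : 1 ≤ r) {T : ℝ}
    (hBV : Tendsto (fun n => ∫⁻ t in Icc 0 T, ∑' i : Grid d,
      (∑ l, ‖u n (i + Pi.single l 1) t - u n i t‖ₑ ^ r) * ENNReal.ofReal (∏ l, w n l)) atTop (𝓝 0))
    {B : Set (E d)} (hB : volume B ≠ ⊤) (k : Grid d) (l : Fin d) :
    Tendsto (fun n => ∫⁻ t in Icc 0 T, ∫⁻ x in B,
      ‖u n (cellIndex (w n) x + k + Pi.single l 1) t - u n (cellIndex (w n) x + k) t‖ₑ) atTop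
      (𝓝 0) := by
  have hdom : ∀ (n : ℕ) (t : ℝ), ∫⁻ x in B,
      ‖u n (cellIndex (w n) x + k + Pi.single l 1) t - u n (cellIndex (w n) x + k) t‖ₑ ^ r ≤
      ∑' i : Grid d, (∑ l, ‖u n (i + Pi.single l 1) t - u n i t‖ₑ ^ r) *
        ENNReal.ofReal (∏ l, w n l) := fun n t =>
    lintegral_cellIndex_add_le (hw n)
      (fun i l => ‖u n (i + Pi.single l 1) t - u n i t‖ₑ ^ r) B k l
  set m : ℝ≥0∞ := volume B * volume (Icc 0 T) with hm
  have hm' : m ≠ ⊤ := ENNReal.mul_ne_top hB measure_Icc_lt_top.ne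
  refine ENNReal.tendsto_nhds_zero.2 fun ε hε => ?_
  -- First δ is chosen against the measure of the space-time region, and only then is the mesh
  -- refined.
  obtain ⟨δ, hδ0, hδ⟩ : ∃ δ : ℝ≥0∞, 0 < δ ∧ δ ≠ ⊤ ∧ δ * m ≤ ε / 2 := by
    have h1 : Tendsto (fun δ : ℝ≥0∞ => δ * m) (𝓝[>] 0) (𝓝 0) := by
      have := (ENNReal.continuous_mul_const hm').tendsto 0
      rw [zero_mul] at this
      exact this.mono_left nhdsWithin_le_nhds
    have h2 := h1.eventually (ge_mem_nhds (ENNReal.half_pos hε.ne'))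
    have h3 : ∀ᶠ δ : ℝ≥0∞ in 𝓝[>] 0, δ < 1 :=
      nhdsWithin_le_nhds (gt_mem_nhds one_pos)
    obtain ⟨δ, ⟨h4, h5⟩, h6⟩ := ((h2.and h3).and self_mem_nhdsWithin).exists
    exact ⟨δ, h6, (h5.trans ENNReal.one_lt_top).ne, h4⟩
  have hC : δ / δ ^ r ≠ ⊤ := ENNReal.div_ne_top hδ.1
    (ENNReal.rpow_pos hδ0 hδ.1).ne'
  have h2 : Tendsto (fun n => δ / δ ^ r * ∫⁻ t in Icc 0 T, ∑' i : Grid d,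
      (∑ l, ‖u n (i + Pi.single l 1) t - u n i t‖ₑ ^ r) * ENNReal.ofReal (∏ l, w n l)) atTop
      (𝓝 0) := by
    simpa using ENNReal.Tendsto.const_mul hBV (Or.inr hC)
  filter_upwards [h2.eventually (ge_mem_nhds (ENNReal.half_pos hε.ne'))] with n hn
  calc ∫⁻ t in Icc 0 T, ∫⁻ x in B,
      ‖u n (cellIndex (w n) x + k + Pi.single l 1) t - u n (cellIndex (w n) x + k) t‖ₑ
      ≤ ∫⁻ t in Icc 0 T, (δ * volume B + δ / δ ^ r * ∑' i : Grid d,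
          (∑ l, ‖u n (i + Pi.single l 1) t - u n i t‖ₑ ^ r) * ENNReal.ofReal (∏ l, w n l)) := by
        refine lintegral_mono fun t => ?_
        refine (lintegral_mono fun x => le_add_mul_rpow hδ0.ne' hδ.1 hr).trans ?_
        rw [lintegral_add_left measurable_const, setLIntegral_const, lintegral_const_mul' _ _ hC]
        gcongr
        exact hdom n t
    _ = δ * m + δ / δ ^ r * ∫⁻ t in Icc 0 T, ∑' i : Grid d,
          (∑ l, ‖u n (i + Pi.single l 1) t - u n i t‖ₑ ^ r) *
            ENNReal.ofReal (∏ l, w n l) := by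
        rw [lintegral_add_left measurable_const, setLIntegral_const, lintegral_const_mul' _ _ hC,
          hm, mul_assoc]
    _ ≤ ε / 2 + ε / 2 := add_le_add hδ.2 hn
    _ = ε := ENNReal.add_halves ε

theorem measurable_lintegral_cellwise (w : Fin d → ℝ) {a : Grid d → ℝ → ℝ≥0∞}
    (ha : ∀ i, Measurable (a i)) (B : Set (E d)) :
    Measurable fun t => ∫⁻ x in B, a (cellIndex w x) t :=
  Measurable.lintegral_prod_left' (f := fun z : E d × ℝ => a (cellIndex w z.1) z.2)
    (measurable_cellwise w ha)

/-- The differences of the approximations over any fixed number of cells tend to zero in `L¹`. -/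
theorem tendsto_lintegral_sub [MeasurableSpace V] [BorelSpace V] [SecondCountableTopology V]
    (hw : ∀ n l, 0 < w n l) (hu : ∀ n i, Measurable (u n i)) {r : ℝ}
    (hr : 1 ≤ r) {T : ℝ}
    (hBV : Tendsto (fun n => ∫⁻ t in Icc 0 T, ∑' i : Grid d,
      (∑ l, ‖u n (i + Pi.single l 1) t - u n i t‖ₑ ^ r) * ENNReal.ofReal (∏ l, w n l)) atTop (𝓝 0))
    {B : Set (E d)} (hB : volume B ≠ ⊤) (m : Grid d) :
    Tendsto (fun n => ∫⁻ t in Icc 0 T, ∫⁻ x in B,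
      ‖u n (cellIndex (w n) x + m) t - u n (cellIndex (w n) x) t‖ₑ) atTop (𝓝 0) := by
  have hmeas : ∀ (k k' : Grid d) (n : ℕ) (i : Grid d),
      Measurable fun t => ‖u n (i + k) t - u n (i + k') t‖ₑ := fun k k' n i =>
    ((hu n _).sub (hu n _)).enorm
  have htri : ∀ (k₁ k₂ k₃ : Grid d) (n : ℕ), (∫⁻ t in Icc 0 T, ∫⁻ x in B,
      ‖u n (cellIndex (w n) x + k₁) t - u n (cellIndex (w n) x + k₃) t‖ₑ) ≤
      (∫⁻ t in Icc 0 T, ∫⁻ x in B,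
        ‖u n (cellIndex (w n) x + k₁) t - u n (cellIndex (w n) x + k₂) t‖ₑ) +
      ∫⁻ t in Icc 0 T, ∫⁻ x in B,
        ‖u n (cellIndex (w n) x + k₂) t - u n (cellIndex (w n) x + k₃) t‖ₑ := fun k₁ k₂ k₃ n => by
    rw [← lintegral_add_left (measurable_lintegral_cellwise (w n) (hmeas k₁ k₂ n) B)]
    refine lintegral_mono fun t => ?_
    rw [← lintegral_add_left (measurable_cellwise_space (w n) fun i =>
      ‖u n (i + k₁) t - u n (i + k₂) t‖ₑ)]
    refine lintegral_mono fun x => ?_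
    exact (congrArg _ (sub_add_sub_cancel _ _ _)).ge.trans (enorm_add_le _ _)
  -- Shifts whose differences vanish in L¹ from every base offset `k` form a subgroup: sums by the
  -- triangle inequality, negatives by moving the base point. It contains the unit vectors, hence
  -- every shift.
  let G : AddSubgroup (Grid d) :=
    { carrier := {m | ∀ k : Grid d, Tendsto (fun n => ∫⁻ t in Icc 0 T, ∫⁻ x in B,
        ‖u n (cellIndex (w n) x + (k + m)) t - u n (cellIndex (w n) x + k) t‖ₑ) atTop (𝓝 0)}
      zero_mem' := fun k => by simp
      add_mem' := fun {a b} ha hb k => by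
        have h1 := (hb (k + a)).add (ha k)
        rw [add_zero] at h1
        refine tendsto_of_tendsto_of_tendsto_of_le_of_le tendsto_const_nhds h1
          (fun _ => zero_le) fun n => ?_
        rw [← add_assoc]
        exact htri _ _ _ n
      neg_mem' := fun {a} ha k => by
        refine (ha (k + -a)).congr fun n => ?_
        simp only [neg_add_cancel_right]
        exact lintegral_congr fun t => lintegral_congr fun x => enorm_sub_rev _ _ }
  have hG : ∀ l, (Pi.single l 1 : Grid d) ∈ G := fun l k => by
    simpa only [← add_assoc] using tendsto_lintegral_single hw hr hBV hB k l
  have hmG : m ∈ G := by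
    rw [← Finset.univ_sum_single m]
    refine sum_mem fun l _ => ?_
    have : (Pi.single l (m l) : Grid d) = m l • Pi.single l 1 := by
      rw [← Pi.single_smul]; simp
    rw [this]
    exact zsmul_mem (hG l) _
  simpa using hmG 0

end WeakBV

end EMV

namespace EMV

/-! ### Test functions -/

section TestFunctions

variable {d : ℕ} {φ : E d × ℝ → ℝ}

theorem spaceTime_eq_prod (d : ℕ) :
    spaceTime d = (volume : Measure (E d)).prod (volume.restrict (Ici (0 : ℝ))) := by
  rw [spaceTime, Measure.volume_eq_prod, ← Measure.prod_restrict, Measure.restrict_univ]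

instance : SigmaFinite (spaceTime d) := by
  rw [spaceTime_eq_prod]
  infer_instance

instance : IsFiniteMeasureOnCompacts (spaceTime d) := by
  unfold spaceTime
  infer_instance

theorem continuous_dt (hφ : ContDiff ℝ 1 φ) : Continuous (dt φ) :=
  (hφ.continuous_fderiv one_ne_zero).clm_apply continuous_const

theorem continuous_dx (hφ : ContDiff ℝ 1 φ) (l : Fin d) : Continuous (dx l φ) :=
  (hφ.continuous_fderiv one_ne_zero).clm_apply continuous_const

theorem hasCompactSupport_dt (hc : HasCompactSupport φ) : HasCompactSupport (dt φ) :=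
  hc.fderiv_apply ℝ _

theorem hasCompactSupport_dx (hc : HasCompactSupport φ) (l : Fin d) : HasCompactSupport (dx l φ) :=
  hc.fderiv_apply ℝ _

theorem integrable_dt (hφ : ContDiff ℝ 1 φ) (hc : HasCompactSupport φ) :
    Integrable (dt φ) (spaceTime d) :=
  (continuous_dt hφ).integrable_of_hasCompactSupport (hasCompactSupport_dt hc)

theorem integrable_dx (hφ : ContDiff ℝ 1 φ) (hc : HasCompactSupport φ) (l : Fin d) :
    Integrable (dx l φ) (spaceTime d) :=
  (continuous_dx hφ l).integrable_of_hasCompactSupport (hasCompactSupport_dx hc l)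

theorem exists_radius (hc : HasCompactSupport φ) :
    ∃ ρ > 0, ∀ z, ρ ≤ ‖z‖ → φ z = 0 ∧ fderiv ℝ φ z = 0 := by
  obtain ⟨ρ, hρ0, hρ⟩ := hc.isCompact.isBounded.subset_ball_lt 0 0
  refine ⟨ρ, hρ0, fun z hz => ?_⟩
  have h1 : z ∉ tsupport φ := fun h => by
    have := hρ h
    rw [mem_ball_zero_iff] at this
    linarith
  exact ⟨image_eq_zero_of_notMem_tsupport h1, by
    by_contra h2
    exact h1 (support_fderiv_subset ℝ h2)⟩

/-- The difference quotient of `φ` over one cell. -/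
noncomputable def diffQuot (w : Fin d → ℝ) (l : Fin d) (φ : E d × ℝ → ℝ) (z : E d × ℝ) : ℝ :=
  (w l)⁻¹ * (φ (z.1 + gridShift w (Pi.single l 1), z.2) - φ z)

theorem norm_gridShift_single {w : Fin d → ℝ} (hw : ∀ l, 0 < w l) (l : Fin d) :
    ‖gridShift w (Pi.single l 1)‖ = w l := by
  rw [gridShift_single, norm_smul, Real.norm_eq_abs, abs_of_pos (hw l)]
  simp

theorem continuous_diffQuot (w : Fin d → ℝ) (l : Fin d) (hφ : Continuous φ) :
    Continuous (diffQuot w l φ) := by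
  unfold diffQuot
  fun_prop

theorem diffQuot_eq_zero {w : Fin d → ℝ} (hw : ∀ l, 0 < w l) {l : Fin d} {ρ : ℝ}
    (hρ : ∀ z, ρ ≤ ‖z‖ → φ z = 0) {z : E d × ℝ} (hz : ρ + w l ≤ ‖z‖) :
    diffQuot w l φ z = 0 := by
  have h1 : ρ ≤ ‖(z.1 + gridShift w (Pi.single l 1), z.2)‖ := by
    have h2 : z = (z.1 + gridShift w (Pi.single l 1), z.2) - (gridShift w (Pi.single l 1), 0) := by
      ext <;> simp
    have h3 := norm_sub_le (z.1 + gridShift w (Pi.single l 1), z.2)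
      ((gridShift w (Pi.single l 1), 0) : E d × ℝ)
    have h4 : ‖((gridShift w (Pi.single l 1), 0) : E d × ℝ)‖ = w l := by
      rw [Prod.norm_def]
      simp [norm_gridShift_single hw, (hw l).le]
    rw [← h2, h4] at h3
    linarith
  rw [diffQuot, hρ _ h1, hρ z (by linarith [hw l]), sub_zero, mul_zero]

theorem hasCompactSupport_diffQuot {w : Fin d → ℝ} (hw : ∀ l, 0 < w l) (l : Fin d)
    (hc : HasCompactSupport φ) : HasCompactSupport (diffQuot w l φ) := by
  obtain ⟨ρ, -, hρ⟩ := exists_radius hc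
  refine HasCompactSupport.intro (isCompact_closedBall (0 : E d × ℝ) (ρ + w l)) fun z hz => ?_
  rw [mem_closedBall_zero_iff, not_le] at hz
  exact diffQuot_eq_zero hw (fun z hz => (hρ z hz).1) hz.le

theorem integrable_diffQuot {w : Fin d → ℝ} (hw : ∀ l, 0 < w l) (l : Fin d)
    (hφ : Continuous φ) (hc : HasCompactSupport φ) :
    Integrable (diffQuot w l φ) (spaceTime d) :=
  (continuous_diffQuot w l hφ).integrable_of_hasCompactSupport (hasCompactSupport_diffQuot hw l hc)

/-- The Lipschitz constant of φ serves for all widths at once and supplies the domination in the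
limits below. -/
theorem exists_abs_diffQuot_le (hφ : ContDiff ℝ 1 φ) (hc : HasCompactSupport φ) :
    ∃ L : ℝ, 0 ≤ L ∧ ∀ (w : Fin d → ℝ), (∀ l, 0 < w l) → ∀ l z, |diffQuot w l φ z| ≤ L := by
  obtain ⟨L, hL⟩ := hφ.lipschitzWith_of_hasCompactSupport hc one_ne_zero
  refine ⟨L, L.2, fun w hw l z => ?_⟩
  have h1 := hL.dist_le_mul (z.1 + gridShift w (Pi.single l 1), z.2) z
  have h2 : dist (z.1 + gridShift w (Pi.single l 1), z.2) z = w l := by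
    rw [Prod.dist_eq]
    simp [norm_gridShift_single hw, (hw l).le]
  rw [h2, Real.dist_eq] at h1
  rw [diffQuot, abs_mul, abs_of_pos (inv_pos.2 (hw l)), inv_mul_le_iff₀ (hw l), mul_comm (w l)]
  exact h1

theorem tendsto_diffQuot (hφ : ContDiff ℝ 1 φ) {w : ℕ → Fin d → ℝ} (hw : ∀ n l, 0 < w n l)
    (hlim : ∀ l, Tendsto (fun n => w n l) atTop (𝓝 0)) (l : Fin d) (z : E d × ℝ) :
    Tendsto (fun n => diffQuot (w n) l φ z) atTop (𝓝 (dx l φ z)) := by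
  have h1 := ((hφ.differentiable one_ne_zero z).hasFDerivAt.hasLineDerivAt
    ((EuclideanSpace.single l 1, 0) : E d × ℝ)).tendsto_slope_zero
  have h2 : Tendsto (fun n => w n l) atTop (𝓝[≠] 0) :=
    tendsto_nhdsWithin_iff.2 ⟨hlim l, Eventually.of_forall fun n => (hw n l).ne'⟩
  refine (h1.comp h2).congr fun n => ?_
  simp only [Function.comp_apply, diffQuot, smul_eq_mul, gridShift_single]
  congr 3
  ext <;> simp

/-- Difference quotients converge to derivatives in `L¹`. -/
theorem tendsto_integral_diffQuot_sub (hφ : ContDiff ℝ 1 φ) (hc : HasCompactSupport φ)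
    {w : ℕ → Fin d → ℝ} (hw : ∀ n l, 0 < w n l)
    (hlim : ∀ l, Tendsto (fun n => w n l) atTop (𝓝 0)) (l : Fin d) :
    Tendsto (fun n => ∫ z, |diffQuot (w n) l φ z - dx l φ z| ∂(spaceTime d)) atTop (𝓝 0) := by
  obtain ⟨ρ, -, hρ⟩ := exists_radius hc
  obtain ⟨L, hL0, hL⟩ := exists_abs_diffQuot_le hφ hc
  have hdx : ∀ z, |dx l φ z| ≤ L := fun z =>
    le_of_tendsto' (tendsto_diffQuot hφ hw hlim l z).abs fun n => hL _ (hw n) l z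
  -- Once the width is below 1, all quotients vanish outside the ball of radius ρ + 1.
  let bound : E d × ℝ → ℝ := (Metric.closedBall (0 : E d × ℝ) (ρ + 1)).indicator fun _ => 2 * L
  have hbound : Integrable bound (spaceTime d) :=
    (integrable_indicator_iff Metric.isClosed_closedBall.measurableSet).2
      (integrableOn_const (isCompact_closedBall _ _).measure_lt_top.ne)
  have h0 : (0 : ℝ) = ∫ z, |dx l φ z - dx l φ z| ∂(spaceTime d) := by simp
  rw [h0]
  refine tendsto_integral_filter_of_dominated_convergence bound
    (Eventually.of_forall fun n => ((continuous_diffQuot (w n) l hφ.continuous).sub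
      (continuous_dx hφ l)).abs.aestronglyMeasurable) ?_ hbound
    (ae_of_all _ fun z => ((tendsto_diffQuot hφ hw hlim l z).sub_const _).abs)
  filter_upwards [(hlim l).eventually (gt_mem_nhds one_pos)] with n hn
  refine ae_of_all _ fun z => ?_
  by_cases hz : z ∈ Metric.closedBall (0 : E d × ℝ) (ρ + 1)
  · rw [show bound z = 2 * L from indicator_of_mem hz _, Real.norm_eq_abs, abs_abs]
    exact (abs_sub _ _).trans (by linarith [hL _ (hw n) l z, hdx z])
  · rw [show bound z = 0 from indicator_of_notMem hz _]
    rw [mem_closedBall_zero_iff, not_le] at hz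
    rw [diffQuot_eq_zero (hw n) (fun z hz => (hρ z hz).1) (by linarith),
      dx, (hρ z (by linarith)).2]
    simp

end TestFunctions

/-! ### Discrete inequalities -/

section Discrete

variable {d : ℕ} {w : Fin d → ℝ} {φ : E d × ℝ → ℝ}

/-- Integration by parts in time, for a Lipschitz function and a test function. -/
theorem integral_mul_deriv_Ici {θ y : ℝ → ℝ} {ρ : ℝ} {L : NNReal} (hρ : 0 < ρ)
    (hθ : ContDiff ℝ 1 θ) (h0 : ∀ t, ρ ≤ t → θ t = 0 ∧ deriv θ t = 0)
    (hy : LipschitzOnWith L y (Ici 0)) :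
    ∫ t in Ici 0, θ t * deriv y t = -(∫ t in Ici 0, deriv θ t * y t) - θ 0 * y 0 := by
  -- Everything reduces to `[0, ρ]`, where a Lipschitz function is absolutely continuous and
  -- integration by parts is available; the boundary term at ρ vanishes.
  have hint : ∀ F : ℝ → ℝ, (∀ t, ρ ≤ t → F t = 0) → ∫ t in Ici 0, F t = ∫ t in (0 : ℝ)..ρ, F t :=
    fun F hF => by
      rw [integral_Ici_eq_integral_Ioi, intervalIntegral.integral_of_le hρ.le]
      refine setIntegral_eq_of_subset_of_forall_sdiff_eq_zero measurableSet_Ioi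
        Ioc_subset_Ioi_self fun t ht => hF t ?_
      by_contra h
      exact ht.2 ⟨ht.1, (not_le.1 h).le⟩
  rw [hint _ fun t ht => by rw [(h0 t ht).1, zero_mul],
    hint _ fun t ht => by rw [(h0 t ht).2, zero_mul],
    (hθ.contDiffOn.absolutelyContinuousOnInterval (a := 0) (b := ρ)).integral_mul_deriv_eq_deriv_mul
      ((hy.mono (by rw [uIcc_of_le hρ.le]; exact Icc_subset_Ici_self)
        ).absolutelyContinuousOnInterval), (h0 ρ le_rfl).1]
  ring

/-- Bounds for positive times suffice because the initial time is a null set. This matters for time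
derivatives, which at zero would involve the arbitrary values at negative times. -/
theorem integrable_mul_cellwise {ψ : E d × ℝ → ℝ} (hψ : Integrable ψ (spaceTime d))
    (w : Fin d → ℝ) {a : Grid d → ℝ → ℝ} (ha : ∀ i, Measurable (a i)) {b : ℝ}
    (hb : ∀ i t, 0 < t → |a i t| ≤ b) :
    Integrable (fun z => ψ z * a (cellIndex w z.1) z.2) (spaceTime d) := by
  refine hψ.mul_bdd (c := b) (measurable_cellwise w ha).aestronglyMeasurable ?_
  rw [spaceTime_eq_prod, ← restrict_Ioi_eq_restrict_Ici]
  have h1 : ∀ᵐ z : E d × ℝ ∂((volume : Measure (E d)).prod (volume.restrict (Ioi (0 : ℝ)))),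
      z.2 ∈ Ioi (0 : ℝ) :=
    Measure.quasiMeasurePreserving_snd.ae (ae_restrict_mem measurableSet_Ioi)
  filter_upwards [h1] with z hz
  exact hb _ _ hz

theorem integrable_mul_cellwise_space {θ : E d → ℝ} (hθ : Continuous θ)
    (hc : HasCompactSupport θ) (w : Fin d → ℝ) {a : Grid d → ℝ} {b : ℝ} (hb : ∀ i, |a i| ≤ b) :
    Integrable (fun x => θ x * a (cellIndex w x)) volume :=
  (hθ.integrable_of_hasCompactSupport hc).mul_bdd (c := b)
    (measurable_cellwise_space w a).aestronglyMeasurable (ae_of_all _ fun _ => hb _)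

theorem hasCompactSupport_slice (hc : HasCompactSupport φ) (t : ℝ) :
    HasCompactSupport fun x => φ (x, t) := by
  obtain ⟨ρ, -, hρ⟩ := exists_radius hc
  refine HasCompactSupport.intro (isCompact_closedBall (0 : E d) ρ) fun x hx => ?_
  rw [mem_closedBall_zero_iff, not_le] at hx
  exact (hρ (x, t) (hx.le.trans (le_max_left _ _))).1

/-- Summation by parts in space. -/
theorem integral_mul_flux_difference (hw : ∀ l, 0 < w l) (hφ : Continuous φ)
    (hc : HasCompactSupport φ) (t : ℝ) (l : Fin d) {a : Grid d → ℝ} {b : ℝ}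
    (hb : ∀ i, |a i| ≤ b) :
    ∫ x, φ (x, t) * ((w l)⁻¹ * (a (cellIndex w x) - a (cellIndex w x - Pi.single l 1))) =
      -∫ x, diffQuot w l φ (x, t) * a (cellIndex w x) := by
  have hφt : Continuous fun x => φ (x, t) := by fun_prop
  have hct := hasCompactSupport_slice hc t
  set s := gridShift w (Pi.single l 1) with hs
  have hφs : Continuous fun x => φ (x + s, t) := by fun_prop
  have hcs : HasCompactSupport fun x => φ (x + s, t) :=
    hct.comp_homeomorph (Homeomorph.addRight s)
  have i1 := integrable_mul_cellwise_space hφt hct w hb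
  have i2 := integrable_mul_cellwise_space hφt hct w (a := fun i => a (i - Pi.single l 1))
    fun i => hb _
  have i3 := integrable_mul_cellwise_space hφs hcs w hb
  -- Translation by one cell moves the index shift from the flux to the test function.
  have h1 : ∫ x, φ (x, t) * a (cellIndex w x - Pi.single l 1) =
      ∫ x, φ (x + s, t) * a (cellIndex w x) := by
    rw [← integral_add_right_eq_self _ s]
    simp only [hs, cellIndex_add_gridShift hw, add_sub_cancel_right]
  have h2 : ∀ x, φ (x, t) * ((w l)⁻¹ * (a (cellIndex w x) - a (cellIndex w x - Pi.single l 1))) =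
      (w l)⁻¹ * (φ (x, t) * a (cellIndex w x) - φ (x, t) * a (cellIndex w x - Pi.single l 1)) :=
    fun x => by ring
  have h3 : ∀ x, diffQuot w l φ (x, t) * a (cellIndex w x) =
      (w l)⁻¹ * (φ (x + s, t) * a (cellIndex w x) - φ (x, t) * a (cellIndex w x)) := fun x => by
    simp only [diffQuot, ← hs]; ring
  simp_rw [h2, h3]
  rw [integral_const_mul, integral_const_mul, integral_sub i1 i2, integral_sub i3 i1, h1]
  ring

theorem deriv_time_eq_dt (hφ : ContDiff ℝ 1 φ) (x : E d) (t : ℝ) :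
    deriv (fun τ => φ (x, τ)) t = dt φ (x, t) := by
  have h1 : HasDerivAt (fun τ : ℝ => (x, τ)) ((0 : E d), (1 : ℝ)) t :=
    (hasDerivAt_const t x).prodMk (hasDerivAt_id t)
  exact ((hφ.differentiable one_ne_zero (x, t)).hasFDerivAt.comp_hasDerivAt t h1).deriv

/-- Fubini and integration by parts along each vertical line. The Lipschitz constant common to all
cells makes the left-hand side integrable. -/
theorem integral_spaceTime_mul_deriv (hφ : ContDiff ℝ 1 φ)
    (hc : HasCompactSupport φ) {y : Grid d → ℝ → ℝ} {L : NNReal} {b : ℝ}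
    (hy : ∀ i, LipschitzOnWith L (y i) (Ici 0)) (hym : ∀ i, Measurable (y i))
    (hyb : ∀ i t, 0 ≤ t → |y i t| ≤ b) :
    ∫ z, φ z * deriv (y (cellIndex w z.1)) z.2 ∂(spaceTime d) =
      -(∫ z, dt φ z * y (cellIndex w z.1) z.2 ∂(spaceTime d)) -
        ∫ x, φ (x, 0) * y (cellIndex w x) 0 := by
  obtain ⟨ρ, hρ0, hρ⟩ := exists_radius hc
  have hder : ∀ i t, 0 < t → |deriv (y i) t| ≤ L := fun i t ht =>
    norm_deriv_le_of_lipschitzOn (Ici_mem_nhds ht) (hy i)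
  have i1 := integrable_mul_cellwise (hφ.continuous.integrable_of_hasCompactSupport hc) w
    (fun i => measurable_deriv (y i)) hder
  have i2 := integrable_mul_cellwise (integrable_dt hφ hc) w hym fun i t ht => hyb i t ht.le
  have i3 := integrable_mul_cellwise_space (θ := fun x => φ (x, 0))
    (hφ.continuous.comp (by fun_prop)) (hasCompactSupport_slice hc 0) w
    (a := fun i => y i 0) fun i => hyb i 0 le_rfl
  rw [spaceTime_eq_prod] at i1 i2 ⊢
  have i4 := i2.integral_prod_left
  rw [integral_prod _ i1, integral_prod _ i2, ← integral_neg, ← integral_sub (show Integrable (fun x =>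
    -∫ t in Ici 0, dt φ (x, t) * y (cellIndex w x) t) volume from i4.neg) i3]
  refine integral_congr_ae (ae_of_all _ fun x => ?_)
  have hnorm : ∀ t, ρ ≤ t → ρ ≤ ‖(x, t)‖ := fun t ht =>
    ht.trans ((le_abs_self t).trans (le_max_right ‖x‖ ‖t‖))
  have h1 := integral_mul_deriv_Ici (θ := fun t => φ (x, t)) hρ0 (hφ.comp (by fun_prop))
    (fun t ht => ⟨(hρ _ (hnorm t ht)).1, by
      rw [deriv_time_eq_dt hφ, dt, (hρ _ (hnorm t ht)).2]; rfl⟩) (hy (cellIndex w x))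
  simp only [deriv_time_eq_dt hφ] at h1
  exact h1

/-- The discrete entropy inequality at a fixed time. -/
theorem discrete_entropy_inequality_slice (hw : ∀ l, 0 < w l) (hφ : Continuous φ)
    (hc : HasCompactSupport φ) {t : ℝ} {a : Grid d → ℝ} {L b b' : ℝ} (ha : ∀ i, |a i| ≤ L)
    {p Q : Fin d → Grid d → ℝ} {e : Grid d → ℝ} (hpb : ∀ l i, |p l i| ≤ b)
    (heb : ∀ i, |e i| ≤ b') (hQ : ∀ l i, |Q l i - p l i| ≤ e i)
    (hineq : ∀ i x, φ (x, t) *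
      (a i + ∑ l, (w l)⁻¹ * (Q l i - Q l (i - Pi.single l 1))) ≤ 0) :
    ∫ x, φ (x, t) * a (cellIndex w x) ≤
      ∫ x, ∑ l, (diffQuot w l φ (x, t) * p l (cellIndex w x) +
        |diffQuot w l φ (x, t)| * e (cellIndex w x)) := by
  have hQb : ∀ l i, |Q l i| ≤ b + b' := fun l i => by
    have e1 := abs_le.1 (hpb l i)
    have e2 := abs_le.1 ((hQ l i).trans ((le_abs_self _).trans (heb i)))
    exact abs_le.2 ⟨by linarith, by linarith⟩
  have cφ : Continuous fun x => φ (x, t) := hφ.comp (by fun_prop)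
  have kφ := hasCompactSupport_slice hc t
  have cq : ∀ l, Continuous fun x => diffQuot w l φ (x, t) := fun l =>
    (continuous_diffQuot w l hφ).comp (by fun_prop)
  have kq : ∀ l, HasCompactSupport fun x => diffQuot w l φ (x, t) := fun l =>
    hasCompactSupport_slice (hasCompactSupport_diffQuot hw l hc) t
  have j0 := integrable_mul_cellwise_space cφ kφ w ha
  have bq : ∀ l i, |(w l)⁻¹ * (Q l i - Q l (i - Pi.single l 1))| ≤
      (w l)⁻¹ * ((b + b') + (b + b')) := fun l i => by
    rw [abs_mul, abs_of_pos (inv_pos.2 (hw l))]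
    exact mul_le_mul_of_nonneg_left ((abs_sub _ _).trans (add_le_add (hQb l _) (hQb l _)))
      (inv_pos.2 (hw l)).le
  have j1 : ∀ l, Integrable fun x => φ (x, t) *
      ((w l)⁻¹ * (Q l (cellIndex w x) - Q l (cellIndex w x - Pi.single l 1))) := fun l =>
    integrable_mul_cellwise_space cφ kφ w (bq l)
  have j2 : ∀ l, Integrable fun x => diffQuot w l φ (x, t) * Q l (cellIndex w x) := fun l =>
    integrable_mul_cellwise_space (cq l) (kq l) w (hQb l)
  have j3 : ∀ l, Integrable fun x => diffQuot w l φ (x, t) * p l (cellIndex w x) := fun l =>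
    integrable_mul_cellwise_space (cq l) (kq l) w (hpb l)
  have cqa : ∀ l, Continuous fun x => |diffQuot w l φ (x, t)| := fun l => (cq l).abs
  have kqa : ∀ l, HasCompactSupport fun x => |diffQuot w l φ (x, t)| := fun l =>
    (kq l).comp_left abs_zero
  have j4 : ∀ l, Integrable fun x => |diffQuot w l φ (x, t)| * e (cellIndex w x) := fun l =>
    integrable_mul_cellwise_space (cqa l) (kqa l) w heb
  have j5 : ∀ l, Integrable fun x => diffQuot w l φ (x, t) * p l (cellIndex w x) +
      |diffQuot w l φ (x, t)| * e (cellIndex w x) := fun l => (j3 l).add (j4 l)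
  have j6 : Integrable fun x => -∑ l, φ (x, t) *
      ((w l)⁻¹ * (Q l (cellIndex w x) - Q l (cellIndex w x - Pi.single l 1))) :=
    (integrable_finsetSum _ fun l _ => j1 l).neg
  have h0 : ∀ x, φ (x, t) * a (cellIndex w x) ≤ -∑ l, φ (x, t) *
      ((w l)⁻¹ * (Q l (cellIndex w x) - Q l (cellIndex w x - Pi.single l 1))) := fun x => by
    have := hineq (cellIndex w x) x
    rw [mul_add, Finset.mul_sum] at this
    linarith
  have h1 := integral_mono j0 j6 h0
  have h2 : (∫ x, -∑ l, φ (x, t) *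
      ((w l)⁻¹ * (Q l (cellIndex w x) - Q l (cellIndex w x - Pi.single l 1)))) =
      ∑ l, ∫ x, diffQuot w l φ (x, t) * Q l (cellIndex w x) := by
    rw [integral_neg, integral_finsetSum _ fun l _ => j1 l, ← Finset.sum_neg_distrib]
    refine Finset.sum_congr rfl fun l _ => ?_
    rw [integral_mul_flux_difference hw hφ hc t l (hQb l), neg_neg]
  rw [integral_finsetSum _ fun l _ => j5 l]
  refine h1.trans (h2.trans_le (Finset.sum_le_sum fun l _ =>
    integral_mono (j2 l) (j5 l) fun x => ?_))
  have h3 : diffQuot w l φ (x, t) * (Q l (cellIndex w x) - p l (cellIndex w x)) ≤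
      |diffQuot w l φ (x, t)| * e (cellIndex w x) := by
    refine (le_abs_self _).trans ?_
    rw [abs_mul]
    exact mul_le_mul_of_nonneg_left (hQ l _) (abs_nonneg _)
  rw [mul_sub] at h3
  exact sub_le_iff_le_add'.1 h3

/-- The weak form of a discrete entropy inequality, up to consistency errors. -/
theorem discrete_entropy_inequality (hw : ∀ l, 0 < w l) (hφ : ContDiff ℝ 1 φ)
    (hc : HasCompactSupport φ) {y : Grid d → ℝ → ℝ} {L : NNReal} {b : ℝ}
    (hy : ∀ i, LipschitzOnWith L (y i) (Ici 0)) (hym : ∀ i, Measurable (y i))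
    (hyb : ∀ i t, 0 ≤ t → |y i t| ≤ b)
    {p : Fin d → Grid d → ℝ → ℝ} (hpm : ∀ l i, Measurable (p l i))
    (hpb : ∀ l i t, 0 ≤ t → |p l i t| ≤ b)
    {e : Grid d → ℝ → ℝ} (hem : ∀ i, Measurable (e i)) {b' : ℝ}
    (heb : ∀ i t, 0 ≤ t → |e i t| ≤ b')
    {Q : Fin d → Grid d → ℝ → ℝ} (hQ : ∀ l i t, 0 ≤ t → |Q l i t - p l i t| ≤ e i t)
    (hineq : ∀ i, ∀ᵐ t ∂(volume.restrict (Ioi (0 : ℝ))), ∀ x, φ (x, t) *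
      (deriv (y i) t + ∑ l, (w l)⁻¹ * (Q l i t - Q l (i - Pi.single l 1) t)) ≤ 0) :
    -∑ l, (b * ∫ z, |diffQuot w l φ z - dx l φ z| ∂(spaceTime d) +
        ∫ z, |diffQuot w l φ z| * e (cellIndex w z.1) z.2 ∂(spaceTime d)) ≤
      (∫ z, dt φ z * y (cellIndex w z.1) z.2 ∂(spaceTime d)) +
      (∑ l, ∫ z, dx l φ z * p l (cellIndex w z.1) z.2 ∂(spaceTime d)) +
      ∫ x, φ (x, 0) * y (cellIndex w x) 0 := by
  have hder : ∀ i t, 0 < t → |deriv (y i) t| ≤ L := fun i t ht =>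
    norm_deriv_le_of_lipschitzOn (Ici_mem_nhds ht) (hy i)
  have iΨ := integrable_mul_cellwise (hφ.continuous.integrable_of_hasCompactSupport hc) w
    (fun i => measurable_deriv (y i)) hder
  have iq : ∀ l, Integrable (diffQuot w l φ) (spaceTime d) := fun l =>
    integrable_diffQuot hw l hφ.continuous hc
  have i1 : ∀ l, Integrable (fun z => diffQuot w l φ z * p l (cellIndex w z.1) z.2)
      (spaceTime d) := fun l =>
    integrable_mul_cellwise (iq l) w (hpm l) fun i t ht => hpb l i t ht.le
  have i2 : ∀ l, Integrable (fun z => |diffQuot w l φ z| * e (cellIndex w z.1) z.2)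
      (spaceTime d) := fun l =>
    integrable_mul_cellwise (iq l).abs w hem fun i t ht => heb i t ht.le
  have i3 : ∀ l, Integrable (fun z => dx l φ z * p l (cellIndex w z.1) z.2)
      (spaceTime d) := fun l =>
    integrable_mul_cellwise (integrable_dx hφ hc l) w (hpm l) fun i t ht => hpb l i t ht.le
  have i4 : ∀ l, Integrable (fun z => |diffQuot w l φ z - dx l φ z|) (spaceTime d) := fun l =>
    ((iq l).sub (integrable_dx hφ hc l)).abs
  have i5 : ∀ l, Integrable (fun z => diffQuot w l φ z * p l (cellIndex w z.1) z.2 +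
      |diffQuot w l φ z| * e (cellIndex w z.1) z.2) (spaceTime d) := fun l => (i1 l).add (i2 l)
  have iG : Integrable (fun z => ∑ l, (diffQuot w l φ z * p l (cellIndex w z.1) z.2 +
      |diffQuot w l φ z| * e (cellIndex w z.1) z.2)) (spaceTime d) :=
    integrable_finsetSum _ fun l _ => i5 l
  have hslice : ∀ᵐ t ∂(volume.restrict (Ici (0 : ℝ))),
      ∫ x, φ (x, t) * deriv (y (cellIndex w x)) t ≤
        ∫ x, ∑ l, (diffQuot w l φ (x, t) * p l (cellIndex w x) t +
          |diffQuot w l φ (x, t)| * e (cellIndex w x) t) := by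
    rw [← restrict_Ioi_eq_restrict_Ici]
    filter_upwards [ae_all_iff.2 hineq, ae_restrict_mem measurableSet_Ioi] with t ht ht0
    exact discrete_entropy_inequality_slice hw hφ.continuous hc (fun i => hder i t ht0)
      (fun l i => hpb l i t ht0.le) (fun i => heb i t ht0.le) (fun l i => hQ l i t ht0.le) ht
  have hΨ : ∫ z, φ z * deriv (y (cellIndex w z.1)) z.2 ∂(spaceTime d) ≤
      ∑ l, ((∫ z, diffQuot w l φ z * p l (cellIndex w z.1) z.2 ∂(spaceTime d)) +
        ∫ z, |diffQuot w l φ z| * e (cellIndex w z.1) z.2 ∂(spaceTime d)) := by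
    have h1 : ∑ l, ((∫ z, diffQuot w l φ z * p l (cellIndex w z.1) z.2 ∂(spaceTime d)) +
        ∫ z, |diffQuot w l φ z| * e (cellIndex w z.1) z.2 ∂(spaceTime d)) =
        ∫ z, ∑ l, (diffQuot w l φ z * p l (cellIndex w z.1) z.2 +
          |diffQuot w l φ z| * e (cellIndex w z.1) z.2) ∂(spaceTime d) := by
      rw [integral_finsetSum _ fun l _ => i5 l]
      exact Finset.sum_congr rfl fun l _ => (integral_add (i1 l) (i2 l)).symm
    rw [h1]
    rw [spaceTime_eq_prod] at iΨ iG ⊢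
    -- Space is the inner variable: outside one null set of times the inequality holds in all of the
    -- countably many cells, and it is summed at fixed time.
    rw [integral_prod_symm _ iΨ, integral_prod_symm _ iG]
    exact integral_mono_ae iΨ.integral_prod_right iG.integral_prod_right hslice
  have hconv : ∀ l, (∫ z, diffQuot w l φ z * p l (cellIndex w z.1) z.2 ∂(spaceTime d)) ≤
      (∫ z, dx l φ z * p l (cellIndex w z.1) z.2 ∂(spaceTime d)) +
        b * ∫ z, |diffQuot w l φ z - dx l φ z| ∂(spaceTime d) := fun l => by
    rw [← integral_const_mul, ← integral_add (i3 l) ((i4 l).const_mul b)]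
    refine integral_mono_ae (i1 l) ((i3 l).add ((i4 l).const_mul b)) ?_
    have h1 : ∀ᵐ z ∂(spaceTime d), 0 ≤ z.2 := by
      refine (ae_restrict_mem (MeasurableSet.univ.prod measurableSet_Ici)).mono fun z hz => hz.2
    filter_upwards [h1] with z hz
    show diffQuot w l φ z * p l (cellIndex w z.1) z.2 ≤ dx l φ z * p l (cellIndex w z.1) z.2 +
      b * |diffQuot w l φ z - dx l φ z|
    have h2 : (diffQuot w l φ z - dx l φ z) * p l (cellIndex w z.1) z.2 ≤
        |diffQuot w l φ z - dx l φ z| * b := by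
      refine (le_abs_self _).trans ?_
      rw [abs_mul]
      exact mul_le_mul_of_nonneg_left (hpb l _ _ hz) (abs_nonneg _)
    linarith
  have hsum := Finset.sum_le_sum fun l (_ : l ∈ Finset.univ) => hconv l
  rw [integral_spaceTime_mul_deriv hφ hc hy hym hyb, Finset.sum_add_distrib] at hΨ
  rw [Finset.sum_add_distrib] at hsum ⊢
  linarith

end Discrete

end EMV

namespace EMV

/-! ### Scheme solutions -/

section SchemeSolution

variable {d N p : ℕ}

theorem ae_hasDerivAt_integral_Ioi {V : Type*} [NormedAddCommGroup V] [NormedSpace ℝ V]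
    [CompleteSpace V] {g : ℝ → V} (hg : ∀ t, 0 ≤ t → IntervalIntegrable g volume 0 t) :
    ∀ᵐ t ∂(volume.restrict (Ioi (0 : ℝ))), HasDerivAt (fun t => ∫ τ in (0 : ℝ)..t, g τ) (g t) t := by
  have h1 : ∀ᵐ t, ∀ n : ℕ, t ∈ uIcc (0 : ℝ) n → ∀ c ∈ uIcc (0 : ℝ) n,
      HasDerivAt (fun t => ∫ τ in c..t, g τ) (g t) t :=
    ae_all_iff.2 fun n => (hg n n.cast_nonneg).ae_hasDerivAt_integral
  filter_upwards [ae_restrict_of_ae h1, ae_restrict_mem measurableSet_Ioi] with t ht ht0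
  obtain ⟨n, hn⟩ := exists_nat_ge t
  exact ht n (by rw [uIcc_of_le n.cast_nonneg]; exact ⟨(mem_Ioi.1 ht0).le, hn⟩) 0 left_mem_uIcc

/-- The right-hand side of the scheme, with the opposite sign. -/
noncomputable def fluxDifference {V : Type*} [NormedAddCommGroup V] [NormedSpace ℝ V]
    (w : Fin d → ℝ) (F : Fin d → (Stencil d p → E N) → V) (u : Grid d → ℝ → E N)
    (i : Grid d) (t : ℝ) : V :=
  ∑ l, (w l)⁻¹ • (faceFlux F u l i t - faceFlux F u l (i - Pi.single l 1) t)

variable {w : Fin d → ℝ} {F : Fin d → (Stencil d p → E N) → E N} {v : Grid d → E N}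
  {u : Grid d → ℝ → E N}

theorem IsSchemeSolution.intervalIntegrable (hu : IsSchemeSolution w F v u) (i : Grid d) {t : ℝ}
    (ht : 0 ≤ t) : IntervalIntegrable (fluxDifference w F u i) volume 0 t := by
  have h1 : ∀ l ∈ Finset.univ, IntervalIntegrable (fun τ => (w l)⁻¹ •
      (faceFlux F u l i τ - faceFlux F u l (i - Pi.single l 1) τ)) volume 0 t := fun l _ =>
    (((hu i t ht).1 l).sub ((hu (i - Pi.single l 1) t ht).1 l)).smul (w l)⁻¹
  exact (IntervalIntegrable.sum _ h1).congr fun τ _ => Finset.sum_apply _ _ _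

theorem IsSchemeSolution.eq_sub_integral (hu : IsSchemeSolution w F v u) (i : Grid d) {t : ℝ}
    (ht : 0 ≤ t) : u i t = v i - ∫ τ in (0 : ℝ)..t, fluxDifference w F u i τ := by
  have h1 : ∀ l ∈ Finset.univ, IntervalIntegrable (fun τ => (w l)⁻¹ •
      (faceFlux F u l i τ - faceFlux F u l (i - Pi.single l 1) τ)) volume 0 t := fun l _ =>
    (((hu i t ht).1 l).sub ((hu (i - Pi.single l 1) t ht).1 l)).smul (w l)⁻¹
  unfold fluxDifference
  rw [intervalIntegral.integral_finsetSum h1, (hu i t ht).2]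
  simp_rw [intervalIntegral.integral_smul]

theorem IsSchemeSolution.initial (hu : IsSchemeSolution w F v u) (i : Grid d) : u i 0 = v i := by
  rw [hu.eq_sub_integral i le_rfl, intervalIntegral.integral_same, sub_zero]

theorem IsSchemeSolution.ae_hasDerivAt (hu : IsSchemeSolution w F v u) (i : Grid d) :
    ∀ᵐ t ∂(volume.restrict (Ioi (0 : ℝ))), HasDerivAt (u i) (-fluxDifference w F u i t) t := by
  filter_upwards [ae_hasDerivAt_integral_Ioi fun t ht => hu.intervalIntegrable i ht,
    ae_restrict_mem measurableSet_Ioi] with t ht ht0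
  have h1 := ht.const_sub (v i)
  refine h1.congr_of_eventuallyEq ?_
  filter_upwards [Ioi_mem_nhds ht0] with s hs
  exact hu.eq_sub_integral i (mem_Ioi.1 hs).le

theorem IsSchemeSolution.continuousOn (hu : IsSchemeSolution w F v u) (i : Grid d) :
    ContinuousOn (u i) (Ici 0) := by
  refine ContinuousOn.congr (f := fun t => v i - ∫ τ in (0 : ℝ)..t, fluxDifference w F u i τ)
    (continuousOn_const.sub ?_) fun t ht => hu.eq_sub_integral i ht
  intro t ht
  have ht' : (0 : ℝ) ≤ t + 1 := by linarith [mem_Ici.1 ht]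
  have h1 := intervalIntegral.continuousOn_primitive_interval
    ((intervalIntegrable_iff' (by simp)).1 (hu.intervalIntegrable i ht'))
  rw [uIcc_of_le ht'] at h1
  refine (h1 t ⟨ht, by linarith⟩).mono_of_mem_nhdsWithin ?_
  rw [mem_nhdsWithin]
  exact ⟨Iio (t + 1), isOpen_Iio, by simp, fun s hs => ⟨hs.2, hs.1.le⟩⟩

/-- The right-hand side of the scheme is bounded by a constant that depends on the mesh but not on
the cell. This suffices, since the constant only ensures integrability and does not enter the error
terms. -/
theorem IsSchemeSolution.lipschitzOnWith (hw : ∀ l, 0 < w l) (hu : IsSchemeSolution w F v u)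
    {b : ℝ} (hb0 : 0 ≤ b) (hb : ∀ l i t, 0 ≤ t → ‖faceFlux F u l i t‖ ≤ b) :
    ∃ L, ∀ i, LipschitzOnWith L (u i) (Ici 0) := by
  have hL : 0 ≤ ∑ l, (w l)⁻¹ * (b + b) := Finset.sum_nonneg fun l _ =>
    mul_nonneg (inv_pos.2 (hw l)).le (by linarith)
  refine ⟨⟨_, hL⟩, fun i => LipschitzOnWith.of_dist_le_mul fun t ht s hs => ?_⟩
  have h1 : ∀ τ, 0 ≤ τ → ‖fluxDifference w F u i τ‖ ≤ ∑ l, (w l)⁻¹ * (b + b) := fun τ hτ => by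
    refine norm_sum_le_of_le _ fun l _ => ?_
    rw [norm_smul, Real.norm_eq_abs, abs_of_pos (inv_pos.2 (hw l))]
    exact mul_le_mul_of_nonneg_left ((norm_sub_le _ _).trans (add_le_add (hb _ _ _ hτ)
      (hb _ _ _ hτ))) (inv_pos.2 (hw l)).le
  have h2 : u i t - u i s = ∫ τ in t..s, fluxDifference w F u i τ := by
    rw [hu.eq_sub_integral i ht, hu.eq_sub_integral i hs, sub_sub_sub_cancel_left,
      intervalIntegral.integral_interval_sub_left (hu.intervalIntegrable i hs)
        (hu.intervalIntegrable i ht)]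
  rw [dist_eq_norm, h2, dist_comm, Real.dist_eq]
  refine intervalIntegral.norm_integral_le_of_norm_le_const fun τ hτ => h1 τ ?_
  exact (le_min (mem_Ici.1 ht) (mem_Ici.1 hs)).trans hτ.1.le

end SchemeSolution

/-! ### Consistent numerical fluxes -/

section ConsistentFlux

variable {d N p : ℕ} {V : Type*} [NormedAddCommGroup V]
  {F : ℝ → Fin d → (Stencil d p → E N) → V} {f : Fin d → E N → V} {K : Set (E N)}

theorem IsConsistentFlux.exists_norm_sub_le (hF : IsConsistentFlux F f) (hK : IsCompact K) :
    ∃ C, 0 ≤ C ∧ ∀ Δx > 0, ∀ (u : Grid d → ℝ → E N) l i t, (∀ i, u i t ∈ K) →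
      ‖faceFlux (F Δx) u l i t - f l (u i t)‖ ≤
        C * ∑ m : Stencil d p, ‖u (i + m.toGrid) t - u i t‖ := by
  obtain ⟨C, hC⟩ := hF.2 K hK
  refine ⟨max C 0, le_max_right _ _, fun Δx hΔ u l i t hu => ?_⟩
  have h1 := hC Δx hΔ l (fun k => u (i + k) t) fun m => hu _
  simp only [add_zero] at h1
  exact h1.trans (mul_le_mul_of_nonneg_right (le_max_left _ _)
    (Finset.sum_nonneg fun _ _ => norm_nonneg _))

theorem exists_sum_norm_sub_le (hK : IsCompact K) :
    ∃ b, 0 ≤ b ∧ ∀ (u : Grid d → ℝ → E N) i t, (∀ i, u i t ∈ K) →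
      ∑ m : Stencil d p, ‖u (i + m.toGrid) t - u i t‖ ≤ b := by
  obtain ⟨b, hb0, hb⟩ := exists_abs_le_on hK (continuous_norm (E := E N))
  refine ⟨∑ _m : Stencil d p, (b + b), Finset.sum_nonneg fun _ _ => by linarith,
    fun u i t hu => Finset.sum_le_sum fun m _ => (norm_sub_le _ _).trans ?_⟩
  have h1 := hb _ (hu (i + m.toGrid))
  have h2 := hb _ (hu i)
  rw [abs_norm] at h1 h2
  exact add_le_add h1 h2

theorem IsConsistentFlux.exists_norm_le (hF : IsConsistentFlux F f) (hK : IsCompact K)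
    (hf : ∀ l, Continuous (f l)) :
    ∃ b, 0 ≤ b ∧ ∀ Δx > 0, ∀ (u : Grid d → ℝ → E N) l i t, (∀ i, u i t ∈ K) →
      ‖faceFlux (F Δx) u l i t‖ ≤ b := by
  obtain ⟨C, hC0, hC⟩ := hF.exists_norm_sub_le hK
  obtain ⟨b, hb0, hb⟩ := exists_sum_norm_sub_le (d := d) (p := p) hK
  choose b' hb'0 hb' using fun l => exists_abs_le_on hK (hf l).norm
  refine ⟨C * b + ∑ l, b' l, add_nonneg (mul_nonneg hC0 hb0)
    (Finset.sum_nonneg fun l _ => hb'0 l), fun Δx hΔ u l i t hu => ?_⟩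
  have h1 := (hC Δx hΔ u l i t hu).trans (mul_le_mul_of_nonneg_left (hb u i t hu) hC0)
  have h2 := hb' l _ (hu i)
  rw [abs_norm] at h2
  have h3 : b' l ≤ ∑ l, b' l :=
    Finset.single_le_sum (fun l _ => hb'0 l) (Finset.mem_univ l)
  have h4 := norm_add_le (faceFlux (F Δx) u l i t - f l (u i t)) (f l (u i t))
  rw [sub_add_cancel] at h4
  linarith

/-- Each coordinate of the scheme becomes a scalar balance law with a consistent flux, so the
argument for entropies covers the conservation law. -/
theorem IsConsistentFlux.apply {F : ℝ → Fin d → (Stencil d p → E N) → E N}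
    {f : Fin d → E N → E N} (hF : IsConsistentFlux F f) (k : Fin N) :
    IsConsistentFlux (fun Δx l s => F Δx l s k) fun l ξ => f l ξ k := by
  refine ⟨hF.1, fun K hK => ?_⟩
  obtain ⟨C, hC⟩ := hF.2 K hK
  refine ⟨C, fun Δx hΔ l v hv => le_trans ?_ (hC Δx hΔ l v hv)⟩
  exact PiLp.norm_apply_le (F Δx l (fun m => v m.toGrid) - f l (v 0)) k

end ConsistentFlux

/-! ### Consistency of the approximations for fixed initial data -/

section Consistency

variable {d N : ℕ} {φ : E d × ℝ → ℝ}

/-- The weak form of the conservation law `∂ₜ η(u) + ∇ₓ · q(u) = 0`, for grid functions. -/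
noncomputable def weakForm (w : Fin d → ℝ) (φ : E d × ℝ → ℝ) (u : Grid d → ℝ → E N) (η : E N → ℝ)
    (q : Fin d → E N → ℝ) : ℝ :=
  fieldPairing (spaceTime d) (cellwiseST w u) (dt φ) η +
    (∑ l, fieldPairing (spaceTime d) (cellwiseST w u) (dx l φ) (q l)) +
    ∫ x, φ (x, 0) * η (cellwise w (fun i => u i 0) x)

theorem ae_spaceTime_nonneg (d : ℕ) : ∀ᵐ z ∂(spaceTime d), 0 ≤ z.2 :=
  (ae_restrict_mem (MeasurableSet.univ.prod measurableSet_Ici)).mono fun _ hz => hz.2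

theorem lintegral_spaceTime_le {G : E d × ℝ → ℝ≥0∞} (hG : Measurable G) {g : E d × ℝ → ℝ≥0∞}
    {ρ : ℝ} (hg : ∀ z, 0 ≤ z.2 → ‖z‖ ≤ ρ → g z ≤ G z) (hg0 : ∀ z, ρ < ‖z‖ → g z = 0) :
    ∫⁻ z, g z ∂(spaceTime d) ≤
      ∫⁻ t in Icc 0 ρ, ∫⁻ x in Metric.closedBall 0 ρ, G (x, t) := by
  have hS : MeasurableSet (Metric.closedBall (0 : E d) ρ ×ˢ Icc (0 : ℝ) ρ) :=
    Metric.isClosed_closedBall.measurableSet.prod measurableSet_Icc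
  have h1 : ∀ᵐ z ∂(spaceTime d),
      g z ≤ (Metric.closedBall (0 : E d) ρ ×ˢ Icc (0 : ℝ) ρ).indicator G z := by
    filter_upwards [ae_spaceTime_nonneg d] with z hz
    by_cases hzS : ‖z‖ ≤ ρ
    · rw [indicator_of_mem]
      · exact hg z hz hzS
      · exact ⟨mem_closedBall_zero_iff.2 ((le_max_left _ _).trans hzS), hz,
          (le_abs_self _).trans ((le_max_right ‖z.1‖ ‖z.2‖).trans hzS)⟩
    · rw [hg0 z (not_le.1 hzS)]
      exact zero_le
  refine (lintegral_mono_ae h1).trans ?_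
  have h2 : ∫⁻ z, (Metric.closedBall (0 : E d) ρ ×ˢ Icc (0 : ℝ) ρ).indicator G z ∂(spaceTime d) ≤
      ∫⁻ z, (Metric.closedBall (0 : E d) ρ ×ˢ Icc (0 : ℝ) ρ).indicator G z :=
    lintegral_mono' Measure.restrict_le_self le_rfl
  refine h2.trans ?_
  rw [lintegral_indicator hS, Measure.volume_eq_prod, ← Measure.prod_restrict,
    lintegral_prod_symm _ hG.aemeasurable]

theorem lintegral_lintegral_const_mul_sum {ι : Type*} [Fintype ι] (w : Fin d → ℝ)
    {a : ι → Grid d → ℝ → ℝ≥0∞} (ha : ∀ m i, Measurable (a m i)) (b : ℝ≥0∞) (hb : b ≠ ⊤)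
    (S : Set ℝ) (B : Set (E d)) :
    ∫⁻ t in S, ∫⁻ x in B, b * ∑ m, a m (cellIndex w x) t =
      b * ∑ m, ∫⁻ t in S, ∫⁻ x in B, a m (cellIndex w x) t := by
  have h1 : ∀ t, ∫⁻ x in B, b * ∑ m, a m (cellIndex w x) t =
      b * ∑ m, ∫⁻ x in B, a m (cellIndex w x) t := fun t => by
    rw [lintegral_const_mul' _ _ hb, lintegral_finsetSum _ fun m _ =>
      measurable_cellwise_space w fun i => a m i t]
  simp_rw [h1]
  rw [lintegral_const_mul' _ _ hb, lintegral_finsetSum _ fun m _ =>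
    measurable_lintegral_cellwise w (ha m) B]

theorem tendsto_integral_of_lintegral_le {X : Type*} [MeasurableSpace X] {μ : Measure X}
    {g : ℕ → X → ℝ} (hg0 : ∀ n z, 0 ≤ g n z) (hg : ∀ n, AEStronglyMeasurable (g n) μ)
    {b : ℕ → ℝ≥0∞} (hb : Tendsto b atTop (𝓝 0))
    (hgb : ∀ᶠ n in atTop, ∫⁻ z, ENNReal.ofReal (g n z) ∂μ ≤ b n) :
    Tendsto (fun n => ∫ z, g n z ∂μ) atTop (𝓝 0) := by
  have h1 : Tendsto (fun n => ∫⁻ z, ENNReal.ofReal (g n z) ∂μ) atTop (𝓝 0) :=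
    tendsto_of_tendsto_of_tendsto_of_le_of_le' tendsto_const_nhds hb
      (Eventually.of_forall fun _ => zero_le) hgb
  have h2 := (ENNReal.tendsto_toReal ENNReal.zero_ne_top).comp h1
  refine h2.congr fun n => ?_
  exact (integral_eq_lintegral_of_nonneg_ae (ae_of_all _ (hg0 n)) (hg n)).symm

variable {V : Type*} [NormedAddCommGroup V] [MeasurableSpace V] [BorelSpace V]
  [SecondCountableTopology V]

/-- This is the consistency error of the fluxes. The quotients are uniformly bounded and eventually
live in a fixed ball, where the stencil differences vanish in L¹ by weak BV. -/
theorem tendsto_integral_diffQuot_mul (hφ : ContDiff ℝ 1 φ) (hc : HasCompactSupport φ)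
    {w : ℕ → Fin d → ℝ} (hw : ∀ n l, 0 < w n l)
    (hw0 : ∀ l, Tendsto (fun n => w n l) atTop (𝓝 0))
    {u : ℕ → Grid d → ℝ → V} (hum : ∀ n i, Measurable (u n i)) {r : ℝ} (hr : 1 ≤ r)
    (hBV : ∀ T > 0, Tendsto (fun n => ∫⁻ t in Icc 0 T, ∑' i : Grid d,
      (∑ l, ‖u n (i + Pi.single l 1) t - u n i t‖ₑ ^ r) * ENNReal.ofReal (∏ l, w n l)) atTop (𝓝 0))
    {C : ℝ} (hC0 : 0 ≤ C) {ι : Type*} [Fintype ι] (k : ι → Grid d) (l : Fin d) :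
    Tendsto (fun n => ∫ z, |diffQuot (w n) l φ z| * (C * ∑ m,
      ‖u n (cellIndex (w n) z.1 + k m) z.2 - u n (cellIndex (w n) z.1) z.2‖) ∂(spaceTime d))
      atTop (𝓝 0) := by
  obtain ⟨Lφ, hLφ0, hLφ⟩ := exists_abs_diffQuot_le hφ hc
  obtain ⟨ρ, hρ0, hρ⟩ := exists_radius hc
  have hem : ∀ n i, Measurable fun t => C * ∑ m, ‖u n (i + k m) t - u n i t‖ := fun n i =>
    (Finset.measurable_sum _ fun m _ => ((hum n _).sub (hum n _)).norm).const_mul C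
  have he0 : ∀ n (z : E d × ℝ), 0 ≤ C * ∑ m,
      ‖u n (cellIndex (w n) z.1 + k m) z.2 - u n (cellIndex (w n) z.1) z.2‖ := fun n z =>
    mul_nonneg hC0 (Finset.sum_nonneg fun _ _ => norm_nonneg _)
  have h1 : Tendsto (fun n => ENNReal.ofReal (Lφ * C) * ∑ m,
      ∫⁻ t in Icc 0 (ρ + 1), ∫⁻ x in Metric.closedBall 0 (ρ + 1),
        ‖u n (cellIndex (w n) x + k m) t -
          u n (cellIndex (w n) x) t‖ₑ) atTop (𝓝 0) := by
    have h2 := ENNReal.Tendsto.const_mul (a := ENNReal.ofReal (Lφ * C))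
      (tendsto_finsetSum (Finset.univ : Finset ι) fun m _ =>
        tendsto_lintegral_sub hw hum hr (hBV (ρ + 1) (by linarith))
          (isCompact_closedBall (0 : E d) (ρ + 1)).measure_lt_top.ne (k m))
      (Or.inr ENNReal.ofReal_ne_top)
    simpa using h2
  refine tendsto_integral_of_lintegral_le (fun n z => mul_nonneg (abs_nonneg _) (he0 n z))
    (fun n => ((continuous_diffQuot _ l hφ.continuous).abs.measurable.mul
      (measurable_cellwise _ (hem n))).aestronglyMeasurable) h1 ?_
  filter_upwards [(hw0 l).eventually (gt_mem_nhds one_pos)] with n hn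
  rw [← lintegral_lintegral_const_mul_sum _ (a := fun (m : ι) i t =>
    ‖u n (i + k m) t - u n i t‖ₑ) (fun m i => ((hum n _).sub (hum n _)).enorm) _
    ENNReal.ofReal_ne_top]
  refine lintegral_spaceTime_le (G := fun z => ENNReal.ofReal (Lφ * C) * ∑ m,
      ‖u n (cellIndex (w n) z.1 + k m) z.2 -
        u n (cellIndex (w n) z.1) z.2‖ₑ)
    ((Finset.measurable_sum _ fun m _ => measurable_cellwise (w n)
      (a := fun i t => ‖u n (i + k m) t - u n i t‖ₑ)
      fun i => ((hum n _).sub (hum n _)).enorm).const_mul _) (fun z _ _ => ?_) fun z hz => ?_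
  · have h3 : ∑ m, ‖u n (cellIndex (w n) z.1 + k m) z.2 -
        u n (cellIndex (w n) z.1) z.2‖ₑ = ENNReal.ofReal (∑ m,
        ‖u n (cellIndex (w n) z.1 + k m) z.2 -
          u n (cellIndex (w n) z.1) z.2‖) := by
      rw [ENNReal.ofReal_sum_of_nonneg fun _ _ => norm_nonneg _]
      exact Finset.sum_congr rfl fun m _ => (ofReal_norm _).symm
    rw [h3, ← ENNReal.ofReal_mul (mul_nonneg hLφ0 hC0), mul_assoc]
    exact ENNReal.ofReal_le_ofReal (mul_le_mul_of_nonneg_right (hLφ _ (hw n) l z)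
      (he0 n z))
  · rw [diffQuot_eq_zero (hw n) (fun z hz => (hρ z hz).1) (by linarith), abs_zero, zero_mul,
      ENNReal.ofReal_zero]

/-- A discrete entropy inequality gives the entropy inequality in the limit. -/
theorem weakForm_lower_bound (hφ : ContDiff ℝ 1 φ) (hc : HasCompactSupport φ)
    {c : Fin d → ℝ} (hcpos : ∀ l, 0 < c l) {h : ℕ → ℝ} (hh : ∀ n, 0 < h n)
    (hlim : Tendsto h atTop (𝓝 0)) {K : Set (E N)} (hK : IsCompact K)
    {u : ℕ → Grid d → ℝ → E N} (hum : ∀ n i, Measurable (u n i))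
    (huK : ∀ n i t, 0 ≤ t → u n i t ∈ K)
    (huL : ∀ n, ∃ L, ∀ i, LipschitzOnWith L (u n i) (Ici 0))
    {r : ℝ} (hr : 1 ≤ r)
    (hBV : ∀ T > 0, Tendsto (fun n => ∫⁻ t in Icc 0 T, ∑' i : Grid d,
      (∑ l, ‖u n (i + Pi.single l 1) t - u n i t‖ₑ ^ r) *
        ENNReal.ofReal (∏ l, width c (h n) l)) atTop (𝓝 0))
    {η : E N → ℝ} (hη : LocallyLipschitz η) {q : Fin d → E N → ℝ} (hq : ∀ l, Continuous (q l))
    {s : ℕ} {Q : ℝ → Fin d → (Stencil d s → E N) → ℝ} (hQ : IsConsistentFlux Q q)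
    (hineq : ∀ n i, ∀ᵐ t ∂(volume.restrict (Ioi (0 : ℝ))), ∀ x, φ (x, t) *
      (deriv (fun τ => η (u n i τ)) t + fluxDifference (width c (h n)) (Q (h n)) (u n) i t) ≤ 0) :
    ∃ ε : ℕ → ℝ, Tendsto ε atTop (𝓝 0) ∧
      ∀ n, -ε n ≤ weakForm (width c (h n)) φ (u n) η q := by
  have hw : ∀ n l, 0 < width c (h n) l := fun n l => mul_pos (hcpos l) (hh n)
  have hw0 : ∀ l, Tendsto (fun n => width c (h n) l) atTop (𝓝 0) := fun l => by
    simpa [width] using hlim.const_mul (c l)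
  obtain ⟨b₁, hb₁0, hb₁⟩ := exists_abs_le_on hK hη.continuous
  choose b₂ hb₂0 hb₂ using fun l => exists_abs_le_on hK (hq l)
  obtain ⟨C, hC0, hC⟩ := hQ.exists_norm_sub_le hK
  obtain ⟨b₃, hb₃0, hb₃⟩ := exists_sum_norm_sub_le (d := d) (p := s) hK
  -- On the compact set `K` the function η is globally Lipschitz, so η(u_i) is Lipschitz in time
  -- with one constant for all cells.
  obtain ⟨Lη, hLη⟩ := (hη.locallyLipschitzOn (s := K)).exists_lipschitzOnWith_of_compact hK
  let b := b₁ + ∑ l, b₂ l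
  have hb1b : b₁ ≤ b := le_add_of_nonneg_right (Finset.sum_nonneg fun l _ => hb₂0 l)
  have hb2b : ∀ l, b₂ l ≤ b := fun l => (Finset.single_le_sum (fun l _ => hb₂0 l)
    (Finset.mem_univ l)).trans (le_add_of_nonneg_left hb₁0)
  let e : ℕ → Grid d → ℝ → ℝ := fun n i t =>
    C * ∑ m : Stencil d s, ‖u n (i + m.toGrid) t - u n i t‖
  have hem : ∀ n i, Measurable (e n i) := fun n i =>
    (Finset.measurable_sum _ fun m _ => ((hum n _).sub (hum n _)).norm).const_mul C
  have he0 : ∀ n i t, 0 ≤ e n i t := fun n i t =>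
    mul_nonneg hC0 (Finset.sum_nonneg fun _ _ => norm_nonneg _)
  refine ⟨fun n => ∑ l, (b * ∫ z, |diffQuot (width c (h n)) l φ z - dx l φ z| ∂(spaceTime d) +
    ∫ z, |diffQuot (width c (h n)) l φ z| * e n (cellIndex (width c (h n)) z.1) z.2
      ∂(spaceTime d)), ?_, fun n => ?_⟩
  · rw [← Finset.sum_const_zero (s := (Finset.univ : Finset (Fin d)))]
    refine tendsto_finsetSum _ fun l _ => ?_
    rw [← add_zero (0 : ℝ)]
    refine Tendsto.add ?_ ?_
    · simpa using (tendsto_integral_diffQuot_sub hφ hc hw hw0 l).const_mul b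
    · exact tendsto_integral_diffQuot_mul hφ hc hw hw0 hum hr hBV hC0 Stencil.toGrid l
  · obtain ⟨L, hL⟩ := huL n
    have hy : ∀ i, LipschitzOnWith (Lη * L) (fun t => η (u n i t)) (Ici 0) := fun i =>
      hLη.comp (hL i) fun t ht => huK n i t ht
    exact discrete_entropy_inequality (hw n) hφ hc hy (fun i => hη.continuous.measurable.comp (hum n i))
      (fun i t ht => (hb₁ _ (huK n i t ht)).trans hb1b)
      (p := fun l i t => q l (u n i t))
      (fun l i => (hq l).measurable.comp (hum n i))
      (fun l i t ht => (hb₂ l _ (huK n i t ht)).trans (hb2b l))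
      (e := e n) (hem n)
      (fun i t ht => by
        rw [abs_of_nonneg (he0 n i t)]
        exact mul_le_mul_of_nonneg_left (hb₃ (u n) i t fun i => huK n i t ht) hC0)
      (Q := fun l i t => faceFlux (Q (h n)) (u n) l i t)
      (fun l i t ht => hC (h n) (hh n) (u n) l i t fun i => huK n i t ht) (hineq n)

theorem weakForm_neg (w : Fin d → ℝ) (φ : E d × ℝ → ℝ) (u : Grid d → ℝ → E N) (η : E N → ℝ)
    (q : Fin d → E N → ℝ) : weakForm w (-φ) u η q = -weakForm w φ u η q := by
  have h1 : dt (-φ) = -dt φ := by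
    funext z
    rw [dt, fderiv_neg]
    rfl
  have h2 : ∀ l, dx l (-φ) = -dx l φ := fun l => by
    funext z
    rw [dx, fderiv_neg]
    rfl
  simp only [weakForm, fieldPairing, h1, h2, Pi.neg_apply, neg_mul, integral_neg,
    Finset.sum_neg_distrib]
  ring

/-- Scheme solutions satisfy the conservation law in the limit. -/
theorem tendsto_weakForm_coordinate (hφ : ContDiff ℝ 1 φ) (hc : HasCompactSupport φ)
    {c : Fin d → ℝ} (hcpos : ∀ l, 0 < c l) {h : ℕ → ℝ} (hh : ∀ n, 0 < h n)
    (hlim : Tendsto h atTop (𝓝 0)) {K : Set (E N)} (hK : IsCompact K)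
    {u : ℕ → Grid d → ℝ → E N} (hum : ∀ n i, Measurable (u n i))
    (huK : ∀ n i t, 0 ≤ t → u n i t ∈ K)
    (huL : ∀ n, ∃ L, ∀ i, LipschitzOnWith L (u n i) (Ici 0))
    {r : ℝ} (hr : 1 ≤ r)
    (hBV : ∀ T > 0, Tendsto (fun n => ∫⁻ t in Icc 0 T, ∑' i : Grid d,
      (∑ l, ‖u n (i + Pi.single l 1) t - u n i t‖ₑ ^ r) *
        ENNReal.ofReal (∏ l, width c (h n) l)) atTop (𝓝 0))
    {p : ℕ} {F : ℝ → Fin d → (Stencil d p → E N) → E N} {f : Fin d → E N → E N}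
    (hf : ∀ l, Continuous (f l)) (hF : IsConsistentFlux F f) {v : ℕ → Grid d → E N}
    (hu : ∀ n, IsSchemeSolution (width c (h n)) (F (h n)) (v n) (u n)) (k : Fin N) :
    Tendsto (fun n => weakForm (width c (h n)) φ (u n) (fun ξ => ξ k) fun l ξ => f l ξ k)
      atTop (𝓝 0) := by
  have hη : LocallyLipschitz fun ξ : E N => ξ k :=
    (EuclideanSpace.proj (𝕜 := ℝ) k : E N →L[ℝ] ℝ).lipschitz.locallyLipschitz
  have hcoord : Continuous fun ξ : E N => ξ k := hη.continuous
  have hzero : ∀ n i, ∀ᵐ t ∂(volume.restrict (Ioi (0 : ℝ))), deriv (fun τ => u n i τ k) t +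
      fluxDifference (width c (h n)) (fun l s => F (h n) l s k) (u n) i t = 0 := fun n i => by
    filter_upwards [(hu n).ae_hasDerivAt i] with t ht
    have h1 : HasDerivAt (fun τ => u n i τ k)
        ((-fluxDifference (width c (h n)) (F (h n)) (u n) i t : E N) k) t :=
      (EuclideanSpace.proj (𝕜 := ℝ) k : E N →L[ℝ] ℝ).hasFDerivAt.comp_hasDerivAt t ht
    have h2 : fluxDifference (width c (h n)) (fun l s => F (h n) l s k) (u n) i t =
        (fluxDifference (width c (h n)) (F (h n)) (u n) i t : E N) k := by
      simp [fluxDifference, faceFlux]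
    rw [h1.deriv, h2, PiLp.neg_apply, neg_add_cancel]
  -- The bracket in the hypothesis of `weakForm_lower_bound` vanishes here, so no sign of φ is
  -- required and -φ supplies the upper bound.
  have key : ∀ φ : E d × ℝ → ℝ, ContDiff ℝ 1 φ → HasCompactSupport φ → ∃ ε : ℕ → ℝ,
      Tendsto ε atTop (𝓝 0) ∧ ∀ n, -ε n ≤
        weakForm (width c (h n)) φ (u n) (fun ξ => ξ k) fun l ξ => f l ξ k := fun φ hφ hc =>
    weakForm_lower_bound hφ hc hcpos hh hlim hK hum huK huL hr hBV hη
      (fun l => hcoord.comp (hf l)) (hF.apply k) fun n i => by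
        filter_upwards [hzero n i] with t ht x
        rw [ht, mul_zero]
  obtain ⟨ε, hε, h1⟩ := key φ hφ hc
  obtain ⟨ε', hε', h2⟩ := key (-φ) hφ.neg hc.neg
  refine tendsto_of_tendsto_of_tendsto_of_le_of_le (by simpa using hε.neg) hε' h1 fun n => ?_
  have := h2 n
  rw [weakForm_neg] at this
  linarith

end Consistency

end EMV

namespace EMV

/-! ### Expectations -/

section Expectation

theorem integral_law {X : Type*} {N : ℕ} {Ω : Type*} [MeasurableSpace Ω] {P : Measure Ω}
    {V : Ω → X → E N} {z : X}
    (hV : Measurable fun ω => V ω z) {W : Type*}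
    [NormedAddCommGroup W] [NormedSpace ℝ W]
    [SecondCountableTopology W] {g : E N → W}
    (hg : Continuous g) : ∫ ξ, g ξ ∂(law P V z) = ∫ ω, g (V ω z) ∂P :=
  integral_map hV.aemeasurable hg.stronglyMeasurable.aestronglyMeasurable

variable {X : Type*} [MeasurableSpace X] {N : ℕ} {K : Set (E N)} {μ : Measure X}
  {Ω : Type*} [MeasurableSpace Ω] {P : Measure Ω} [IsProbabilityMeasure P]

theorem integral_fieldPairing [SFinite μ] (hK : IsCompact K) {V : Ω → X → E N}
    (hV : Measurable (Function.uncurry V)) (hVK : ∀ ω z, V ω z ∈ K) {ψ : X → ℝ}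
    (hψ : Integrable ψ μ) {g : E N → ℝ} (hg : Continuous g) :
    ∫ ω, fieldPairing μ (V ω) ψ g ∂P = ∫ z, ψ z * ∫ ξ, g ξ ∂(law P V z) ∂μ := by
  obtain ⟨b, -, hb⟩ := exists_abs_le_on hK hg
  have h1 : Integrable (Function.uncurry fun ω z => ψ z * g (V ω z)) (P.prod μ) :=
    (hψ.comp_snd P).mul_bdd (c := b) (hg.measurable.comp hV).aestronglyMeasurable
      (ae_of_all _ fun a => hb _ (hVK a.1 a.2))
  unfold fieldPairing
  rw [integral_integral_swap h1]
  refine integral_congr_ae (ae_of_all _ fun z => ?_)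
  simp only
  rw [integral_const_mul, integral_law (show Measurable fun ω => V ω z from
    hV.comp measurable_prodMk_right) hg]

/-- The null sequences depend on ω, without any uniformity. The functions min (R n) 0 are bounded
and tend to zero pointwise, so dominated convergence applies to them. -/
theorem eventually_neg_le_integral {R : ℕ → Ω → ℝ} (hR : ∀ n, Measurable (R n)) {b : ℝ}
    (hb : ∀ n ω, |R n ω| ≤ b)
    (hlow : ∀ ω, ∃ ε : ℕ → ℝ, Tendsto ε atTop (𝓝 0) ∧ ∀ n, -ε n ≤ R n ω) {δ : ℝ} (hδ : 0 < δ) :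
    ∀ᶠ n in atTop, -δ ≤ ∫ ω, R n ω ∂P := by
  have h1 : Tendsto (fun n => ∫ ω, min (R n ω) 0 ∂P) atTop (𝓝 (∫ _ω, (0 : ℝ) ∂P)) := by
    refine tendsto_integral_of_dominated_convergence (fun _ => b)
      (fun n => ((hR n).min measurable_const).aestronglyMeasurable) (integrable_const b)
      (fun n => ae_of_all _ fun ω => ?_) (ae_of_all _ fun ω => ?_)
    · rw [Real.norm_eq_abs, abs_of_nonpos (min_le_right _ _)]
      rcases min_cases (R n ω) 0 with h | h <;> linarith [abs_le.1 (hb n ω)]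
    · obtain ⟨ε, hε, h⟩ := hlow ω
      have h2 : Tendsto (fun n => min (-ε n) 0) atTop (𝓝 0) := by
        simpa using hε.neg.min (tendsto_const_nhds (x := (0 : ℝ)))
      exact tendsto_of_tendsto_of_tendsto_of_le_of_le h2 tendsto_const_nhds
        (fun n => min_le_min_right _ (h n)) fun n => min_le_right _ _
  rw [integral_zero] at h1
  filter_upwards [h1.eventually (lt_mem_nhds (neg_lt_zero.2 hδ))] with n hn
  refine hn.le.trans (integral_mono ?_ (integrable_of_abs_le (hR n) (hb n)) fun ω =>
    min_le_left _ _)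
  exact (integrable_of_abs_le (hR n) (hb n)).inf (integrable_const 0)

end Expectation

/-! ### Consistency of random approximations -/

section RandomConsistency

variable {d N p : ℕ} {Ω : Type*} [MeasurableSpace Ω]

/-- Uniformly bounded random approximations by the scheme, along a sequence of mesh sizes. The
field `V n ω` is a version of the approximation `U n ω` with values in a compact set. -/
structure IsRandomApproximation (F : ℝ → Fin d → (Stencil d p → E N) → E N) (c : Fin d → ℝ)
    (h : ℕ → ℝ) (r : ℝ) (K : Set (E N)) (u₀ : ℕ → Ω → Grid d → E N)
    (U : ℕ → Ω → Grid d → ℝ → E N) (V : ℕ → Ω → E d × ℝ → E N) : Prop where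
  ratio_pos : ∀ l, 0 < c l
  mesh_pos : ∀ n, 0 < h n
  tendsto_mesh : Tendsto h atTop (𝓝 0)
  isCompact : IsCompact K
  measurable_time : ∀ n ω i, Measurable (U n ω i)
  mem : ∀ n ω i t, 0 ≤ t → U n ω i t ∈ K
  solution : ∀ n ω, IsSchemeSolution (width c (h n)) (F (h n)) (u₀ n ω) (U n ω)
  one_le : 1 ≤ r
  weakBV : ∀ ω, ∀ T > 0, Tendsto (fun n => ∫⁻ t in Icc 0 T, ∑' i : Grid d,
      (∑ l, ‖U n ω (i + Pi.single l 1) t - U n ω i t‖ₑ ^ r) *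
        ENNReal.ofReal (∏ l, width c (h n) l)) atTop (𝓝 0)
  measurable_initial : ∀ n, Measurable (u₀ n)
  measurable_field : ∀ n, Measurable (Function.uncurry (V n))
  field_mem : ∀ n ω z, V n ω z ∈ K
  field_ae_eq : ∀ n ω, cellwiseST (width c (h n)) (U n ω) =ᵐ[spaceTime d] V n ω

namespace IsRandomApproximation

variable {F : ℝ → Fin d → (Stencil d p → E N) → E N} {c : Fin d → ℝ} {h : ℕ → ℝ} {r : ℝ}
  {K : Set (E N)} {u₀ : ℕ → Ω → Grid d → E N} {U : ℕ → Ω → Grid d → ℝ → E N}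
  {V : ℕ → Ω → E d × ℝ → E N} {f : Fin d → E N → E N} {φ : E d × ℝ → ℝ} {P : Measure Ω}

theorem initial_mem (hA : IsRandomApproximation F c h r K u₀ U V) (n : ℕ) (ω : Ω) (i : Grid d) :
    u₀ n ω i ∈ K := by
  rw [← (hA.solution n ω).initial i]
  exact hA.mem n ω i 0 le_rfl

theorem lipschitz (hA : IsRandomApproximation F c h r K u₀ U V) (hF : IsConsistentFlux F f)
    (hf : ∀ l, Continuous (f l)) (n : ℕ) (ω : Ω) :
    ∃ L, ∀ i, LipschitzOnWith L (U n ω i) (Ici 0) := by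
  obtain ⟨b, hb0, hb⟩ := hF.exists_norm_le hA.isCompact hf
  exact (hA.solution n ω).lipschitzOnWith (fun l => mul_pos (hA.ratio_pos l) (hA.mesh_pos n)) hb0
    fun l i t ht => hb _ (hA.mesh_pos n) _ l i t fun i => hA.mem n ω i t ht

theorem measurable_initialField (hA : IsRandomApproximation F c h r K u₀ U V) (n : ℕ) :
    Measurable (Function.uncurry fun ω => cellwise (width c (h n)) (u₀ n ω)) := by
  have h1 : Measurable fun a : Ω × Grid d => u₀ n a.1 a.2 :=
    measurable_from_prod_countable_left fun i => (measurable_pi_apply i).comp (hA.measurable_initial n)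
  exact h1.comp (measurable_fst.prodMk ((measurable_cellIndex _).comp measurable_snd))

/-- In space-time `U` may be replaced by its version `V`, which is jointly measurable and `K`-valued
everywhere. The trace at time zero is not determined by `V` and is expressed by the initial data. -/
theorem weakForm_eq (hA : IsRandomApproximation F c h r K u₀ U V) (φ : E d × ℝ → ℝ)
    (η : E N → ℝ) (q : Fin d → E N → ℝ) (n : ℕ) (ω : Ω) :
    weakForm (width c (h n)) φ (U n ω) η q =
      fieldPairing (spaceTime d) (V n ω) (dt φ) η +
      (∑ l, fieldPairing (spaceTime d) (V n ω) (dx l φ) (q l)) +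
      fieldPairing volume (cellwise (width c (h n)) (u₀ n ω)) (fun x => φ (x, 0)) η := by
  have h1 : ∀ ψ g, fieldPairing (spaceTime d) (cellwiseST (width c (h n)) (U n ω)) ψ g =
      fieldPairing (spaceTime d) (V n ω) ψ g := fun ψ g =>
    integral_congr_ae ((hA.field_ae_eq n ω).mono fun z hz => by simp only [hz])
  have h2 : (fun i => U n ω i 0) = u₀ n ω := funext fun i => (hA.solution n ω).initial i
  simp only [weakForm, h1, h2]
  rfl

theorem integrable_slice (hφ : ContDiff ℝ 1 φ) (hc : HasCompactSupport φ) :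
    Integrable (fun x : E d => φ (x, 0)) volume :=
  (hφ.continuous.comp (by fun_prop)).integrable_of_hasCompactSupport (hasCompactSupport_slice hc 0)

theorem measurable_weakForm (hA : IsRandomApproximation F c h r K u₀ U V) (hφ : ContDiff ℝ 1 φ)
    (hc : HasCompactSupport φ) {η : E N → ℝ} (hη : Continuous η) {q : Fin d → E N → ℝ}
    (hq : ∀ l, Continuous (q l)) (n : ℕ) :
    Measurable fun ω => weakForm (width c (h n)) φ (U n ω) η q := by
  simp_rw [hA.weakForm_eq]
  exact ((measurable_fieldPairing (hA.measurable_field n) (integrable_dt hφ hc).1 hη).add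
    (Finset.measurable_sum _ fun l _ => measurable_fieldPairing (hA.measurable_field n)
      (integrable_dx hφ hc l).1 (hq l))).add
    (measurable_fieldPairing (hA.measurable_initialField n) (integrable_slice hφ hc).1 hη)

theorem exists_abs_weakForm_le (hA : IsRandomApproximation F c h r K u₀ U V)
    (hφ : ContDiff ℝ 1 φ) (hc : HasCompactSupport φ) {η : E N → ℝ} (hη : Continuous η)
    {q : Fin d → E N → ℝ} (hq : ∀ l, Continuous (q l)) :
    ∃ b, ∀ n ω, |weakForm (width c (h n)) φ (U n ω) η q| ≤ b := by
  obtain ⟨b₁, -, h₁⟩ := exists_abs_fieldPairing_le hA.isCompact (integrable_dt hφ hc) hη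
  choose b₂ _ h₂ using fun l =>
    exists_abs_fieldPairing_le hA.isCompact (integrable_dx hφ hc l) (hq l)
  obtain ⟨b₃, -, h₃⟩ := exists_abs_fieldPairing_le hA.isCompact (integrable_slice hφ hc) hη
  refine ⟨b₁ + ∑ l, b₂ l + b₃, fun n ω => ?_⟩
  have hV := (hA.measurable_field n).comp (measurable_prodMk_left (x := ω))
  rw [hA.weakForm_eq]
  refine (abs_add_le _ _).trans (add_le_add ((abs_add_le _ _).trans (add_le_add
    (h₁ _ hV (hA.field_mem n ω)) ((Finset.abs_sum_le_sum_abs _ _).trans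
      (Finset.sum_le_sum fun l _ => h₂ l _ hV (hA.field_mem n ω))))) ?_)
  exact h₃ _ ((hA.measurable_initialField n).comp (measurable_prodMk_left (x := ω)))
    fun x => hA.initial_mem n ω _

/-- Only the initial term is rewritten through the law, matching the assumptions on the initial
data; the other expectations are left in the form in which their limits are known. -/
theorem integral_weakForm [IsProbabilityMeasure P]
    (hA : IsRandomApproximation F c h r K u₀ U V)
    (hφ : ContDiff ℝ 1 φ) (hc : HasCompactSupport φ) {η : E N → ℝ} (hη : Continuous η)
    {q : Fin d → E N → ℝ} (hq : ∀ l, Continuous (q l)) (n : ℕ) :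
    ∫ ω, weakForm (width c (h n)) φ (U n ω) η q ∂P =
      (∫ ω, fieldPairing (spaceTime d) (V n ω) (dt φ) η ∂P) +
      (∑ l, ∫ ω, fieldPairing (spaceTime d) (V n ω) (dx l φ) (q l) ∂P) +
      ∫ x, φ (x, 0) * ∫ ξ, η ξ ∂(law P (fun ω => cellwise (width c (h n)) (u₀ n ω)) x) := by
  have i1 := integrable_fieldPairing (Q := P) hA.isCompact (hA.measurable_field n)
    (hA.field_mem n) (integrable_dt hφ hc) hη
  have i2 := fun l => integrable_fieldPairing (Q := P) hA.isCompact (hA.measurable_field n)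
    (hA.field_mem n) (integrable_dx hφ hc l) (hq l)
  have hm : ∀ ω x, cellwise (width c (h n)) (u₀ n ω) x ∈ K := fun ω x => hA.initial_mem n ω _
  have i3 := integrable_fieldPairing (Q := P) hA.isCompact (hA.measurable_initialField n)
    hm (integrable_slice hφ hc) hη
  have i4 := integrable_finsetSum Finset.univ fun l _ => i2 l
  have i5 : Integrable (fun ω => fieldPairing (spaceTime d) (V n ω) (dt φ) η +
      ∑ l, fieldPairing (spaceTime d) (V n ω) (dx l φ) (q l)) P := i1.add i4
  simp_rw [hA.weakForm_eq]
  rw [integral_add i5 i3, integral_add i1 i4, integral_finsetSum _ fun l _ => i2 l,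
    integral_fieldPairing hA.isCompact (hA.measurable_initialField n) hm (integrable_slice hφ hc) hη]

variable {κ : Kernel (E d × ℝ) (E N)} [IsMarkovKernel κ] {σ : E d → Measure (E N)}

theorem integral_test_eq (hK : IsCompact K) (hκ : ∀ z, κ z Kᶜ = 0) (hφ : ContDiff ℝ 1 φ)
    (hc : HasCompactSupport φ) {η : E N → ℝ} (hη : Continuous η) {q : Fin d → E N → ℝ}
    (hq : ∀ l, Continuous (q l)) :
    Integrable (fun z => dt φ z * (∫ ξ, η ξ ∂(κ z)) + ∑ l, dx l φ z * ∫ ξ, q l ξ ∂(κ z))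
      (spaceTime d) ∧
    ∫ z, (dt φ z * (∫ ξ, η ξ ∂(κ z)) + ∑ l, dx l φ z * ∫ ξ, q l ξ ∂(κ z)) ∂(spaceTime d) =
      (∫ z, dt φ z * ∫ ξ, η ξ ∂(κ z) ∂(spaceTime d)) +
        ∑ l, ∫ z, dx l φ z * ∫ ξ, q l ξ ∂(κ z) ∂(spaceTime d) := by
  have key : ∀ {ψ : E d × ℝ → ℝ} {g : E N → ℝ}, Integrable ψ (spaceTime d) → Continuous g →
      Integrable (fun z => ψ z * ∫ ξ, g ξ ∂(κ z)) (spaceTime d) := fun hψ hg => by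
    obtain ⟨b, -, hb⟩ := exists_abs_le_on hK hg
    exact integrable_mul_of_abs_le hψ hg.stronglyMeasurable.integral_kernel.aestronglyMeasurable
      fun z => abs_integral_le_of_compl_eq_zero (hκ z) hb
  have i1 := key (integrable_dt hφ hc) hη
  have i2 := fun l => key (integrable_dx hφ hc l) (hq l)
  have i3 := integrable_finsetSum Finset.univ fun l _ => i2 l
  exact ⟨i1.add i3, by rw [integral_add i1 i3, integral_finsetSum _ fun l _ => i2 l]⟩

theorem tendsto_integral_fieldPairing_add
    (hmean : ∀ (ψ : E d × ℝ → ℝ) (g : E N → ℝ), Integrable ψ (spaceTime d) → Continuous g →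
      Tendsto (fun n => ∫ ω, fieldPairing (spaceTime d) (V n ω) ψ g ∂P) atTop
        (𝓝 (∫ z, ψ z * ∫ ξ, g ξ ∂(κ z) ∂(spaceTime d))))
    (hK : IsCompact K) (hκ : ∀ z, κ z Kᶜ = 0) (hφ : ContDiff ℝ 1 φ)
    (hc : HasCompactSupport φ) {η : E N → ℝ} (hη : Continuous η) {q : Fin d → E N → ℝ}
    (hq : ∀ l, Continuous (q l)) :
    Tendsto (fun n => (∫ ω, fieldPairing (spaceTime d) (V n ω) (dt φ) η ∂P) +
      ∑ l, ∫ ω, fieldPairing (spaceTime d) (V n ω) (dx l φ) (q l) ∂P) atTop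
      (𝓝 (∫ z, (dt φ z * (∫ ξ, η ξ ∂(κ z)) + ∑ l, dx l φ z * ∫ ξ, q l ξ ∂(κ z))
        ∂(spaceTime d))) := by
  rw [(integral_test_eq hK hκ hφ hc hη hq).2]
  exact (hmean _ _ (integrable_dt hφ hc) hη).add
    (tendsto_finsetSum _ fun l _ => hmean _ _ (integrable_dx hφ hc l) (hq l))

variable [IsProbabilityMeasure P]

/-- The limit of the expectations satisfies the entropy inequality. -/
theorem entropyInequality (hA : IsRandomApproximation F c h r K u₀ U V)
    (hF : IsConsistentFlux F f) (hf : ∀ l, Continuous (f l))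
    (hmean : ∀ (ψ : E d × ℝ → ℝ) (g : E N → ℝ), Integrable ψ (spaceTime d) → Continuous g →
      Tendsto (fun n => ∫ ω, fieldPairing (spaceTime d) (V n ω) ψ g ∂P) atTop
        (𝓝 (∫ z, ψ z * ∫ ξ, g ξ ∂(κ z) ∂(spaceTime d))))
    (hκ : ∀ z, κ z Kᶜ = 0) (e : EntropyPair f) {s : ℕ}
    {Q : ℝ → Fin d → (Stencil d s → E N) → ℝ} (hQ : IsConsistentFlux Q e.q)
    (hineq : ∀ n ω i, ∀ᵐ t ∂(volume.restrict (Ioi (0 : ℝ))),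
      deriv (fun τ => e.η (U n ω i τ)) t +
        fluxDifference (width c (h n)) (Q (h n)) (U n ω) i t ≤ 0)
    (hinit : ∀ ψ : E d → ℝ, ContDiff ℝ 1 ψ → HasCompactSupport ψ → (∀ x, 0 ≤ ψ x) →
      limsup (fun n => ((∫ x, ψ x * (∫ ξ, e.η ξ
        ∂(law P (fun ω => cellwise (width c (h n)) (u₀ n ω)) x)) : ℝ) : EReal)) atTop
        ≤ ((∫ x, ψ x * (∫ ξ, e.η ξ ∂(σ x)) : ℝ) : EReal)) :
    EntropyInequality e σ κ := by
  intro φ hφ hc hpos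
  have hη : LocallyLipschitz e.η := e.convex.locallyLipschitz
  have hq := fun l => (e.lipschitz l).continuous
  refine le_of_forall_pos_le_add fun δ hδ => ?_
  obtain ⟨b, hb⟩ := hA.exists_abs_weakForm_le hφ hc hη.continuous hq
  have h1 := eventually_neg_le_integral (P := P)
    (hA.measurable_weakForm hφ hc hη.continuous hq) hb (fun ω =>
      weakForm_lower_bound hφ hc hA.ratio_pos hA.mesh_pos hA.tendsto_mesh hA.isCompact
        (fun n => hA.measurable_time n ω) (fun n => hA.mem n ω) (fun n => hA.lipschitz hF hf n ω)
        hA.one_le (hA.weakBV ω) hη hq hQ fun n i => by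
          filter_upwards [hineq n ω i, ae_restrict_mem measurableSet_Ioi] with t ht ht0 x
          exact mul_nonpos_of_nonneg_of_nonpos (hpos x t (mem_Ioi.1 ht0).le) ht)
    (show 0 < δ / 3 by positivity)
  have h2 := (tendsto_integral_fieldPairing_add hmean hA.isCompact hκ hφ hc hη.continuous
    hq).eventually (gt_mem_nhds (lt_add_of_pos_right _ (show 0 < δ / 3 by positivity)))
  -- The initial term is controlled from above only, which is the direction needed. The three
  -- tolerances δ / 3 are then met at one common `n`.
  have h3 := eventually_lt_of_limsup_lt ((hinit (fun x => φ (x, 0))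
    (hφ.comp (by fun_prop)) (hasCompactSupport_slice hc 0) fun x => hpos x 0 le_rfl).trans_lt
    (EReal.coe_lt_coe (lt_add_of_pos_right _ (show 0 < δ / 3 by positivity))))
  obtain ⟨n, h1, h2, h3⟩ := (h1.and (h2.and h3)).exists
  rw [hA.integral_weakForm hφ hc hη.continuous hq] at h1
  have h4 := EReal.coe_lt_coe_iff.1 h3
  linarith

/-- The limit of the expectations is a measure-valued solution. -/
theorem isMVSolution (hA : IsRandomApproximation F c h r K u₀ U V)
    (hF : IsConsistentFlux F f) (hf : ∀ l, Continuous (f l))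
    (hmean : ∀ (ψ : E d × ℝ → ℝ) (g : E N → ℝ), Integrable ψ (spaceTime d) → Continuous g →
      Tendsto (fun n => ∫ ω, fieldPairing (spaceTime d) (V n ω) ψ g ∂P) atTop
        (𝓝 (∫ z, ψ z * ∫ ξ, g ξ ∂(κ z) ∂(spaceTime d))))
    (hκ : ∀ z, κ z Kᶜ = 0)
    (hinit : ∀ ψ : E d → ℝ, ContDiff ℝ 1 ψ → HasCompactSupport ψ →
      Tendsto (fun n => ∫ x, ψ x • (∫ ξ, ξ
        ∂(law P (fun ω => cellwise (width c (h n)) (u₀ n ω)) x))) atTop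
        (𝓝 (∫ x, ψ x • (∫ ξ, ξ ∂(σ x))))) :
    IsMVSolution f σ κ := by
  intro φ hφ hc
  have hcoord : ∀ k : Fin N, Continuous fun ξ : E N => ξ k := fun k => by fun_prop
  have hfk : ∀ (k : Fin N) l, Continuous fun ξ : E N => f l ξ k := fun k l =>
    (hcoord k).comp (hf l)
  have hint : ∀ {g : E N → E N}, Continuous g → ∀ z (k : Fin N),
      (∫ ξ, g ξ ∂(κ z)) k = ∫ ξ, g ξ k ∂(κ z) := fun hg z k =>
    eval_integral_piLp (fun k => integrable_of_compl_eq_zero hA.isCompact (hκ z)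
      ((hcoord k).comp hg)) k
  ext k
  have hη := hcoord k
  have h0 : Tendsto (fun n => ∫ ω, weakForm (width c (h n)) φ (U n ω) (fun ξ => ξ k)
      (fun l ξ => f l ξ k) ∂P) atTop (𝓝 0) := by
    obtain ⟨b, hb⟩ := hA.exists_abs_weakForm_le hφ hc hη (hfk k)
    rw [← integral_zero Ω ℝ (μ := P)]
    exact tendsto_integral_of_dominated_convergence (fun _ => b)
      (fun n => (hA.measurable_weakForm hφ hc hη (hfk k) n).aestronglyMeasurable)
      (integrable_const b) (fun n => ae_of_all _ (hb n)) (ae_of_all _ fun ω =>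
        tendsto_weakForm_coordinate hφ hc hA.ratio_pos hA.mesh_pos hA.tendsto_mesh hA.isCompact
          (fun n => hA.measurable_time n ω) (fun n => hA.mem n ω)
          (fun n => hA.lipschitz hF hf n ω) hA.one_le (hA.weakBV ω) hf hF
          (fun n => hA.solution n ω) k)
  have h1 := tendsto_integral_fieldPairing_add hmean hA.isCompact hκ hφ hc hη (hfk k)
  have h2 := ((hcoord k).tendsto _).comp (hinit (fun x => φ (x, 0))
    (hφ.comp (by fun_prop)) (hasCompactSupport_slice hc 0))
  have h3 : ∀ n, (∫ x, φ (x, 0) • (∫ ξ, ξ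
      ∂(law P (fun ω => cellwise (width c (h n)) (u₀ n ω)) x))) k =
      ∫ x, φ (x, 0) * (∫ ξ, ξ k
        ∂(law P (fun ω => cellwise (width c (h n)) (u₀ n ω)) x)) := fun n => by
    have hm : ∀ x, Measurable fun ω => cellwise (width c (h n)) (u₀ n ω) x := fun x =>
      (hA.measurable_initialField n).comp (measurable_prodMk_right (y := x))
    have hlaw : ∀ x, ∫ ξ, ξ ∂(law P (fun ω => cellwise (width c (h n)) (u₀ n ω)) x) =
        ∫ ω, u₀ n ω (cellIndex (width c (h n)) x) ∂P := fun x =>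
      integral_law (hm x) continuous_id'
    have hlawk : ∀ x k, ∫ ξ, ξ k ∂(law P (fun ω => cellwise (width c (h n)) (u₀ n ω)) x) =
        ∫ ω, u₀ n ω (cellIndex (width c (h n)) x) k ∂P := fun x k =>
      integral_law (hm x) (hcoord k)
    choose b _ hb using fun k : Fin N => exists_abs_le_on hA.isCompact (hcoord k)
    have hintk : ∀ i (k : Fin N), (∫ ω, u₀ n ω i ∂P) k = ∫ ω, u₀ n ω i k ∂P := fun i k =>
      eval_integral_piLp (fun k => integrable_of_abs_le ((hcoord k).measurable.comp
        ((measurable_pi_apply i).comp (hA.measurable_initial n)))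
        fun ω => hb k _ (hA.initial_mem n ω i)) k
    have hslice : Continuous fun x : E d => φ (x, 0) := hφ.continuous.comp (by fun_prop)
    rw [eval_integral_piLp]
    · simp only [hlaw, hlawk, PiLp.smul_apply, hintk, smul_eq_mul]
    · intro k
      simp only [hlaw, PiLp.smul_apply, hintk, smul_eq_mul]
      refine integrable_mul_cellwise_space hslice (hasCompactSupport_slice hc 0) _
        (a := fun i => ∫ ω, u₀ n ω i k ∂P) (b := b k) fun i => ?_
      have := norm_integral_le_of_norm_le_const (μ := P) (f := fun ω => u₀ n ω i k)
        (ae_of_all _ fun ω => hb k _ (hA.initial_mem n ω i))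
      simpa using this
  have h4 := (h1.add h2).congr fun n => by
    rw [Function.comp_apply, h3, ← hA.integral_weakForm hφ hc hη (hfk k)]
  -- The expected weak form has two limits: the weak form of `κ`, by convergence of the means, and
  -- zero, by consistency of the scheme.
  have h5 := tendsto_nhds_unique h4 h0
  rw [PiLp.add_apply, eval_integral_piLp, PiLp.zero_apply]
  · refine (congrArg (· + _) ?_).trans h5
    refine integral_congr_ae (ae_of_all _ fun z => ?_)
    simp [hint continuous_id', hint (hf _)]
  · intro k
    refine (integral_test_eq hA.isCompact hκ hφ hc (hcoord k) (hfk k)).1.congr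
      (ae_of_all _ fun z => ?_)
    simp [hint continuous_id', hint (hf _)]

end IsRandomApproximation

end RandomConsistency

end EMV

namespace EMV

/-! ### Bounded versions of the approximations -/

section Clip

variable {d N p : ℕ}

/-- Truncation of values outside the ball of radius `R`. -/
noncomputable def clip (R : ℝ) (ξ : E N) : E N := if ‖ξ‖ ≤ R then ξ else 0

theorem measurable_clip (R : ℝ) : Measurable (clip (N := N) R) :=
  Measurable.ite (measurableSet_le measurable_norm measurable_const) measurable_id measurable_const

theorem clip_mem {R : ℝ} (hR : 0 ≤ R) (ξ : E N) : clip R ξ ∈ Metric.closedBall (0 : E N) R := by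
  rw [mem_closedBall_zero_iff, clip]
  split_ifs with h
  · exact h
  · simpa using hR

/-- The truncated approximation, as a function of the initial data. -/
noncomputable def clippedField (R : ℝ) (w : Fin d → ℝ) (S : (Grid d → E N) → Grid d → ℝ → E N)
    (a : Grid d → E N) (z : E d × ℝ) : E N :=
  clip R (cellwiseST w (S a) z)

variable {R : ℝ} {w : Fin d → ℝ} {S : (Grid d → E N) → Grid d → ℝ → E N}

theorem measurable_uncurry_cellwiseST (w : Fin d → ℝ)
    (hS : ∀ i, Measurable fun a : (Grid d → E N) × ℝ => S a.1 i a.2) :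
    Measurable (Function.uncurry fun a => cellwiseST w (S a)) := by
  have h1 : Measurable fun b : ((Grid d → E N) × ℝ) × Grid d => S b.1.1 b.2 b.1.2 :=
    measurable_from_prod_countable_left hS
  exact h1.comp ((measurable_fst.prodMk (measurable_snd.comp measurable_snd)).prodMk
    ((measurable_cellIndex w).comp (measurable_fst.comp measurable_snd)))

theorem measurable_clippedField (R : ℝ) (w : Fin d → ℝ)
    (hS : ∀ i, Measurable fun a : (Grid d → E N) × ℝ => S a.1 i a.2) :
    Measurable (Function.uncurry (clippedField R w S)) :=
  (measurable_clip R).comp (measurable_uncurry_cellwiseST w hS)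

theorem measurable_uncurry_comp_left {A X Y Ω : Type*} [MeasurableSpace A] [MeasurableSpace X]
    [MeasurableSpace Y] [MeasurableSpace Ω] {G : A → X → Y} (hG : Measurable (Function.uncurry G))
    {u : Ω → A} (hu : Measurable u) : Measurable (Function.uncurry fun ω => G (u ω)) :=
  hG.comp ((hu.comp measurable_fst).prodMk measurable_snd)

theorem ae_norm_le_of_eLpNorm_top_le {X : Type*} [MeasurableSpace X] {μ : Measure X} {g : X → E N}
    {C : ℝ} (hg : eLpNorm g ⊤ μ ≤ ENNReal.ofReal C) : ∀ᵐ z ∂μ, ‖g z‖ ≤ max C 0 := by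
  rw [eLpNorm_exponent_top] at hg
  filter_upwards [enorm_ae_le_eLpNormEssSup g μ] with z hz
  have h1 := hz.trans hg
  rw [← ofReal_norm] at h1
  by_cases hC : 0 ≤ C
  · exact ((ENNReal.ofReal_le_ofReal_iff hC).1 h1).trans (le_max_left _ _)
  · rw [ENNReal.ofReal_of_nonpos (not_le.1 hC).le, nonpos_iff_eq_zero, ENNReal.ofReal_eq_zero] at h1
    exact h1.trans (le_max_right _ _)

theorem cellwiseST_ae_eq_clippedField {a : Grid d → E N}
    (ha : ∀ᵐ z ∂(spaceTime d), ‖cellwiseST w (S a) z‖ ≤ R) :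
    cellwiseST w (S a) =ᵐ[spaceTime d] clippedField R w S a :=
  ha.mono fun _ hz => (if_pos hz).symm

/-- Each cell has positive volume, so some point of it sees the bound at almost every time;
continuity extends it to every time. At time zero this bounds the initial data. -/
theorem norm_le_of_ae_norm_le (hw : ∀ l, 0 < w l) {u : Grid d → ℝ → E N}
    (hu : ∀ i, ContinuousOn (u i) (Ici 0))
    (hR : ∀ᵐ z ∂(spaceTime d), ‖cellwiseST w u z‖ ≤ R) (i : Grid d) {t : ℝ} (ht : 0 ≤ t) :
    ‖u i t‖ ≤ R := by
  rw [spaceTime_eq_prod] at hR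
  have h1 := Measure.ae_ae_of_ae_prod hR
  have h2 : volume (cellIndex w ⁻¹' {i}) ≠ 0 := by
    rw [volume_cell hw]
    exact (ENNReal.ofReal_pos.2 (Finset.prod_pos fun l _ => hw l)).ne'
  obtain ⟨x, hx, hxi⟩ : ∃ x, (∀ᵐ t ∂(volume.restrict (Ici (0 : ℝ))),
      ‖cellwiseST w u (x, t)‖ ≤ R) ∧ cellIndex w x = i := by
    by_contra! hcon
    exact h2 (measure_mono_null (fun x hx h => hcon x h hx) (ae_iff.1 h1))
  have h3 : (fun t => max ‖u i t‖ R) =ᵐ[volume.restrict (Ici (0 : ℝ))] fun _ => R := by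
    filter_upwards [hx] with t ht
    rw [cellwiseST, hxi] at ht
    exact max_eq_right ht
  have h4 := Measure.eqOn_of_ae_eq h3 ((hu i).norm.sup continuousOn_const) continuousOn_const
    (by rw [interior_Ici, closure_Ioi])
  exact max_eq_right_iff.1 (h4 ht)

/-- A property that holds almost everywhere for random data with a given law. -/
theorem ae_cellwiseST_ae_eq_clippedField {Ω Ω' : Type*} [MeasurableSpace Ω] [MeasurableSpace Ω']
    {P : Measure Ω} {P' : Measure Ω'}
    (hS : ∀ i, Measurable fun a : (Grid d → E N) × ℝ => S a.1 i a.2) {u : Ω → Grid d → E N}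
    {v : Ω' → Grid d → E N} (hvu : IdentDistrib v u P' P)
    (hu : ∀ ω, cellwiseST w (S (u ω)) =ᵐ[spaceTime d] clippedField R w S (u ω)) :
    ∀ᵐ ω ∂P', cellwiseST w (S (v ω)) =ᵐ[spaceTime d] clippedField R w S (v ω) := by
  have h1 : MeasurableSet {b : (Grid d → E N) × (E d × ℝ) |
      cellwiseST w (S b.1) b.2 = clippedField R w S b.1 b.2} :=
    measurableSet_eq_fun (measurable_uncurry_cellwiseST w hS) (measurable_clippedField R w hS)
  -- Since the good data form a measurable set, having good data almost surely is a property of the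
  -- law alone and passes to the independent copies.
  have h2 : MeasurableSet {a | cellwiseST w (S a) =ᵐ[spaceTime d] clippedField R w S a} :=
    measurable_measure_prodMk_left (ν := spaceTime d) h1.compl (measurableSet_singleton 0)
  rw [← ae_map_iff hvu.aemeasurable_fst h2, hvu.map_eq, ae_map_iff hvu.aemeasurable_snd h2]
  exact ae_of_all _ hu

instance : NeZero (spaceTime d) := by
  refine ⟨fun h => ?_⟩
  have h1 : spaceTime d (univ ×ˢ univ) = 0 := by rw [h]; rfl
  rw [spaceTime_eq_prod, Measure.prod_prod, mul_eq_zero] at h1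
  rcases h1 with h1 | h1
  · exact isOpen_univ.measure_ne_zero volume univ_nonempty h1
  · simp at h1

end Clip

/-! ### Sample averages -/

section SampleAverage

variable {d N : ℕ}

theorem sampleAverage_eq_avg {A Ω : Type*} {V : A → E d × ℝ → E N} {v : ℕ → Ω → A} {ω : Ω}
    {U : ℕ → E d × ℝ → E N} (hU : ∀ k, U k =ᵐ[spaceTime d] V (v k ω)) (ψ : E d × ℝ → ℝ)
    (g : E N → ℝ) (M : ℕ) :
    sampleAverage ψ g U M = avg (samplePairing (spaceTime d) V v ψ g) M ω := by
  unfold sampleAverage avg samplePairing fieldPairing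
  congr 1
  exact Finset.sum_congr rfl fun k _ =>
    integral_congr_ae ((hU k).mono fun z hz => by simp only [hz])

theorem integral_empirical {X : Type*} [MeasurableSpace X] {U : ℕ → X → E N} (g : E N → ℝ)
    (M : ℕ) (z : X) :
    ∫ ξ, g ξ ∂(empirical U M z) = (M : ℝ)⁻¹ * ∑ k ∈ Finset.range M, g (U k z) := by
  rw [empirical, integral_smul_measure, integral_finsetSum_measure fun k _ =>
    integrable_dirac (by simp)]
  simp [ENNReal.toReal_inv]

theorem integral_mul_empirical {U : ℕ → E d × ℝ → E N} (hU : ∀ k, Measurable (U k))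
    {ψ : E d × ℝ → ℝ} (hψ : Integrable ψ (spaceTime d)) (g : C₀(E N, ℝ)) (M : ℕ) :
    ∫ z, ψ z * (∫ ξ, g ξ ∂(empirical U M z)) ∂(spaceTime d) = sampleAverage ψ g U M := by
  have h1 : ∀ k, Integrable (fun z => ψ z * g (U k z)) (spaceTime d) := fun k =>
    integrable_mul_of_abs_le (b := ‖g.toBCF‖) hψ
      ((map_continuous g).measurable.comp (hU k)).aestronglyMeasurable
      fun z => g.toBCF.norm_coe_le_norm _
  unfold sampleAverage
  rw [← integral_finsetSum _ fun k _ => h1 k, ← integral_const_mul]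
  refine integral_congr_ae (ae_of_all _ fun z => ?_)
  simp only
  rw [integral_empirical, Finset.mul_sum, Finset.mul_sum, Finset.mul_sum]
  exact Finset.sum_congr rfl fun k _ => by ring

end SampleAverage

end EMV

/-! ### Assembly: convergence of the Monte Carlo approximations -/

theorem mainTheorem8
    {d N p : ℕ}
    -- the conservation law, the initial Young measure, and the entropies
    (f : Fin d → E N → E N) (hf : ∀ l, ContDiff ℝ 1 (f l))
    (σ : E d → Measure (E N)) (hσ : IsYoungMeasure σ)
    (hσ_id : LocallyIntegrablePairing σ (fun ξ : E N => ξ))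
    (𝓔 : Set (EntropyPair f)) (hσ_η : ∀ e ∈ 𝓔, LocallyIntegrablePairing σ e.η)
    -- the mesh ratios, the numerical flux, and the evolution operator of the scheme
    (c : Fin d → ℝ) (hc : ∀ l, 0 < c l)
    (F : ℝ → Fin d → (Stencil d p → E N) → E N) (hF : IsConsistentFlux F f)
    (S : ℝ → (Grid d → E N) → Grid d → ℝ → E N)
    (hS_meas : ∀ Δx > 0, ∀ i, Measurable fun a : (Grid d → E N) × ℝ => S Δx a.1 i a.2)
    -- the random initial data, and its independent samples
    {Ω Ω' : Type*} [MeasurableSpace Ω] [MeasurableSpace Ω']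
    (P : Measure Ω) [IsProbabilityMeasure P] (P' : Measure Ω') [IsProbabilityMeasure P']
    (u₀ : ℝ → Ω → Grid d → E N) (hu₀_meas : ∀ Δx > 0, Measurable (u₀ Δx))
    (v₀ : ℝ → ℕ → Ω' → Grid d → E N) (hv₀_meas : ∀ Δx > 0, ∀ k, Measurable (v₀ Δx k))
    (hv₀_indep : ∀ Δx > 0, iIndepFun (v₀ Δx) P')
    (hv₀_law : ∀ Δx > 0, ∀ k, IdentDistrib (v₀ Δx k) (u₀ Δx) P' P)
    (hS_u : ∀ Δx > 0, ∀ ω,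
      IsSchemeSolution (width c Δx) (F Δx) (u₀ Δx ω) (S Δx (u₀ Δx ω)))
    (hS_v : ∀ Δx > 0, ∀ k ω,
      IsSchemeSolution (width c Δx) (F Δx) (v₀ Δx k ω) (S Δx (v₀ Δx k ω)))
    -- uniform boundedness
    (C : ℝ) (h_bdd : ∀ Δx > 0, ∀ ω,
      eLpNorm (cellwiseST (width c Δx) (S Δx (u₀ Δx ω))) ⊤ (spaceTime d) ≤ ENNReal.ofReal C)
    -- weak BV
    (r : ℝ) (hr : 1 ≤ r) (h_bv : WeakBV c r fun Δx ω => S Δx (u₀ Δx ω))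
    -- entropy consistency
    (h_ent : ∀ e ∈ 𝓔, IsEntropyStable c (fun Δx ω => S Δx (u₀ Δx ω)) e)
    -- consistency with the initial data
    (h_init : InitialMeanConsistent
      (fun Δx => law P fun ω => cellwise (width c Δx) (u₀ Δx ω)) σ)
    (h_init_ent : ∀ e ∈ 𝓔, InitialEntropyConsistent
      (fun Δx => law P fun ω => cellwise (width c Δx) (u₀ Δx ω)) σ e.η)
    -- a sequence of mesh sizes
    (h : ℕ → ℝ) (h_pos : ∀ n, 0 < h n) (h_lim : Tendsto h atTop (𝓝 0)) :
    ∃ (j : ℕ → ℕ) (ν : E d × ℝ → Measure (E N)), StrictMono j ∧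
      IsEMVSolution f 𝓔 σ ν ∧ IsUniformlyBounded ν ∧
      -- weak* convergence of the Monte Carlo approximations, almost surely
      (∃ M : ℕ → ℕ, StrictMono M ∧ (∀ n, 0 < M n) ∧
        ∀ᵐ ω ∂P', WeakStarTendsto (spaceTime d)
          (fun n => empirical
            (fun k => cellwiseST (width c (h (j n))) (S (h (j n)) (v₀ (h (j n)) k ω))) (M n))
          ν) ∧
      -- the iterated limit, almost surely: first `M → ∞`, then `Δx → 0`
      (∀ᵐ ω ∂P', ∀ (ψ : E d × ℝ → ℝ) (g : E N → ℝ), Integrable ψ (spaceTime d) → Continuous g →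
        ∃ L : ℕ → ℝ,
          (∀ n, Tendsto
            (fun M => sampleAverage ψ g
              (fun k => cellwiseST (width c (h (j n))) (S (h (j n)) (v₀ (h (j n)) k ω))) M)
            atTop (𝓝 (L n))) ∧
          Tendsto L atTop (𝓝 (∫ z, ψ z * (∫ ξ, g ξ ∂(ν z)) ∂(spaceTime d)))) ∧
      -- the two limits are interchangeable
      (∀ (ψ : E d × ℝ → ℝ) (g : E N → ℝ), Integrable ψ (spaceTime d) → Continuous g →
        let A : ℕ → ℕ → Ω' → ℝ := fun n M ω => sampleAverage ψ g
          (fun k => cellwiseST (width c (h (j n))) (S (h (j n)) (v₀ (h (j n)) k ω))) M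
        let I : ℝ := ∫ z, ψ z * (∫ ξ, g ξ ∂(ν z)) ∂(spaceTime d)
        -- the double limit exists in mean square
        Tendsto (fun nM : ℕ × ℕ => ∫ ω, (A nM.1 nM.2 ω - I) ^ 2 ∂P') (atTop ×ˢ atTop) (𝓝 0) ∧
        -- first `Δx → 0`, then `M → ∞`, in distribution
        (∀ b : ℝ →ᵇ ℝ, ∃ L : ℕ → ℝ,
          (∀ M, Tendsto (fun n => ∫ ω, b (A n M ω) ∂P') atTop (𝓝 (L M))) ∧
          Tendsto L atTop (𝓝 (b I))) ∧
        -- first `Δx → 0`, then `M → ∞`, almost surely, if the inner limits exist in probability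
        (∀ B : ℕ → Ω' → ℝ,
          (∀ M, TendstoInMeasure P' (fun n => A n M) atTop (B M)) →
          ∀ᵐ ω ∂P', Tendsto (fun M => B M ω) atTop (𝓝 I))) := by
  set R : ℝ := max C 0
  have hR : 0 ≤ R := le_max_right _ _
  have hK : IsCompact (Metric.closedBall (0 : E N) R) := isCompact_closedBall _ _
  have hw : ∀ Δx > 0, ∀ l, 0 < width c Δx l := fun Δx hΔ l => mul_pos (hc l) hΔ
  have hf' := fun l => (hf l).continuous
  have hbd : ∀ Δx > 0, ∀ ω,
      ∀ᵐ z ∂(spaceTime d), ‖cellwiseST (width c Δx) (S Δx (u₀ Δx ω)) z‖ ≤ R :=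
    fun Δx hΔ ω => ae_norm_le_of_eLpNorm_top_le (h_bdd Δx hΔ ω)
  have hQ : ∀ n, IsProbabilityMeasure (P.map (u₀ (h n))) := fun n =>
    Measure.isProbabilityMeasure_map (hu₀_meas _ (h_pos n)).aemeasurable
  have hV := fun n => measurable_clippedField R (width c (h n)) (hS_meas (h n) (h_pos n))
  -- The truncated evolution operator is regarded as a random field on the space of grid data
  -- itself, with the law of the data as probability. Truncation places its values in the ball for
  -- all data, including data for which no bound is assumed.
  obtain ⟨j, κ, hj, hκ, hκK, hMC⟩ := exists_subseq_isMonteCarloLimit (μ := spaceTime d) (P := P')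
    hK ⟨0, by simpa using hR⟩ (Q := fun n => P.map (u₀ (h n)))
    (V := fun n => clippedField R (width c (h n)) (S (h n))) hV (fun n a z => clip_mem hR _)
    (v := fun n => v₀ (h n)) (fun n k => hv₀_meas _ (h_pos n) k) (fun n => hv₀_indep _ (h_pos n))
    fun n k => (hv₀_law _ (h_pos n) k).map_eq
  have hmesh : Tendsto (fun n => h (j n)) atTop (𝓝[>] 0) :=
    tendsto_nhdsWithin_iff.2 ⟨h_lim.comp hj.tendsto_atTop, Eventually.of_forall fun n => h_pos _⟩
  have hA : IsRandomApproximation F c (fun n => h (j n)) r (Metric.closedBall (0 : E N) R)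
      (fun n => u₀ (h (j n))) (fun n ω => S (h (j n)) (u₀ (h (j n)) ω))
      fun n ω => clippedField R (width c (h (j n))) (S (h (j n))) (u₀ (h (j n)) ω) :=
    { ratio_pos := hc
      mesh_pos := fun n => h_pos _
      tendsto_mesh := h_lim.comp hj.tendsto_atTop
      isCompact := hK
      measurable_time := fun n ω i =>
        (hS_meas _ (h_pos _) i).comp (measurable_prodMk_left (x := u₀ (h (j n)) ω))
      mem := fun n ω i t ht => mem_closedBall_zero_iff.2
        (norm_le_of_ae_norm_le (hw _ (h_pos _)) (hS_u _ (h_pos _) ω).continuousOn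
          (hbd _ (h_pos _) ω) i ht)
      solution := fun n ω => hS_u _ (h_pos _) ω
      one_le := hr
      weakBV := fun ω T hT => (h_bv T hT ω).comp hmesh
      measurable_initial := fun n => hu₀_meas _ (h_pos _)
      measurable_field := fun n => measurable_uncurry_comp_left (hV (j n)) (hu₀_meas _ (h_pos _))
      field_mem := fun n ω z => clip_mem hR _
      field_ae_eq := fun n ω => cellwiseST_ae_eq_clippedField (hbd _ (h_pos _) ω) }
  have hmean : ∀ (ψ : E d × ℝ → ℝ) (g : E N → ℝ), Integrable ψ (spaceTime d) → Continuous g →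
      Tendsto (fun n => ∫ ω, fieldPairing (spaceTime d)
        (clippedField R (width c (h (j n))) (S (h (j n))) (u₀ (h (j n)) ω)) ψ g ∂P) atTop
        (𝓝 (∫ z, ψ z * ∫ ξ, g ξ ∂(κ z) ∂(spaceTime d))) := fun ψ g hψ hg =>
    (hMC.mean ψ g hψ hg).congr fun n => integral_map (hu₀_meas _ (h_pos _)).aemeasurable
      (measurable_fieldPairing (hV (j n)) hψ.1 hg).aestronglyMeasurable
  -- The bound is assumed for the original data only; its transfer to the samples, through equality
  -- of laws, holds almost surely.
  have hae : ∀ᵐ ω ∂P', ∀ n k, cellwiseST (width c (h (j n))) (S (h (j n)) (v₀ (h (j n)) k ω))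
      =ᵐ[spaceTime d] clippedField R (width c (h (j n))) (S (h (j n))) (v₀ (h (j n)) k ω) :=
    ae_all_iff.2 fun n => ae_all_iff.2 fun k =>
      ae_cellwiseST_ae_eq_clippedField (hS_meas _ (h_pos _)) (hv₀_law _ (h_pos _) k) fun ω =>
        cellwiseST_ae_eq_clippedField (hbd _ (h_pos _) ω)
  have hsample : ∀ᵐ ω ∂P', ∀ (ψ : E d × ℝ → ℝ) (g : E N → ℝ) n M, sampleAverage ψ g
      (fun k => cellwiseST (width c (h (j n))) (S (h (j n)) (v₀ (h (j n)) k ω))) M =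
      avg (samplePairing (spaceTime d) (clippedField R (width c (h (j n))) (S (h (j n))))
        (v₀ (h (j n))) ψ g) M ω :=
    hae.mono fun ω hω ψ g n M => sampleAverage_eq_avg (hω n) ψ g M
  -- The deterministic sample sizes (n + 1)² are those that make the variances summable.
  refine ⟨j, κ, hj, ⟨⟨fun z => inferInstance, fun g =>
    (map_continuous g).stronglyMeasurable.integral_kernel.measurable⟩, ?_, fun e he => ?_⟩,
    ⟨_, hK, hκK⟩, ⟨fun n => (n + 1) ^ 2, fun a b hab => Nat.pow_lt_pow_left (by omega) two_ne_zero,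
      fun n => by positivity, ?_⟩, ?_, fun ψ g hψ hg => ⟨?_, fun b => ?_, fun B hB => ?_⟩⟩
  · exact hA.isMVSolution hF hf' hmean hκK fun ψ hψ hψc => (h_init ψ hψ hψc).comp hmesh
  · obtain ⟨s, Q, hQ, hineq⟩ := h_ent e he
    refine hA.entropyInequality hF hf' hmean hκK e hQ
      (fun n ω i => hineq _ (h_pos _) ω i) fun ψ hψ hψc hψ0 => ?_
    -- The upper limit along the chosen mesh sizes is at most the one over all mesh sizes tending to
    -- zero.
    exact (limsup_le_limsup_of_le (f := map (fun n => h (j n)) atTop) hmesh).trans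
      (h_init_ent e he ψ hψ hψc hψ0)
  · filter_upwards [hMC.diagonal, hsample] with ω h1 h2 g ψ hψ
    refine (h1 ψ g hψ (map_continuous g)).congr fun n => ?_
    have h3 : ∀ k, Measurable (cellwiseST (width c (h (j n))) (S (h (j n)) (v₀ (h (j n)) k ω))) :=
      fun k => (measurable_uncurry_cellwiseST _ (hS_meas _ (h_pos _))).comp measurable_prodMk_left
    exact (h2 ψ g n _).symm.trans (integral_mul_empirical h3 hψ g _).symm
  · filter_upwards [hMC.iterated, hsample] with ω h1 h2 ψ g hψ hg
    exact ⟨_, fun n => (h1 ψ g hψ hg n).congr fun M => (h2 ψ g n M).symm, hMC.mean ψ g hψ hg⟩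
  · refine (hMC.meanSquare ψ g hψ hg).congr fun nM => integral_congr_ae ?_
    filter_upwards [hsample] with ω h2
    simp only [h2]
  · obtain ⟨L, h1, h2⟩ := hMC.inDistribution ψ g hψ hg b
    refine ⟨L, fun M => (h1 M).congr fun n => integral_congr_ae ?_, h2⟩
    filter_upwards [hsample] with ω h2
    simp only [h2]
  · refine hMC.almostSure ψ g hψ hg B fun M => (hB M).congr_left fun n => ?_
    filter_upwards [hsample] with ω h2
    exact h2 ψ g n M
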